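/- **Setting.** A 2-colex is a connected graph cellularly embedded in a closed oriented surface of arbitrary genus such that every vertex has degree $3$ and the faces can be coloured with $3$ colours, faces on the two sides of an edge having different colours. Let $V$ and $F$ be its numbers of vertices and faces. For an inverse temperature $\beta\in\mathbb R$ and couplings $J_a\in\mathbb R$ (one per vertex $a$), the 3-body Ising model has a spin $\sigma_f\in\{1,-1\}$ on every face $f$, energy $H(\sigma)=-\sum_a J_a\,\sigma_{f_a}\sigma_{g_a}\sigma_{h_a}$, where $f_a,g_a,h_a$ are the three faces at $a$, and partition function $\mathcal Z=\sum_\sigma e^{-\beta H(\sigma)}$. Put $$\gamma=\sqrt{2^{F+2}}\prod_a\sqrt{e^{2\beta J_a}+e^{-2\beta J_a}},\qquad A_a=\frac{1}{\sqrt{e^{2\beta J_a}+e^{-2\beta J_a}}}\begin{pmatrix}e^{\beta J_a}&e^{-\beta J_a}\\ e^{-\beta J_a}&-e^{\beta J_a}\end{pmatrix}.$$ Place a qubit on each vertex. The colour code state is $|\Omega\rangle=N^{-1}\prod_f(I+X_f)|0\cdots0\rangle$, where $X_f$ is the tensor product of the Pauli matrices $X$ over the vertices of $f$ and $N>0$ normalizes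 the vector. The model of computation is a classically controlled quantum computer with a register of $V$ qubits: one step is an elementary operation of a random access machine with exact real arithmetic (including $\exp$ and $\sqrt{\ }$) at unit cost, or one elementary gate (an arbitrary single-qubit unitary or a CNOT), or the reset of a qubit to $|0\rangle$, or the measurement of a qubit in the computational basis. The input consists of $V$, $F$, the $V\times F$ vertex-face incidence matrix, $\beta$, the $J_a$, an error parameter $\epsilon$ and a success probability $p$. **Theorem (Quantum algorithm for $\mathcal Z$).** There is a single program for this machine that, for all 2-colexes, all $\beta$ and $J_a$, and all $\epsilon>0$ and $0<p<1$, halts after $$O\Big(V^3\cdot\frac1{\epsilon^2}\cdot\log\frac1{1-p}\Big)$$ steps and outputs an estimate $\mathcal Z_{\rm est}$ such that, with probability at least $p$, $$|\mathcal Z_{\rm est}-\mathcal Z|\le\frac{\gamma}{\sqrt{2^{F-2}}}\cdot\epsilon .$$ Here the constant in $O(\cdot)$ is uniform over all 2-colexes, all $\beta$ and $J_a$, all $\epsilon\le\epsilon_0$ and all $p\ge p_0$, for any fixed $\epsilon_0>0$ and $p_0\in(0,1)$. Moreover, the quantum operations of the program are the following protocol. There are real orthogonal $2\times2$ matrices $O_a$,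 depending only on $\beta$ and $J_a$, with $A_a=O_a^TZO_a$ ($Z$ the Pauli matrix), and for every 2-colex there is a circuit of $O(V^3)$ elementary gates that prepares $|\Omega\rangle$ from $|0\cdots0\rangle$. For some number $K\ge1$, the program performs $K$ rounds; in each it resets all qubits to $|0\rangle$, runs this circuit, applies $O_a$ to each qubit $a$, and measures all qubits, obtaining a bit string $x^k$. The output is the rescaled average of the measured values of $Z^{\otimes V}$, $$\mathcal Z_{\rm est}=\frac{\gamma}{\sqrt{2^{F-2}}}\cdot\frac1K\sum_{k=1}^K\prod_a(-1)^{x^k_a}.$$ -/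

import Mathlib

open scoped Classical

noncomputable section

namespace ColorCode

/-! ## 2-colexes -/

/-- A 2-colex with vertices labelled by `Fin V` and faces labelled by `Fin F`: a connected trivalent
graph cellularly embedded in a closed oriented surface (of any genus), with 3-colourable faces,
given as a combinatorial map. Darts are half-edges, `rot` is the rotation of the half-edges around
their vertex, `opp` interchanges the two halves of an edge. The vertices are the cycles of `rot`;
the faces are the cycles of `rot * opp`, which walks along an edge to its other end and turns to the
next edge there. -/
structure Colex (V F : ℕ) where
  Dart : Type
  dart_finite : Finite Dart
  dart_nonempty : Nonempty Dart
  rot : Equiv.Perm Dart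
  opp : Equiv.Perm Dart
  opp_opp : ∀ d, opp (opp d) = d
  opp_ne : ∀ d, opp d ≠ d
  connected : ∀ d e, ∃ g ∈ Subgroup.closure ({rot, opp} : Set (Equiv.Perm Dart)), g d = e
  vertex : Dart → Fin V
  vertex_surjective : Function.Surjective vertex
  vertex_eq_iff : ∀ d e, vertex d = vertex e ↔ rot.SameCycle d e
  face : Dart → Fin F
  face_surjective : Function.Surjective face
  face_eq_iff : ∀ d e, face d = face e ↔ (rot * opp).SameCycle d e
  trivalent : ∀ v, Nat.card {d // vertex d = v} = 3
  /-- the two faces on the two sides of an edge get different colours -/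
  colorable : ∃ c : Fin F → Fin 3, ∀ d, c (face d) ≠ c (face (opp d))

/-- The vertex `v` lies on the face `f`. -/
def Colex.Inc {V F : ℕ} (m : Colex V F) (v : Fin V) (f : Fin F) : Prop :=
  ∃ d, m.vertex d = v ∧ m.face d = f

/-! ## The 3-body Ising model -/

/-- The energy of a configuration of spins (`±1`, as units of `ℤ`) on the faces; each vertex `a`
contributes `-J a` times the product of the spins of the faces at `a`. -/
def energy {V F : ℕ} (m : Colex V F) (J : Fin V → ℝ) (s : Fin F → ℤˣ) : ℝ :=
  -∑ a, J a * ∏ f ∈ Finset.univ.filter (fun f => m.Inc a f), ((s f : ℤ) : ℝ)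

def partitionFunction {V F : ℕ} (m : Colex V F) (β : ℝ) (J : Fin V → ℝ) : ℝ :=
  ∑ s : Fin F → ℤˣ, Real.exp (-β * energy m J s)

def gammaFactor {V : ℕ} (F : ℕ) (β : ℝ) (J : Fin V → ℝ) : ℝ :=
  Real.sqrt (2 ^ (F + 2)) *
    ∏ a, Real.sqrt (Real.exp (2 * β * J a) + Real.exp (-2 * β * J a))

/-- The error scale `γ / √(2 ^ (F - 2))`. -/
def errorScale {V : ℕ} (F : ℕ) (β : ℝ) (J : Fin V → ℝ) : ℝ :=
  gammaFactor F β J / Real.sqrt ((2 : ℝ) ^ ((F : ℤ) - 2))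

/-- The single-qubit observable `A_a`, for `J = J_a`. -/
def obsA (β J : ℝ) : Matrix (Fin 2) (Fin 2) ℝ :=
  (1 / Real.sqrt (Real.exp (2 * β * J) + Real.exp (-2 * β * J))) •
    !![Real.exp (β * J), Real.exp (-β * J); Real.exp (-β * J), -Real.exp (β * J)]

def pauliZ : Matrix (Fin 2) (Fin 2) ℝ := !![1, 0; 0, -1]

/-! ## Qubits, gates and measurements -/

/-- Vectors of amplitudes of `n` qubits in the computational basis. -/
abbrev QState (n : ℕ) := (Fin n → Fin 2) → ℂ

def normSq {n : ℕ} (ψ : QState n) : ℝ := ∑ x, ‖ψ x‖ ^ 2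

/-- The basis state `|0…0⟩`. -/
def ketZero (n : ℕ) : QState n := fun x => if x = 0 then 1 else 0

def tensorOp {n : ℕ} (M : Fin n → Matrix (Fin 2) (Fin 2) ℂ) :
    Matrix (Fin n → Fin 2) (Fin n → Fin 2) ℂ :=
  Matrix.of fun x y => ∏ a, M a (x a) (y a)

def pauliX : Matrix (Fin 2) (Fin 2) ℂ := !![0, 1; 1, 0]

/-- The face operator `X_f`, the tensor product of `X` over the vertices of `f`. -/
def faceX {V F : ℕ} (m : Colex V F) (f : Fin F) :
    Matrix (Fin V → Fin 2) (Fin V → Fin 2) ℂ :=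
  tensorOp fun v => if m.Inc v f then pauliX else 1

/-- The unnormalized colour code state `∏_f (1 + X_f) |0…0⟩` (the factors commute). -/
def omegaUnnormalized {V F : ℕ} (m : Colex V F) : QState V :=
  (List.ofFn fun f : Fin F => 1 + faceX m f).prod.mulVec (ketZero V)

/-- The colour code state `|Ω⟩`. -/
def omega {V F : ℕ} (m : Colex V F) : QState V := fun x =>
  omegaUnnormalized m x / (Real.sqrt (normSq (omegaUnnormalized m)) : ℂ)

/-- Elementary gates: arbitrary single-qubit unitaries and CNOT (`c` the control, `t` the target). -/
inductive Gate (n : ℕ) where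
  | single (q : Fin n) (U : Matrix.unitaryGroup (Fin 2) ℂ)
  | cnot (c t : Fin n) (h : c ≠ t)

def Gate.apply {n : ℕ} : Gate n → QState n → QState n
  | .single q U, ψ => fun x => ∑ b, (U : Matrix (Fin 2) (Fin 2) ℂ) (x q) b *
      ψ (Function.update x q b)
  | .cnot c t _, ψ => fun x => ψ (Function.update x t (x t + x c))

/-- A circuit is a list of gates, applied from left to right. -/
def runCircuit {n : ℕ} (W : List (Gate n)) (ψ : QState n) : QState n :=
  W.foldl (fun φ g => g.apply φ) ψ

/-- The Born probability of the outcome `b` when qubit `q` is measured in the computational basis. -/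
def bornProb {n : ℕ} (ψ : QState n) (q : Fin n) (b : Fin 2) : NNReal :=
  ∑ x, if x q = b then ‖ψ x‖₊ ^ 2 else 0

/-- The normalized state after the outcome `b` of a measurement of qubit `q`. -/
def collapse {n : ℕ} (ψ : QState n) (q : Fin n) (b : Fin 2) : QState n := fun x =>
  if x q = b then ψ x / (Real.sqrt (bornProb ψ q b) : ℂ) else 0

/-- The random outcome of measuring qubit `q`: outcome `1` has its Born probability, outcome `0` the
complementary one. On unit vectors the truncation at `1` is void. -/
def measureOutcome {n : ℕ} (ψ : QState n) (q : Fin n) : PMF (Fin 2) :=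
  PMF.ofFintype
    (fun b => if b = 1 then ((min 1 (bornProb ψ q 1) : NNReal) : ENNReal)
      else 1 - ((min 1 (bornProb ψ q 1) : NNReal) : ENNReal))
    (by
      rw [Fin.sum_univ_two]
      simp only [zero_ne_one, if_true, if_false]
      exact tsub_add_cancel_of_le (by exact_mod_cast min_le_left _ _))

/-- The bit flip of qubit `q`. -/
def flipQubit {n : ℕ} (q : Fin n) (ψ : QState n) : QState n := fun x =>
  ψ (Function.update x q (x q + 1))

/-- The operations on the quantum register, as recorded in the history of a run. -/
inductive QEvent (n : ℕ) where
  | gate (g : Gate n)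
  | reset (q : Fin n)
  | measured (q : Fin n) (outcome : Fin 2)

/-! ## A quantum computer with classical control

A random access machine with unit-cost real arithmetic, index registers that can only be set,
copied and changed by one, and a quantum register. Programs are finite syntactic objects with
rational constants. -/

/-- Index expressions; `pred` of `0` is `0`. -/
inductive IExp where
  | const (k : ℕ)
  | reg (r : ℕ)
  | succ (e : IExp)
  | pred (e : IExp)

/-- Real expressions; `read A i j` is the entry `(i, j)` of the real array `A`. -/
inductive RExp where
  | const (c : ℚ)
  | read (A : ℕ) (i j : IExp)
  | add (a b : RExp)
  | sub (a b : RExp)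
  | mul (a b : RExp)
  | div (a b : RExp)
  | exp (a : RExp)
  | sqrt (a : RExp)

inductive BExp where
  | ilt (i j : IExp)
  | rlt (a b : RExp)
  | not (b : BExp)

inductive Cmd where
  | skip
  | seq (c d : Cmd)
  | ite (b : BExp) (c d : Cmd)
  | while (b : BExp) (c : Cmd)
  /-- set the index register `r` -/
  | setIdx (r : ℕ) (e : IExp)
  /-- set the entry `(i, j)` of the real array `A` -/
  | write (A : ℕ) (i j : IExp) (e : RExp)
  /-- apply to qubit `q` the matrix with real parts `re` and imaginary parts `im` of its entries -/
  | gate (q : IExp) (re im : Fin 2 → Fin 2 → RExp)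
  | cnot (c t : IExp)
  /-- bring qubit `q` to `|0⟩`, by a measurement followed by a flip after outcome `1` -/
  | reset (q : IExp)
  /-- measure qubit `q` and store the outcome in the entry `(i, j)` of the real array `A` -/
  | measure (q : IExp) (A : ℕ) (i j : IExp)

/-- The state of the machine with `n` qubits. The history is not accessible to programs. -/
structure Store (n : ℕ) where
  idx : ℕ → ℕ
  mem : ℕ → ℕ → ℕ → ℝ
  qstate : QState n
  history : List (QEvent n)

def IExp.eval {n : ℕ} (s : Store n) : IExp → ℕ
  | .const k => k
  | .reg r => s.idx r
  | .succ e => e.eval s + 1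
  | .pred e => e.eval s - 1

def RExp.eval {n : ℕ} (s : Store n) : RExp → ℝ
  | .const c => c
  | .read A i j => s.mem A (i.eval s) (j.eval s)
  | .add a b => a.eval s + b.eval s
  | .sub a b => a.eval s - b.eval s
  | .mul a b => a.eval s * b.eval s
  | .div a b => a.eval s / b.eval s
  | .exp a => Real.exp (a.eval s)
  | .sqrt a => Real.sqrt (a.eval s)

def BExp.eval {n : ℕ} (s : Store n) : BExp → Prop
  | .ilt i j => i.eval s < j.eval s
  | .rlt a b => a.eval s < b.eval s
  | .not b => ¬ b.eval s

def Store.setIdx {n : ℕ} (s : Store n) (r k : ℕ) : Store n :=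
  { s with idx := Function.update s.idx r k }

def Store.setMem {n : ℕ} (s : Store n) (A i j : ℕ) (y : ℝ) : Store n :=
  { s with mem := fun A' i' j' => if A' = A ∧ i' = i ∧ j' = j then y else s.mem A' i' j' }

def Store.applyGate {n : ℕ} (s : Store n) (g : Gate n) : Store n :=
  { s with qstate := g.apply s.qstate, history := s.history ++ [.gate g] }

def gateMatrix {n : ℕ} (s : Store n) (re im : Fin 2 → Fin 2 → RExp) :
    Matrix (Fin 2) (Fin 2) ℂ :=
  Matrix.of fun i j => ⟨(re i j).eval s, (im i j).eval s⟩

/-- A configuration: the commands still to be executed, and the store. -/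
abbrev Config (n : ℕ) := List Cmd × Store n

/-- One step of the machine. An operation on a qubit that does not exist, a CNOT with equal control
and target, and a non-unitary gate have no effect. -/
def step {n : ℕ} : Config n → PMF (Config n)
  | ([], s) => PMF.pure ([], s)
  | (.skip :: k, s) => PMF.pure (k, s)
  | (.seq c d :: k, s) => PMF.pure (c :: d :: k, s)
  | (.ite b c d :: k, s) => PMF.pure (if b.eval s then (c :: k, s) else (d :: k, s))
  | (.while b c :: k, s) => PMF.pure (if b.eval s then (c :: .while b c :: k, s) else (k, s))
  | (.setIdx r e :: k, s) => PMF.pure (k, s.setIdx r (e.eval s))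
  | (.write A i j e :: k, s) => PMF.pure (k, s.setMem A (i.eval s) (j.eval s) (e.eval s))
  | (.gate q re im :: k, s) => PMF.pure (k,
      if h : q.eval s < n ∧ gateMatrix s re im ∈ Matrix.unitaryGroup (Fin 2) ℂ then
        s.applyGate (.single ⟨q.eval s, h.1⟩ ⟨gateMatrix s re im, h.2⟩)
      else s)
  | (.cnot c t :: k, s) => PMF.pure (k,
      if h : (c.eval s < n ∧ t.eval s < n) ∧ c.eval s ≠ t.eval s then
        s.applyGate (.cnot ⟨c.eval s, h.1.1⟩ ⟨t.eval s, h.1.2⟩ fun e => h.2 (Fin.mk.inj e))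
      else s)
  | (.reset q :: k, s) =>
      if h : q.eval s < n then
        (measureOutcome s.qstate ⟨q.eval s, h⟩).map fun b : Fin 2 => (k,
          { s with
            qstate := if b = 1 then
                flipQubit ⟨q.eval s, h⟩ (collapse s.qstate ⟨q.eval s, h⟩ b)
              else collapse s.qstate ⟨q.eval s, h⟩ b
            history := s.history ++ [.reset ⟨q.eval s, h⟩] })
      else PMF.pure (k, s)
  | (.measure q A i j :: k, s) =>
      if h : q.eval s < n then
        (measureOutcome s.qstate ⟨q.eval s, h⟩).map fun b : Fin 2 => (k,
          { s.setMem A (i.eval s) (j.eval s) ((b : ℕ) : ℝ) with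
            qstate := collapse s.qstate ⟨q.eval s, h⟩ b
            history := s.history ++ [.measured ⟨q.eval s, h⟩ b] })
      else PMF.pure (k, s)

/-- The distribution of the configuration after `T` steps (a halted machine stays as it is). -/
def runFor {n : ℕ} : ℕ → Config n → PMF (Config n)
  | 0, c => PMF.pure c
  | T + 1, c => (step c).bind (runFor T)

/-- The initial store: index registers `0` and `1` hold `V` and `F`; array `0` holds the vertex-face
incidence matrix, array `1` the inverse temperature, array `2` the couplings, array `3` the error
`ε` and the success probability `p`; all else is `0`. The register of `V` qubits is in
`|0…0⟩`. -/
def inputStore {V F : ℕ} (m : Colex V F) (β : ℝ) (J : Fin V → ℝ) (ε p : ℝ) : Store V where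
  idx r := if r = 0 then V else if r = 1 then F else 0
  mem A i j :=
    if A = 0 then
      if h : i < V ∧ j < F then (if m.Inc ⟨i, h.1⟩ ⟨j, h.2⟩ then 1 else 0) else 0
    else if A = 1 then (if i = 0 ∧ j = 0 then β else 0)
    else if A = 2 then (if h : i < V ∧ j = 0 then J ⟨i, h.1⟩ else 0)
    else if A = 3 then (if i = 0 ∧ j = 0 then ε else if i = 0 ∧ j = 1 then p else 0)
    else 0
  qstate := ketZero V
  history := []

/-- The output of a run: entry `(0, 0)` of array `4`. -/
def output {n : ℕ} (s : Store n) : ℝ := s.mem 4 0 0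

/-! ## The measurement protocol -/

/-- The operations of one round with measured bit string `x`: reset all qubits, run the circuit `W`,
apply the single-qubit gate `R a` to each qubit `a`, measure each qubit. -/
def roundEvents {n : ℕ} (W : List (Gate n)) (R : Fin n → Matrix.unitaryGroup (Fin 2) ℂ)
    (x : Fin n → Fin 2) : List (QEvent n) :=
  List.ofFn (fun a => QEvent.reset a) ++ W.map QEvent.gate ++
    List.ofFn (fun a => QEvent.gate (Gate.single a (R a))) ++
    List.ofFn (fun a => QEvent.measured a (x a))

/-- The eigenvalue `∏_a (-1) ^ (x a)` of the tensor power of Pauli `Z` on `|x⟩`. -/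
def parity {n : ℕ} (x : Fin n → Fin 2) : ℝ := ∏ a, (-1 : ℝ) ^ (x a : ℕ)

/-- A real orthogonal matrix as a unitary gate. -/
def realGate (O : Matrix.orthogonalGroup (Fin 2) ℝ) : Matrix.unitaryGroup (Fin 2) ℂ :=
  ⟨(O : Matrix (Fin 2) (Fin 2) ℝ).map Complex.ofReal, by
    have h := Matrix.mem_unitaryGroup_iff.mp O.2
    have hs : star ((O : Matrix (Fin 2) (Fin 2) ℝ).map Complex.ofReal) =
        (star (O : Matrix (Fin 2) (Fin 2) ℝ)).map Complex.ofReal := by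
      ext i j
      simp [Matrix.star_apply]
    rw [Matrix.mem_unitaryGroup_iff, hs]
    have h2 := congrArg (fun M : Matrix (Fin 2) (Fin 2) ℝ => M.map Complex.ofRealHom) h
    simp only [Matrix.map_mul] at h2
    exact h2.trans (Matrix.map_one _ (map_zero _) (map_one _))⟩

end ColorCode

end

noncomputable section

namespace ColorCode

/-! ## A program logic for bounded running times -/

/-! For a set t of faces let ∂t (`Colex.boundary`) be the set of vertices that lie on an odd number
of its faces. The state |Ω⟩ is proportional to Σ_t |∂t⟩. The entry of A_a at bits x, y is (-1)^(xy)
exp(β J_a (-1)^(x+y)) divided by `obsNorm` (`obsA_apply`). In ⟨∂t| ⊗A_a |∂u⟩ the signs multiply to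
(-1)^|∂t ∩ ∂u| = 1, because the code spanned by the faces is self-orthogonal
(`Colex.sum_boundary_mul_boundary`). What remains is the Boltzmann weight of the spin configuration
t + u, so the sum over t and u is 2^F 𝒵 divided by the product of the norms (`sum_sum_prod_obsA`).
The squared norm of Σ_t |∂t⟩ is 4 · 2^F, since ∂ has a kernel of four elements
(`Colex.card_boundary_eq_zero`). As A_a = O_aᵀ Z O_a, the error scale times the expected measured
parity is exactly 𝒵 (`errorScale_mul_sum_parity`).

The parities lie in [-1, 1], so by Hoeffding's inequality (`iid_mean_close`) their mean over K
independent rounds is within ε of its expectation with probability at least p as soon as 2 exp(-K ε²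
/ 2) ≤ 1 - p. The program tests this condition before every round; the resulting K is of order log(1
/ (1 - p)) / ε² (`numRounds_le`).

To prepare |Ω⟩, the face vectors are brought by Gaussian elimination into a form where the pivot row
of each column vanishes to the left of that column (`elim_pivot_row`). This does not change the
product of the operators 1 + X_b (`prodOnePlusX_elim`). When a column is processed, its pivot qubit
is still 0, so a Hadamard gate on the pivot and CNOTs from it apply (1 + X_b) / √2
(`runCircuit_columnCircuit`). Columns that have become zero need no gates.

Elimination costs O(V³) steps once and a round costs O(V²), as F ≤ 3V. These bounds and the output
law come from a program logic: `Det` describes deterministic pieces, and `Run` couples the final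
store with a random value that the program need not store, here the measured bit strings. Since a
round ends in a basis state up to a phase, the resets of the next round are deterministic and the
rounds are independent (`run_rounds`). -/

theorem pmf_bind_congr {α β : Type*} {p : PMF α} {f g : α → PMF β}
    (h : ∀ a ∈ p.support, f a = g a) : p.bind f = p.bind g := by
  ext b
  simp only [PMF.bind_apply]
  refine tsum_congr fun a => ?_
  by_cases ha : p a = 0
  · simp [ha]
  · rw [h a ((PMF.mem_support_iff _ _).2 ha)]

variable {n : ℕ}

/-- From the configuration `c` the machine halts within `T` steps, with final store distributed
as `ν`. -/
def Halts (c : Config n) (T : ℕ) (ν : PMF (Store n)) : Prop :=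
  ∀ T' ≥ T, runFor T' c = ν.map fun s => ([], s)

theorem Halts.mono {c : Config n} {T T' : ℕ} {ν : PMF (Store n)} (h : Halts c T ν)
    (hT : T ≤ T') : Halts c T' ν := fun t ht => h t (hT.trans ht)

theorem runFor_nil (T : ℕ) (s : Store n) : runFor T ([], s) = PMF.pure ([], s) := by
  induction T with
  | zero => rfl
  | succ T ih => simp [runFor, step, ih]

theorem halts_nil (s : Store n) : Halts ([], s) 0 (PMF.pure s) := fun T _ => by
  simp [runFor_nil, PMF.pure_map]

/-- The random choice `a` stays explicit, so that the law of the final store can depend on it. Only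
choices of positive probability have to be followed. -/
theorem halts_step {c : Config n} {T : ℕ} {α : Type} {μ : PMF α} {g : α → Config n}
    {ν : α → PMF (Store n)} (hc : step c = μ.map g)
    (h : ∀ a ∈ μ.support, Halts (g a) T (ν a)) : Halts c (T + 1) (μ.bind ν) := by
  intro T' hT'
  obtain ⟨t, rfl⟩ : ∃ t, T' = t + 1 := ⟨T' - 1, by omega⟩
  rw [runFor, hc, PMF.bind_map, PMF.map_bind]
  exact pmf_bind_congr fun a ha => h a ha t (by omega)

/-- The command `c`, started in `s`, ends within `T` steps, with final store distributed as `μ`. -/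
def Exec (c : Cmd) (s : Store n) (T : ℕ) (μ : PMF (Store n)) : Prop :=
  ∀ (k : List Cmd) (Tk : ℕ) (ν : Store n → PMF (Store n)),
    (∀ s' ∈ μ.support, Halts (k, s') Tk (ν s')) → Halts (c :: k, s) (T + Tk) (μ.bind ν)

theorem Exec.mono {c : Cmd} {s : Store n} {T T' : ℕ} {μ : PMF (Store n)} (h : Exec c s T μ)
    (hT : T ≤ T') : Exec c s T' μ := fun k Tk ν hν => (h k Tk ν hν).mono (by omega)

theorem Exec.halts {c : Cmd} {s : Store n} {T : ℕ} {μ : PMF (Store n)} (h : Exec c s T μ) :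
    Halts ([c], s) T μ := by
  simpa using h [] 0 PMF.pure fun s' _ => halts_nil s'

theorem exec_of_step {c : Cmd} {s : Store n} {α : Type} {μ : PMF α} {g : α → Store n}
    (h : ∀ k, step (c :: k, s) = μ.map fun a => (k, g a)) : Exec c s 1 (μ.map g) := by
  intro k Tk ν hν
  rw [PMF.bind_map, add_comm]
  refine halts_step (h k) fun a ha => hν _ ?_
  rw [PMF.support_map]
  exact ⟨a, ha, rfl⟩

theorem exec_of_step_pure {c : Cmd} {s s' : Store n}
    (h : ∀ k, step (c :: k, s) = PMF.pure (k, s')) : Exec c s 1 (PMF.pure s') := by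
  have := exec_of_step (c := c) (s := s) (μ := PMF.pure ()) (g := fun _ => s')
    (fun k => by rw [h, PMF.pure_map])
  simpa [PMF.pure_map] using this

theorem exec_seq {c d : Cmd} {s : Store n} {T₁ T₂ : ℕ} {μ : PMF (Store n)}
    {ν : Store n → PMF (Store n)} (hc : Exec c s T₁ μ)
    (hd : ∀ s' ∈ μ.support, Exec d s' T₂ (ν s')) :
    Exec (.seq c d) s (T₁ + T₂ + 1) (μ.bind ν) := by
  intro k Tk ξ hξ
  have h1 : Halts (c :: d :: k, s) (T₁ + (T₂ + Tk)) (μ.bind fun s' => (ν s').bind ξ) := by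
    refine hc _ _ _ fun s' hs' => hd s' hs' _ _ _ fun s'' hs'' => hξ s'' ?_
    rw [PMF.support_bind]
    exact Set.mem_biUnion hs' hs''
  have h2 := halts_step (c := (Cmd.seq c d :: k, s)) (μ := PMF.pure ())
    (g := fun _ => (c :: d :: k, s)) (by simp [step, PMF.pure_map]) (fun _ _ => h1)
  rw [PMF.pure_bind] at h2
  rw [PMF.bind_bind]
  exact h2.mono (by omega)

/-- Branching and loop unfolding share a first step that only replaces the command by a list of
commands. The hypothesis is phrased with continuations because such a list is not itself a command.
-/
theorem exec_of_step_cont {c : Cmd} {s : Store n} {l : List Cmd} {T : ℕ} {μ : PMF (Store n)}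
    (hstep : ∀ k, step (c :: k, s) = PMF.pure (l ++ k, s))
    (h : ∀ (k : List Cmd) (Tk : ℕ) (ν : Store n → PMF (Store n)),
      (∀ s' ∈ μ.support, Halts (k, s') Tk (ν s')) → Halts (l ++ k, s) (T + Tk) (μ.bind ν)) :
    Exec c s (T + 1) μ := by
  intro k Tk ν hν
  have h2 := halts_step (c := (c :: k, s)) (μ := PMF.pure ())
    (g := fun _ => (l ++ k, s)) (by simp [hstep, PMF.pure_map]) (fun _ _ => h k Tk ν hν)
  rw [PMF.pure_bind] at h2
  exact h2.mono (by omega)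

theorem exec_ite_true {b : BExp} {c d : Cmd} {s : Store n} {T : ℕ} {μ : PMF (Store n)}
    (hb : b.eval s) (h : Exec c s T μ) : Exec (.ite b c d) s (T + 1) μ :=
  exec_of_step_cont (l := [c]) (fun k => by simp [step, hb]) h

theorem exec_ite_false {b : BExp} {c d : Cmd} {s : Store n} {T : ℕ} {μ : PMF (Store n)}
    (hb : ¬ b.eval s) (h : Exec d s T μ) : Exec (.ite b c d) s (T + 1) μ :=
  exec_of_step_cont (l := [d]) (fun k => by simp [step, hb]) h

theorem exec_while_false {b : BExp} {c : Cmd} {s : Store n} (hb : ¬ b.eval s) :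
    Exec (.while b c) s 1 (PMF.pure s) :=
  exec_of_step_pure fun k => by simp [step, hb]

theorem exec_while_true {b : BExp} {c : Cmd} {s : Store n} {T₁ T₂ : ℕ} {μ : PMF (Store n)}
    {ν : Store n → PMF (Store n)} (hb : b.eval s) (hc : Exec c s T₁ μ)
    (hd : ∀ s' ∈ μ.support, Exec (.while b c) s' T₂ (ν s')) :
    Exec (.while b c) s (T₁ + T₂ + 1) (μ.bind ν) := by
  refine exec_of_step_cont (l := [c, .while b c]) (fun k => by simp [step, hb]) ?_
  intro k Tk ξ hξ
  rw [PMF.bind_bind, add_assoc]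
  refine hc _ _ _ fun s' hs' => hd s' hs' _ _ _ fun s'' hs'' => hξ s'' ?_
  rw [PMF.support_bind]
  exact Set.mem_biUnion hs' hs''

/-! ### Runs coupled with a random value, and deterministic runs -/

/-- The command `c`, started in `s`, ends within `T` steps, and there is a random element of `α`
with distribution `μ` that is related by `Q` to the final store. -/
def Run {α : Type} (c : Cmd) (s : Store n) (T : ℕ) (μ : PMF α) (Q : α → Store n → Prop) : Prop :=
  ∃ ρ : PMF (α × Store n), ρ.map Prod.fst = μ ∧ (∀ z ∈ ρ.support, Q z.1 z.2) ∧
    Exec c s T (ρ.map Prod.snd)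

/-- The command `c`, started in `s`, ends within `T` steps in a store that satisfies `Q`, without
any randomness. -/
def Det (c : Cmd) (s : Store n) (T : ℕ) (Q : Store n → Prop) : Prop :=
  ∃ s', Q s' ∧ Exec c s T (PMF.pure s')

theorem Run.mono {α : Type} {c : Cmd} {s : Store n} {T T' : ℕ} {μ : PMF α}
    {Q Q' : α → Store n → Prop} (h : Run c s T μ Q) (hT : T ≤ T')
    (hQ : ∀ a s, Q a s → Q' a s) : Run c s T' μ Q' := by
  obtain ⟨ρ, h1, h2, h3⟩ := h
  exact ⟨ρ, h1, fun z hz => hQ _ _ (h2 z hz), h3.mono hT⟩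

theorem Run.and_support {α : Type} {c : Cmd} {s : Store n} {T : ℕ} {μ : PMF α}
    {Q : α → Store n → Prop} (h : Run c s T μ Q) :
    Run c s T μ fun a s' => a ∈ μ.support ∧ Q a s' := by
  obtain ⟨ρ, rfl, h2, h3⟩ := h
  refine ⟨ρ, rfl, fun z hz => ⟨?_, h2 z hz⟩, h3⟩
  rw [PMF.support_map]
  exact ⟨z, hz, rfl⟩

theorem Run.map {α β : Type} {c : Cmd} {s : Store n} {T : ℕ} {μ : PMF α}
    {Q : α → Store n → Prop} {Q' : β → Store n → Prop} (h : Run c s T μ Q) (f : α → β)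
    (hQ : ∀ a s, Q a s → Q' (f a) s) : Run c s T (μ.map f) Q' := by
  obtain ⟨ρ, rfl, h2, h3⟩ := h
  refine ⟨ρ.map (Prod.map f id), ?_, ?_, ?_⟩
  · rw [PMF.map_comp, PMF.map_comp]; rfl
  · intro z hz
    rw [PMF.support_map] at hz
    obtain ⟨w, hw, rfl⟩ := hz
    exact hQ _ _ (h2 w hw)
  · rw [PMF.map_comp]
    exact h3

theorem Det.mono {c : Cmd} {s : Store n} {T T' : ℕ} {Q Q' : Store n → Prop} (h : Det c s T Q)
    (hT : T ≤ T') (hQ : ∀ s, Q s → Q' s) : Det c s T' Q' := by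
  obtain ⟨s', h1, h2⟩ := h
  exact ⟨s', hQ _ h1, h2.mono hT⟩

theorem Det.run {α : Type} {c : Cmd} {s : Store n} {T : ℕ} {Q : Store n → Prop}
    {Q' : α → Store n → Prop} (h : Det c s T Q) (a : α) (hQ : ∀ s, Q s → Q' a s) :
    Run c s T (PMF.pure a) Q' := by
  obtain ⟨s', h1, h2⟩ := h
  refine ⟨PMF.pure (a, s'), by simp [PMF.pure_map], ?_, by simpa [PMF.pure_map] using h2⟩
  intro z hz
  simp only [PMF.support_pure, Set.mem_singleton_iff] at hz
  subst hz
  exact hQ _ h1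

/-- At time `max T T'` both descriptions give the law of the same halted configuration. -/
theorem Exec.unique {c : Cmd} {s : Store n} {T T' : ℕ} {μ μ' : PMF (Store n)}
    (h : Exec c s T μ) (h' : Exec c s T' μ') : μ = μ' := by
  have h1 := h.halts (max T T') (le_max_left _ _)
  rw [h'.halts (max T T') (le_max_right _ _)] at h1
  have h2 := congrArg (PMF.map Prod.snd) h1
  rw [PMF.map_comp, PMF.map_comp] at h2
  exact ((PMF.map_id μ').symm.trans (h2.trans (PMF.map_id μ))).symm

/-- The common argument of sequential composition and of loop unfolding. -/
theorem run_bind_aux {α β : Type} {c d e : Cmd} {s : Store n} {T T₁ T₂ : ℕ} {μ : PMF α}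
    {κ : α → PMF β} {Q : α → Store n → Prop} {R : β → Store n → Prop}
    (hcomp : ∀ (ρ : PMF (Store n)) (ν : Store n → PMF (Store n)), Exec c s T₁ ρ →
      (∀ s' ∈ ρ.support, Exec d s' T₂ (ν s')) → Exec e s T (ρ.bind ν))
    (hc : Run c s T₁ μ Q) (hd : ∀ a s', Q a s' → Run d s' T₂ (κ a) R) :
    Run e s T (μ.bind κ) R := by
  obtain ⟨ρ, rfl, h2, h3⟩ := hc
  obtain ⟨z₀, hz₀⟩ := ρ.support_nonempty
  obtain ⟨ξ₀, -⟩ := hd _ _ (h2 z₀ hz₀)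
  -- For each pair satisfying `Q`, a joint law for the second command is chosen; `ξ₀` is a filler
  -- elsewhere.
  let ξ : α × Store n → PMF (β × Store n) := fun z =>
    if h : Q z.1 z.2 then (hd _ _ h).choose else ξ₀
  have hξ : ∀ z, Q z.1 z.2 → (ξ z).map Prod.fst = κ z.1 ∧ (∀ w ∈ (ξ z).support, R w.1 w.2) ∧
      Exec d z.2 T₂ ((ξ z).map Prod.snd) := by
    intro z hz
    simp only [ξ, dif_pos hz]
    exact (hd _ _ hz).choose_spec
  -- The machine sees only the store, so its continuation must not depend on the coupled value. Any
  -- admissible value will do: by `Exec.unique`, two values coupled to the same store lead to the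
  -- same law of final stores.
  let ν : Store n → PMF (Store n) := fun s' =>
    if h : ∃ a, Q a s' then (ξ (h.choose, s')).map Prod.snd else PMF.pure s'
  have hν : ∀ z, Q z.1 z.2 → ν z.2 = (ξ z).map Prod.snd := by
    intro z hz
    have h : ∃ a, Q a z.2 := ⟨z.1, hz⟩
    simp only [ν, dif_pos h]
    exact (hξ (h.choose, z.2) h.choose_spec).2.2.unique (hξ z hz).2.2
  refine ⟨ρ.bind ξ, ?_, ?_, ?_⟩
  · rw [PMF.map_bind, PMF.bind_map]
    exact pmf_bind_congr fun z hz => (hξ z (h2 z hz)).1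
  · intro w hw
    rw [PMF.support_bind] at hw
    obtain ⟨z, hz, hw⟩ := Set.mem_iUnion₂.1 hw
    exact (hξ z (h2 z hz)).2.1 w hw
  · have : (ρ.bind ξ).map Prod.snd = (ρ.map Prod.snd).bind ν := by
      rw [PMF.map_bind, PMF.bind_map]
      exact pmf_bind_congr fun z hz => (hν z (h2 z hz)).symm
    rw [this]
    refine hcomp _ _ h3 fun s' hs' => ?_
    rw [PMF.support_map] at hs'
    obtain ⟨z, hz, rfl⟩ := hs'
    rw [hν z (h2 z hz)]
    exact (hξ z (h2 z hz)).2.2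

theorem Run.seq {α β : Type} {c d : Cmd} {s : Store n} {T₁ T₂ : ℕ} {μ : PMF α}
    {κ : α → PMF β} {Q : α → Store n → Prop} {R : β → Store n → Prop}
    (hc : Run c s T₁ μ Q) (hd : ∀ a s', Q a s' → Run d s' T₂ (κ a) R) :
    Run (.seq c d) s (T₁ + T₂ + 1) (μ.bind κ) R :=
  run_bind_aux (fun _ _ => exec_seq) hc hd

theorem Run.while_true {α β : Type} {b : BExp} {c : Cmd} {s : Store n} {T₁ T₂ : ℕ} {μ : PMF α}
    {κ : α → PMF β} {Q : α → Store n → Prop} {R : β → Store n → Prop} (hb : b.eval s)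
    (hc : Run c s T₁ μ Q) (hd : ∀ a s', Q a s' → Run (.while b c) s' T₂ (κ a) R) :
    Run (.while b c) s (T₁ + T₂ + 1) (μ.bind κ) R :=
  run_bind_aux (fun _ _ => exec_while_true hb) hc hd

theorem Det.seq_run {β : Type} {c d : Cmd} {s : Store n} {T₁ T₂ : ℕ}
    {κ : PMF β} {Q : Store n → Prop} {R : β → Store n → Prop}
    (hc : Det c s T₁ Q) (hd : ∀ s', Q s' → Run d s' T₂ κ R) :
    Run (.seq c d) s (T₁ + T₂ + 1) κ R := by
  have := Run.seq (κ := fun _ => κ) (hc.run (Q' := fun _ => Q) () fun _ h => h)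
    (fun _ s' h => hd s' h)
  simpa using this

theorem Run.seq_det {α : Type} {c d : Cmd} {s : Store n} {T₁ T₂ : ℕ} {μ : PMF α}
    {Q R : α → Store n → Prop}
    (hc : Run c s T₁ μ Q) (hd : ∀ a s', Q a s' → Det d s' T₂ (R a)) :
    Run (.seq c d) s (T₁ + T₂ + 1) μ R := by
  have := Run.seq (κ := PMF.pure) hc (fun a s' h => (hd a s' h).run a fun _ h => h)
  simpa using this

theorem Det.seq {c d : Cmd} {s : Store n} {T₁ T₂ : ℕ} {Q R : Store n → Prop}
    (hc : Det c s T₁ Q) (hd : ∀ s', Q s' → Det d s' T₂ R) :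
    Det (.seq c d) s (T₁ + T₂ + 1) R := by
  obtain ⟨s', h1, h2⟩ := hc
  obtain ⟨s'', h3, h4⟩ := hd s' h1
  refine ⟨s'', h3, ?_⟩
  have := exec_seq (ν := fun _ => PMF.pure s'') h2 (by simpa using h4)
  simpa using this

theorem Det.while_true {b : BExp} {c : Cmd} {s : Store n} {T₁ T₂ : ℕ} {Q R : Store n → Prop}
    (hb : b.eval s) (hc : Det c s T₁ Q) (hd : ∀ s', Q s' → Det (.while b c) s' T₂ R) :
    Det (.while b c) s (T₁ + T₂ + 1) R := by
  obtain ⟨s', h1, h2⟩ := hc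
  obtain ⟨s'', h3, h4⟩ := hd s' h1
  refine ⟨s'', h3, ?_⟩
  have := exec_while_true (ν := fun _ => PMF.pure s'') hb h2 (by simpa using h4)
  simpa using this

theorem det_while_false {b : BExp} {c : Cmd} {s : Store n} {Q : Store n → Prop}
    (hb : ¬ b.eval s) (hQ : Q s) : Det (.while b c) s 1 Q :=
  ⟨s, hQ, exec_while_false hb⟩

theorem det_ite {b : BExp} {c d : Cmd} {s : Store n} {T : ℕ} {Q : Store n → Prop}
    (hc : b.eval s → Det c s T Q) (hd : ¬ b.eval s → Det d s T Q) :
    Det (.ite b c d) s (T + 1) Q := by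
  by_cases hb : b.eval s
  · obtain ⟨s', h1, h2⟩ := hc hb
    exact ⟨s', h1, exec_ite_true hb h2⟩
  · obtain ⟨s', h1, h2⟩ := hd hb
    exact ⟨s', h1, exec_ite_false hb h2⟩

/-! ### Primitive commands and counting loops -/

theorem det_skip {s : Store n} {Q : Store n → Prop} (hQ : Q s) : Det .skip s 1 Q :=
  ⟨s, hQ, exec_of_step_pure fun _ => rfl⟩

theorem det_setIdx {s : Store n} {r : ℕ} {e : IExp} {Q : Store n → Prop}
    (hQ : Q (s.setIdx r (e.eval s))) : Det (.setIdx r e) s 1 Q :=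
  ⟨_, hQ, exec_of_step_pure fun _ => rfl⟩

theorem det_write {s : Store n} {A : ℕ} {i j : IExp} {e : RExp} {Q : Store n → Prop}
    (hQ : Q (s.setMem A (i.eval s) (j.eval s) (e.eval s))) : Det (.write A i j e) s 1 Q :=
  ⟨_, hQ, exec_of_step_pure fun _ => rfl⟩

/-- The single-qubit gate on qubit `q`, as a circuit that is empty if there is no such qubit. -/
def singleCircuit (n q : ℕ) (U : Matrix.unitaryGroup (Fin 2) ℂ) : List (Gate n) :=
  if h : q < n then [.single ⟨q, h⟩ U] else []

/-- The CNOT from `c` to `t`, as a circuit that is empty if this makes no sense. -/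
def cnotCircuit (n c t : ℕ) : List (Gate n) :=
  if h : (c < n ∧ t < n) ∧ c ≠ t then [.cnot ⟨c, h.1.1⟩ ⟨t, h.1.2⟩ fun e => h.2 (Fin.mk.inj e)]
  else []

def Store.applyCircuit (s : Store n) (W : List (Gate n)) : Store n :=
  { s with qstate := runCircuit W s.qstate, history := s.history ++ W.map .gate }

theorem Store.applyCircuit_nil (s : Store n) : s.applyCircuit [] = s := by
  simp [applyCircuit, runCircuit]

/-- A gate on a missing qubit is ignored by the machine, which matches the empty `singleCircuit`.
This covers zero columns in the preparation, whose pivot is the nonexistent qubit `n`. -/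
theorem det_gate {s : Store n} {q : IExp} {re im : Fin 2 → Fin 2 → RExp} {Q : Store n → Prop}
    (U : Matrix.unitaryGroup (Fin 2) ℂ) (hU : gateMatrix s re im = U)
    (hQ : Q (s.applyCircuit (singleCircuit n (q.eval s) U))) : Det (.gate q re im) s 1 Q := by
  refine ⟨_, hQ, exec_of_step_pure fun k => ?_⟩
  have hU' : gateMatrix s re im ∈ Matrix.unitaryGroup (Fin 2) ℂ := hU ▸ U.2
  have hU'' : (⟨gateMatrix s re im, hU'⟩ : Matrix.unitaryGroup (Fin 2) ℂ) = U := Subtype.ext hU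
  by_cases h : q.eval s < n
  · simp only [step, singleCircuit, dif_pos h, dif_pos (And.intro h hU'), hU'']
    rfl
  · simp only [step, singleCircuit, dif_neg h, Store.applyCircuit_nil]
    rw [dif_neg fun h' => h h'.1]

theorem det_cnot {s : Store n} {c t : IExp} {Q : Store n → Prop}
    (hQ : Q (s.applyCircuit (cnotCircuit n (c.eval s) (t.eval s)))) : Det (.cnot c t) s 1 Q := by
  refine ⟨_, hQ, exec_of_step_pure fun k => ?_⟩
  by_cases h : (c.eval s < n ∧ t.eval s < n) ∧ c.eval s ≠ t.eval s
  · simp only [step, cnotCircuit, dif_pos h]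
    rfl
  · simp only [step, cnotCircuit, dif_neg h, Store.applyCircuit_nil]

/-- The loop `for r = 0, …, idx b - 1 do body`. -/
def forLoop (r b : ℕ) (body : Cmd) : Cmd :=
  .seq (.setIdx r (.const 0))
    (.while (.ilt (.reg r) (.reg b)) (.seq body (.setIdx r (.succ (.reg r)))))

theorem Store.setIdx_idx_self (s : Store n) (r x : ℕ) : (s.setIdx r x).idx r = x := by
  simp [setIdx]

/-- Each iteration costs the body plus three steps: loop test, sequencing and increment. The last 3
pays for the initialization, its sequencing and the failing final test. The invariant must survive
arbitrary changes of the counter register, and the body must leave the counter as it found it. -/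
theorem det_forLoop {r b N T : ℕ} {body : Cmd} {s : Store n} (I : ℕ → Store n → Prop)
    (hI : ∀ i s x, I i s → I i (s.setIdx r x)) (hb : ∀ i s, I i s → s.idx b = N) (h0 : I 0 s)
    (hstep : ∀ i s, i < N → s.idx r = i → I i s →
      Det body s T fun s' => s'.idx r = i ∧ I (i + 1) s') :
    Det (forLoop r b body) s (N * (T + 3) + 3) (I N) := by
  have key : ∀ d i s, i + d = N → s.idx r = i → I i s →
      Det (.while (.ilt (.reg r) (.reg b)) (.seq body (.setIdx r (.succ (.reg r))))) s
        (d * (T + 3) + 1) (I N) := by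
    intro d
    induction d with
    | zero =>
      intro i s hi hr h
      obtain rfl : i = N := by omega
      refine (det_while_false ?_ h).mono (by omega) fun _ h => h
      simp [BExp.eval, IExp.eval, hr, hb _ _ h]
    | succ d ih =>
      intro i s hi hr h
      refine (Det.while_true ?_ (Det.seq (hstep i s (by omega) hr h) fun s' hs' =>
        det_setIdx (Q := fun s'' => s''.idx r = i + 1 ∧ I (i + 1) s'') ?_) fun s' hs' =>
          ih (i + 1) s' (by omega) hs'.1 hs'.2).mono ?_ fun _ h => h
      · simp only [BExp.eval, IExp.eval, hr, hb _ _ h]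
        omega
      · refine ⟨?_, hI _ _ _ hs'.2⟩
        simp [Store.setIdx_idx_self, IExp.eval, hs'.1]
      · ring_nf
        omega
  refine (Det.seq (det_setIdx (Q := fun s' => s'.idx r = 0 ∧ I 0 s') ?_) fun s' hs' =>
    key N 0 s' (by omega) hs'.1 hs'.2).mono (by omega) fun _ h => h
  exact ⟨by simp [Store.setIdx_idx_self, IExp.eval], hI _ _ _ h0⟩

theorem run_measure {s : Store n} {q i j : IExp} {A : ℕ} (h : q.eval s < n) :
    Run (.measure q A i j) s 1 (measureOutcome s.qstate ⟨q.eval s, h⟩) fun b s' =>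
      s' = { s.setMem A (i.eval s) (j.eval s) ((b : ℕ) : ℝ) with
            qstate := collapse s.qstate ⟨q.eval s, h⟩ b
            history := s.history ++ [.measured ⟨q.eval s, h⟩ b] } := by
  let g : Fin 2 → Store n := fun b => { s.setMem A (i.eval s) (j.eval s) ((b : ℕ) : ℝ) with
            qstate := collapse s.qstate ⟨q.eval s, h⟩ b
            history := s.history ++ [.measured ⟨q.eval s, h⟩ b] }
  refine ⟨(measureOutcome s.qstate ⟨q.eval s, h⟩).map fun b => (b, g b), ?_, ?_, ?_⟩
  · rw [PMF.map_comp]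
    exact PMF.map_id _
  · intro z hz
    rw [PMF.support_map] at hz
    obtain ⟨b, -, rfl⟩ := hz
    rfl
  · rw [PMF.map_comp]
    refine exec_of_step (g := g) fun k => ?_
    simp only [step, dif_pos h]
    rfl

/-- A reset contains a measurement and is random in general; when the outcome is certain it is a
deterministic command. -/
theorem det_reset {s : Store n} {q : IExp} (h : q.eval s < n) (b : Fin 2)
    (hb : measureOutcome s.qstate ⟨q.eval s, h⟩ = PMF.pure b) {Q : Store n → Prop}
    (hQ : Q { s with
            qstate := if b = 1 then
                flipQubit ⟨q.eval s, h⟩ (collapse s.qstate ⟨q.eval s, h⟩ b)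
              else collapse s.qstate ⟨q.eval s, h⟩ b
            history := s.history ++ [.reset ⟨q.eval s, h⟩] }) :
    Det (.reset q) s 1 Q := by
  refine ⟨_, hQ, exec_of_step_pure fun k => ?_⟩
  simp only [step, dif_pos h, hb, PMF.pure_map]

end ColorCode

end

noncomputable section

namespace ColorCode

variable {n : ℕ}

/-! ## Unit vectors, gates and measurements -/

theorem normSq_smul (c : ℂ) (ψ : QState n) : normSq (c • ψ) = ‖c‖ ^ 2 * normSq ψ := by
  simp [normSq, mul_pow, Finset.mul_sum]

/-- The basis vector `|x⟩`. -/
def ket (x : Fin n → Fin 2) : QState n := fun y => if y = x then 1 else 0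

theorem normSq_ket (x : Fin n → Fin 2) : normSq (ket x) = 1 := by
  have : ∀ y : Fin n → Fin 2, ‖ket x y‖ ^ 2 = if y = x then (1 : ℝ) else 0 := by
    intro y
    unfold ket
    split_ifs <;> simp
  simp [normSq, this]

theorem ketZero_eq_ket : ketZero n = ket 0 := rfl

/-- A sum over all bit strings does not change if one bit is resampled. -/
theorem sum_sum_update {M : Type*} [AddCommMonoid M] (q : Fin n) (g : (Fin n → Fin 2) → M) :
    ∑ x, ∑ b, g (Function.update x q b) = 2 • ∑ x, g x := by
  have h : ∀ x : Fin n → Fin 2, ∑ b, g (Function.update x q b) =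
      g x + g (Function.update x q (x q + 1)) := by
    intro x
    have h2 : ∀ c : Fin 2, c = 0 ∨ c = 1 := by decide
    have e : Function.update x q (x q) = x := Function.update_eq_self q x
    rw [Fin.sum_univ_two]
    rcases h2 (x q) with h | h
    · rw [h] at e
      rw [e, h]
      rfl
    · rw [h] at e
      rw [e, h, add_comm]
      rfl
  have hinv : Function.Involutive fun x : Fin n → Fin 2 => Function.update x q (x q + 1) := by
    intro x
    have : ∀ c : Fin 2, c + 1 + 1 = c := by decide
    simp [this]
  simp only [h, Finset.sum_add_distrib]
  rw [two_nsmul]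
  congr 1
  exact Equiv.sum_comp hinv.toPerm g

theorem unitary_norm_sq (U : Matrix.unitaryGroup (Fin 2) ℂ) (v : Fin 2 → ℂ) :
    ∑ b, ‖∑ c, (U : Matrix (Fin 2) (Fin 2) ℂ) b c * v c‖ ^ 2 = ∑ b, ‖v b‖ ^ 2 := by
  have hU := Matrix.mem_unitaryGroup_iff'.mp U.2
  have key : ∀ w : Fin 2 → ℂ, ((∑ b, ‖w b‖ ^ 2 : ℝ) : ℂ) = star w ⬝ᵥ w := by
    intro w
    simp [dotProduct, Complex.conj_mul']
  have h1 : (fun b => ∑ c, (U : Matrix (Fin 2) (Fin 2) ℂ) b c * v c) =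
      (U : Matrix (Fin 2) (Fin 2) ℂ).mulVec v := rfl
  have h2 := key (fun b => ∑ c, (U : Matrix (Fin 2) (Fin 2) ℂ) b c * v c)
  rw [h1, Matrix.star_mulVec, Matrix.dotProduct_mulVec, Matrix.vecMul_vecMul,
    ← Matrix.star_eq_conjTranspose, hU, Matrix.vecMul_one, ← key] at h2
  exact_mod_cast h2

theorem Gate.normSq_apply (g : Gate n) (ψ : QState n) : normSq (g.apply ψ) = normSq ψ := by
  cases g with
  | single q U =>
    -- Resampling the bit `q` groups the amplitudes into pairs, on each of which the gate acts as
    -- the 2×2 unitary `U`.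
    have h1 := sum_sum_update q fun x => ‖Gate.apply (.single q U) ψ x‖ ^ 2
    have h2 := sum_sum_update q fun x => ‖ψ x‖ ^ 2
    have h3 : ∀ x : Fin n → Fin 2,
        ∑ b, ‖Gate.apply (.single q U) ψ (Function.update x q b)‖ ^ 2 =
          ∑ b, ‖ψ (Function.update x q b)‖ ^ 2 := by
      intro x
      rw [← unitary_norm_sq U fun b => ψ (Function.update x q b)]
      simp [Gate.apply]
    simp only [h3] at h1
    rw [h2] at h1
    simp only [two_nsmul] at h1
    unfold normSq
    linarith
  | cnot c t h =>
    have hinv : Function.Involutive fun x : Fin n → Fin 2 =>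
        Function.update x t (x t + x c) := by
      intro x
      have : ∀ a b : Fin 2, a + b + b = a := by decide
      simp [Function.update_of_ne h, this]
    exact Equiv.sum_comp hinv.toPerm fun x => ‖ψ x‖ ^ 2

theorem runCircuit_append (W W' : List (Gate n)) (ψ : QState n) :
    runCircuit (W ++ W') ψ = runCircuit W' (runCircuit W ψ) := List.foldl_append

theorem normSq_runCircuit (W : List (Gate n)) (ψ : QState n) :
    normSq (runCircuit W ψ) = normSq ψ := by
  induction W generalizing ψ with
  | nil => rfl
  | cons g W ih => exact (ih _).trans (g.normSq_apply ψ)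

theorem Gate.apply_smul (g : Gate n) (c : ℂ) (ψ : QState n) :
    g.apply (c • ψ) = c • g.apply ψ := by
  cases g with
  | single q U =>
    ext x
    simp only [Gate.apply, Pi.smul_apply, smul_eq_mul, Finset.mul_sum]
    exact Finset.sum_congr rfl fun b _ => by ring
  | cnot => rfl

theorem runCircuit_smul (W : List (Gate n)) (c : ℂ) (ψ : QState n) :
    runCircuit W (c • ψ) = c • runCircuit W ψ := by
  induction W generalizing ψ with
  | nil => rfl
  | cons g W ih =>
    change runCircuit W (g.apply (c • ψ)) = c • runCircuit W (g.apply ψ)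
    rw [Gate.apply_smul, ih]

/-! ### Born's rule for sequential measurements -/

/-- The joint distribution of the outcomes when all qubits of a unit vector are measured. -/
def bornPMF (ψ : QState n) (h : normSq ψ = 1) : PMF (Fin n → Fin 2) :=
  PMF.ofFintype (fun x => ENNReal.ofReal (‖ψ x‖ ^ 2)) (by
    rw [← ENNReal.ofReal_sum_of_nonneg fun _ _ => by positivity]
    change ENNReal.ofReal (normSq ψ) = 1
    rw [h, ENNReal.ofReal_one])

theorem bornProb_add (ψ : QState n) (q : Fin n) :
    (bornProb ψ q 0 : ℝ) + bornProb ψ q 1 = normSq ψ := by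
  simp only [bornProb, normSq, NNReal.coe_sum, ← Finset.sum_add_distrib]
  refine Finset.sum_congr rfl fun x _ => ?_
  have h2 : ∀ c : Fin 2, c = 0 ∨ c = 1 := by decide
  rcases h2 (x q) with h | h <;> simp [h]

theorem measureOutcome_apply {ψ : QState n} (h : normSq ψ = 1) (q : Fin n) (b : Fin 2) :
    measureOutcome ψ q b = bornProb ψ q b := by
  have hs := bornProb_add ψ q
  rw [h] at hs
  have hs' : bornProb ψ q 0 + bornProb ψ q 1 = 1 := by exact_mod_cast hs
  have hle : bornProb ψ q 1 ≤ 1 := hs' ▸ le_add_self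
  have h2 : ∀ c : Fin 2, c = 0 ∨ c = 1 := by decide
  rcases h2 b with rfl | rfl
  · simp only [measureOutcome, PMF.ofFintype_apply, min_eq_right hle, zero_ne_one, if_false]
    refine ENNReal.sub_eq_of_eq_add (by simp) ?_
    exact_mod_cast hs'.symm
  · simp [measureOutcome, min_eq_right hle]

theorem normSq_collapse {ψ : QState n} {q : Fin n} {b : Fin 2} (h : bornProb ψ q b ≠ 0) :
    normSq (collapse ψ q b) = 1 := by
  have h0 : (bornProb ψ q b : ℝ) ≠ 0 := by exact_mod_cast h
  have h1 : ∀ x, ‖collapse ψ q b x‖ ^ 2 =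
      (if x q = b then ‖ψ x‖ ^ 2 else 0) / (bornProb ψ q b : ℝ) := by
    intro x
    unfold collapse
    split_ifs
    · rw [norm_div, div_pow, Complex.norm_real, Real.norm_eq_abs, sq_abs,
        Real.sq_sqrt (NNReal.coe_nonneg _)]
    · simp
  simp only [normSq, h1, ← Finset.sum_div]
  rw [div_eq_one_iff_eq h0]
  simp [bornProb, apply_ite]

/-- Measuring one qubit of a unit vector and then all qubits is measuring all qubits. -/
theorem bornPMF_eq_bind {ψ : QState n} (h : normSq ψ = 1) (q : Fin n)
    (κ : Fin 2 → PMF (Fin n → Fin 2))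
    (hκ : ∀ b (hb : bornProb ψ q b ≠ 0), κ b = bornPMF (collapse ψ q b) (normSq_collapse hb)) :
    (measureOutcome ψ q).bind κ = bornPMF ψ h := by
  ext x
  have hterm : ∀ b, measureOutcome ψ q b * κ b x =
      if x q = b then ENNReal.ofReal (‖ψ x‖ ^ 2) else 0 := by
    intro b
    rw [measureOutcome_apply h]
    -- If the outcome `b` has probability zero, then `ψ` vanishes on all strings with this bit, so
    -- the value of `κ b` is irrelevant. Otherwise the factor `bornProb ψ q b` cancels the
    -- normalization of the collapsed state.
    by_cases hb : bornProb ψ q b = 0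
    · rw [hb]
      split_ifs with hx
      · have := (Finset.sum_eq_zero_iff.1 hb) x (Finset.mem_univ _)
        rw [if_pos hx] at this
        have h0 : ψ x = 0 := by simpa using this
        simp [h0]
      · simp
    · rw [hκ b hb]
      have h0 : (0 : ℝ) < bornProb ψ q b := by
        have := pos_iff_ne_zero.2 hb
        exact_mod_cast this
      simp only [bornPMF, PMF.ofFintype_apply, collapse]
      split_ifs
      · rw [norm_div, div_pow, Complex.norm_real, Real.norm_eq_abs, sq_abs,
          Real.sq_sqrt h0.le, ← ENNReal.ofReal_coe_nnreal, ← ENNReal.ofReal_mul h0.le,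
          mul_div_cancel₀ _ h0.ne']
      · simp
  rw [PMF.bind_apply, tsum_fintype]
  simp only [hterm, bornPMF, PMF.ofFintype_apply]
  simp

/-! Measurements of basis vectors -/

theorem bornProb_smul_ket {u : ℂ} (hu : ‖u‖ = 1) (x : Fin n → Fin 2) (q : Fin n) (b : Fin 2) :
    bornProb (u • ket x) q b = if x q = b then 1 else 0 := by
  have hu' : ‖u‖₊ = 1 := NNReal.eq hu
  have : ∀ y : Fin n → Fin 2, (if y q = b then ‖(u • ket x) y‖₊ ^ 2 else 0) =
      if y = x then (if x q = b then (1 : NNReal) else 0) else 0 := by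
    intro y
    by_cases hy : y = x
    · subst hy
      simp [ket, hu']
    · simp [ket, hy]
  simp only [bornProb, this]
  simp

theorem normSq_smul_ket {u : ℂ} (hu : ‖u‖ = 1) (x : Fin n → Fin 2) : normSq (u • ket x) = 1 := by
  rw [normSq_smul, hu, normSq_ket]; norm_num

theorem measureOutcome_smul_ket {u : ℂ} (hu : ‖u‖ = 1) (x : Fin n → Fin 2) (q : Fin n) :
    measureOutcome (u • ket x) q = PMF.pure (x q) := by
  ext b
  rw [measureOutcome_apply (normSq_smul_ket hu x), bornProb_smul_ket hu, PMF.pure_apply]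
  by_cases h : x q = b
  · simp [h]
  · simp [h, Ne.symm h]

theorem collapse_smul_ket {u : ℂ} (hu : ‖u‖ = 1) (x : Fin n → Fin 2) (q : Fin n) :
    collapse (u • ket x) q (x q) = u • ket x := by
  ext y
  simp only [collapse, bornProb_smul_ket hu, if_true]
  split_ifs with h
  · simp
  · have : y ≠ x := fun e => h (e ▸ rfl)
    simp [ket, this]

theorem flipQubit_smul_ket (u : ℂ) (x : Fin n → Fin 2) (q : Fin n) :
    flipQubit q (u • ket x) = u • ket (Function.update x q (x q + 1)) := by
  ext y
  have : Function.update y q (y q + 1) = x ↔ y = Function.update x q (x q + 1) := by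
    have h2 : ∀ c : Fin 2, c + 1 + 1 = c := by decide
    constructor
    · rintro rfl
      simp [h2]
    · rintro rfl
      simp [h2]
  simp [flipQubit, ket, this]

theorem reset_smul_ket {u : ℂ} (hu : ‖u‖ = 1) (x : Fin n → Fin 2) (q : Fin n) :
    (if x q = 1 then flipQubit q (collapse (u • ket x) q (x q))
      else collapse (u • ket x) q (x q)) = u • ket (Function.update x q 0) := by
  rw [collapse_smul_ket hu, flipQubit_smul_ket]
  split_ifs with h
  · rw [h]
    rfl
  · have h2 : ∀ c : Fin 2, c ≠ 1 → c = 0 := by decide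
    rw [← h2 _ h, Function.update_eq_self]

/-- A unit vector supported on one bit string is a basis vector up to a phase. -/
theorem eq_smul_ket {ψ : QState n} (h : normSq ψ = 1) {x : Fin n → Fin 2}
    (hx : ∀ y, y ≠ x → ψ y = 0) : ‖ψ x‖ = 1 ∧ ψ = ψ x • ket x := by
  have e : ψ = ψ x • ket x := by
    ext y
    by_cases hy : y = x
    · simp [ket, hy]
    · simp [ket, hy, hx y hy]
  refine ⟨?_, e⟩
  rw [e, normSq_smul, normSq_ket, mul_one] at h
  nlinarith [norm_nonneg (ψ x)]

/-! ## Tensor products of single-qubit gates -/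

theorem tensorOp_one : tensorOp (fun _ : Fin n => (1 : Matrix (Fin 2) (Fin 2) ℂ)) = 1 := by
  ext x y
  simp only [tensorOp, Matrix.of_apply, Matrix.one_apply]
  by_cases h : x = y
  · simp [h]
  · obtain ⟨a, ha⟩ := Function.ne_iff.1 h
    rw [if_neg h]
    exact Finset.prod_eq_zero (Finset.mem_univ a) (if_neg ha)

theorem single_apply_tensorOp (q : Fin n) (U : Matrix.unitaryGroup (Fin 2) ℂ)
    (M : Fin n → Matrix (Fin 2) (Fin 2) ℂ) (ψ : QState n) :
    (Gate.single q U).apply ((tensorOp M).mulVec ψ) =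
      (tensorOp (Function.update M q ((U : Matrix (Fin 2) (Fin 2) ℂ) * M q))).mulVec ψ := by
  ext x
  simp only [Gate.apply, Matrix.mulVec, dotProduct, tensorOp, Matrix.of_apply, Finset.mul_sum]
  rw [Finset.sum_comm]
  refine Finset.sum_congr rfl fun y _ => ?_
  rw [← Finset.mul_prod_erase _ _ (Finset.mem_univ q), Function.update_self, Matrix.mul_apply,
    Finset.sum_mul, Finset.sum_mul]
  refine Finset.sum_congr rfl fun b _ => ?_
  rw [← Finset.mul_prod_erase _ _ (Finset.mem_univ q), Function.update_self]
  have : ∏ a ∈ Finset.univ.erase q, M a (Function.update x q b a) (y a) =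
      ∏ a ∈ Finset.univ.erase q,
        Function.update M q ((U : Matrix (Fin 2) (Fin 2) ℂ) * M q) a (x a) (y a) := by
    refine Finset.prod_congr rfl fun a ha => ?_
    rw [Function.update_of_ne (Finset.ne_of_mem_erase ha),
      Function.update_of_ne (Finset.ne_of_mem_erase ha)]
  rw [this]
  ring

theorem runCircuit_singles (R : Fin n → Matrix.unitaryGroup (Fin 2) ℂ) (ψ : QState n) :
    runCircuit (List.ofFn fun a => Gate.single a (R a)) ψ =
      (tensorOp fun a => (R a : Matrix (Fin 2) (Fin 2) ℂ)).mulVec ψ := by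
  -- After `j` gates the tensor product has the identity at all qubits not yet reached.
  have key : ∀ j ≤ n, runCircuit ((List.ofFn fun a => Gate.single a (R a)).take j) ψ =
      (tensorOp fun a => if (a : ℕ) < j then (R a : Matrix (Fin 2) (Fin 2) ℂ) else 1).mulVec
        ψ := by
    intro j
    induction j with
    | zero =>
      intro _
      simp [runCircuit, tensorOp_one]
    | succ j ih =>
      intro hj
      rw [List.take_add_one, runCircuit_append, ih (by omega)]
      have : (List.ofFn fun a => Gate.single a (R a))[j]?.toList =
          [Gate.single ⟨j, hj⟩ (R ⟨j, hj⟩)] := by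
        rw [List.getElem?_eq_getElem (by simpa using hj)]
        simp
      rw [this]
      change (Gate.single _ _).apply _ = _
      rw [single_apply_tensorOp]
      congr 2
      ext1 a
      by_cases ha : a = ⟨j, hj⟩
      · subst ha
        simp
      · rw [Function.update_of_ne ha]
        have : (a : ℕ) ≠ j := fun h => ha (Fin.ext h)
        have : (a : ℕ) < j ↔ (a : ℕ) < j + 1 := by omega
        simp [this]
  have := key n le_rfl
  rw [List.take_of_length_le (by simp)] at this
  simpa using this

end ColorCode

end

noncomputable section

namespace ColorCode

/-! ## Combinatorics of 2-colexes -/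

namespace Colex

variable {V F : ℕ} (m : Colex V F)

/-- A proper colouring of the faces. -/
def color : Fin F → Fin 3 := m.colorable.choose

instance : Finite m.Dart := m.dart_finite

instance : Fintype m.Dart := Fintype.ofFinite _

theorem color_ne (d : m.Dart) : m.color (m.face d) ≠ m.color (m.face (m.opp d)) :=
  m.colorable.choose_spec d

theorem face_rot_opp (d : m.Dart) : m.face (m.rot (m.opp d)) = m.face d := by
  rw [m.face_eq_iff]
  exact Equiv.Perm.SameCycle.symm ⟨1, by simp⟩

/-- The edge of `d` separates the face of `d` from the face of the next dart at the same vertex. The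
colouring condition across edges thus becomes a condition on consecutive darts around a vertex. -/
theorem face_opp (d : m.Dart) : m.face (m.opp d) = m.face (m.rot d) := by
  rw [← m.face_rot_opp (m.opp d), m.opp_opp]

theorem vertex_rot (d : m.Dart) : m.vertex (m.rot d) = m.vertex d := by
  rw [m.vertex_eq_iff]
  exact Equiv.Perm.SameCycle.symm ⟨1, by simp⟩

theorem color_rot_ne (d : m.Dart) :
    m.color (m.face (m.rot d)) ≠ m.color (m.face d) := by
  rw [← m.face_opp]
  exact (m.color_ne d).symm

theorem rot_ne (d : m.Dart) : m.rot d ≠ d := fun h => m.color_rot_ne d (by rw [h])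

theorem rot_rot_ne (d : m.Dart) : m.rot (m.rot d) ≠ d := by
  intro h
  -- the set of darts at this vertex would have only two elements
  have hsub : ∀ e, m.vertex e = m.vertex d → e = d ∨ e = m.rot d := by
    intro e he
    obtain ⟨i, hi⟩ := (m.vertex_eq_iff d e).1 he.symm
    have hpow : (m.rot ^ 2) d = d := by simpa [pow_two] using h
    have h2 : ((m.rot ^ 2) ^ (i / 2)) d = d := by
      exact Equiv.Perm.zpow_apply_eq_self_of_apply_eq_self hpow _
    have h3 : (m.rot ^ i) d = (m.rot ^ (i % 2)) d := by
      have : i = i % 2 + 2 * (i / 2) := (Int.emod_add_mul_ediv i 2).symm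
      conv_lhs => rw [this, zpow_add, zpow_mul]
      rw [Equiv.Perm.mul_apply]
      congr 1
    rcases Int.emod_two_eq_zero_or_one i with h4 | h4
    · rw [h4] at h3
      left
      rw [← hi, h3]
      simp
    · rw [h4] at h3
      right
      rw [← hi, h3]
      simp
  have hc := m.trivalent (m.vertex d)
  have : Nat.card {e // m.vertex e = m.vertex d} ≤ 2 := by
    rw [Nat.card_eq_fintype_card, Fintype.card_subtype]
    refine (Finset.card_le_card (t := {d, m.rot d}) fun e he => ?_).trans Finset.card_le_two
    rw [Finset.mem_filter] at he
    simpa using hsub e he.2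
  omega

/-- The three iterates of `rot` at `d` are distinct, and a trivalent vertex has room for no further
dart. -/
theorem dart_eq {d e : m.Dart} (h : m.vertex e = m.vertex d) :
    e = d ∨ e = m.rot d ∨ e = m.rot (m.rot d) := by
  have hc := m.trivalent (m.vertex d)
  rw [Nat.card_eq_fintype_card, Fintype.card_subtype] at hc
  have hsub : ({d, m.rot d, m.rot (m.rot d)} : Finset m.Dart) ⊆
      Finset.univ.filter fun e => m.vertex e = m.vertex d := by
    intro e he
    simp only [Finset.mem_insert, Finset.mem_singleton] at he
    rw [Finset.mem_filter]
    refine ⟨Finset.mem_univ _, ?_⟩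
    rcases he with rfl | rfl | rfl <;> simp [vertex_rot]
  have hcard : ({d, m.rot d, m.rot (m.rot d)} : Finset m.Dart).card = 3 :=
    Finset.card_eq_three.2 ⟨_, _, _, (m.rot_ne d).symm, (m.rot_rot_ne d).symm,
      (m.rot_ne (m.rot d)).symm, rfl⟩
  have := Finset.eq_of_subset_of_card_le hsub (by omega)
  have he : e ∈ Finset.univ.filter fun e => m.vertex e = m.vertex d := by simp [h]
  rw [← this] at he
  simpa using he

theorem rot_rot_rot (d : m.Dart) : m.rot (m.rot (m.rot d)) = d := by
  rcases m.dart_eq (d := d) (e := m.rot (m.rot (m.rot d))) (by simp [vertex_rot]) with h | h | h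
  · exact h
  · exact absurd (m.rot.injective h) (m.rot_rot_ne _)
  · exact absurd h (m.rot_ne _)

theorem color_rot_rot_ne (d : m.Dart) :
    m.color (m.face (m.rot (m.rot d))) ≠ m.color (m.face d) := by
  have := m.color_rot_ne (m.rot (m.rot d))
  rw [rot_rot_rot] at this
  exact this.symm

/-- Darts at the same vertex with the same face colour agree. -/
theorem dart_ext {d e : m.Dart} (hv : m.vertex e = m.vertex d)
    (hc : m.color (m.face e) = m.color (m.face d)) : e = d := by
  rcases m.dart_eq hv with h | rfl | rfl
  · exact h
  · exact absurd hc (m.color_rot_ne d)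
  · exact absurd hc (m.color_rot_rot_ne d)

theorem exists_dart (v : Fin V) (c : Fin 3) : ∃ d, m.vertex d = v ∧ m.color (m.face d) = c := by
  obtain ⟨d, rfl⟩ := m.vertex_surjective v
  have h1 := m.color_rot_ne d
  have h2 := m.color_rot_rot_ne d
  have h3 := m.color_rot_ne (m.rot d)
  have key : ∀ a b e c : Fin 3, b ≠ a → e ≠ a → e ≠ b → c = a ∨ c = b ∨ c = e := by decide
  rcases key _ _ _ c h1 h2 h3 with h | h | h
  · exact ⟨d, rfl, h.symm⟩
  · exact ⟨m.rot d, m.vertex_rot d, h.symm⟩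
  · exact ⟨m.rot (m.rot d), by simp [vertex_rot], h.symm⟩

/-- The dart at `v` whose face has colour `c`. -/
def dartAt (v : Fin V) (c : Fin 3) : m.Dart := (m.exists_dart v c).choose

theorem vertex_dartAt (v : Fin V) (c : Fin 3) : m.vertex (m.dartAt v c) = v :=
  (m.exists_dart v c).choose_spec.1

theorem color_dartAt (v : Fin V) (c : Fin 3) : m.color (m.face (m.dartAt v c)) = c :=
  (m.exists_dart v c).choose_spec.2

theorem dartAt_vertex (d : m.Dart) : m.dartAt (m.vertex d) (m.color (m.face d)) = d :=
  m.dart_ext (m.vertex_dartAt _ _) (m.color_dartAt _ _)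

/-- The face of colour `c` at `v`. -/
def faceAt (v : Fin V) (c : Fin 3) : Fin F := m.face (m.dartAt v c)

theorem color_faceAt (v : Fin V) (c : Fin 3) : m.color (m.faceAt v c) = c := m.color_dartAt v c

theorem faceAt_eq {d : m.Dart} {v : Fin V} {c : Fin 3} (hv : m.vertex d = v)
    (hc : m.color (m.face d) = c) : m.faceAt v c = m.face d := by
  subst hv hc
  rw [faceAt, dartAt_vertex]

theorem inc_iff {v : Fin V} {f : Fin F} : m.Inc v f ↔ ∃ c, m.faceAt v c = f := by
  constructor
  · rintro ⟨d, hv, rfl⟩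
    exact ⟨_, m.faceAt_eq hv rfl⟩
  · rintro ⟨c, rfl⟩
    exact ⟨_, m.vertex_dartAt v c, rfl⟩

theorem faceAt_injective (v : Fin V) : Function.Injective (m.faceAt v) := fun c c' h => by
  rw [← m.color_faceAt v c, h, m.color_faceAt]

theorem filter_inc (v : Fin V) :
    Finset.univ.filter (fun f => m.Inc v f) = Finset.univ.map ⟨_, m.faceAt_injective v⟩ := by
  ext f
  simp [inc_iff]

/-- A dart is determined by its vertex and the colour of its face, and every such pair occurs. -/
theorem card_dart : Fintype.card m.Dart = 3 * V := by
  let e : m.Dart ≃ Fin V × Fin 3 :=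
    { toFun := fun d => (m.vertex d, m.color (m.face d))
      invFun := fun x => m.dartAt x.1 x.2
      left_inv := m.dartAt_vertex
      right_inv := fun x => Prod.ext (m.vertex_dartAt _ _) (m.color_dartAt _ _) }
  rw [Fintype.card_congr e]
  simp [mul_comm]

theorem face_card_le (m : Colex V F) : F ≤ 3 * V := by
  rw [← m.card_dart]
  simpa using Fintype.card_le_of_surjective _ m.face_surjective

theorem vertex_card_pos (m : Colex V F) : 0 < V := by
  obtain ⟨d⟩ := m.dart_nonempty
  exact Fin.pos (m.vertex d)

/-- The faces on the two sides of an edge are the same at both of its ends. -/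
theorem faceAt_vertex_opp (d : m.Dart) (c : Fin 3)
    (hc : c = m.color (m.face d) ∨ c = m.color (m.face (m.opp d))) :
    m.faceAt (m.vertex (m.opp d)) c = m.faceAt (m.vertex d) c := by
  rcases hc with rfl | rfl
  · rw [m.faceAt_eq rfl rfl, ← m.face_rot_opp d]
    exact m.faceAt_eq (m.vertex_rot _) rfl
  · rw [m.faceAt_eq rfl rfl, m.face_opp]
    exact (m.faceAt_eq (m.vertex_rot _) rfl).symm

/-- For each vertex `v` and two colours there is exactly one edge at `v` between faces of these
colours. -/
theorem existsUnique_dart_edge (v : Fin V) {c c' : Fin 3} (h : c ≠ c') :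
    ∃! d : m.Dart, m.vertex d = v ∧ ((m.color (m.face d) = c ∧ m.color (m.face (m.opp d)) = c') ∨
      (m.color (m.face d) = c' ∧ m.color (m.face (m.opp d)) = c)) := by
  -- If the darts at `v` carry colours a, b, e in rotation order, their edges separate the colour
  -- pairs ab, be and ea, so each pair of colours occurs exactly once.
  have key : ∀ (d : m.Dart), m.color (m.face (m.opp d)) =
      m.color (m.face (m.rot d)) := fun d => by rw [face_opp]
  have hrot : ∀ d : m.Dart, m.color (m.face (m.rot (m.rot d))) ≠ m.color (m.face (m.rot d)) :=
    fun d => m.color_rot_ne _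
  obtain ⟨d, rfl, hd⟩ := m.exists_dart v c
  have h1 := m.color_rot_ne d
  have h2 := m.color_rot_rot_ne d
  have h3 := hrot d
  have h4 : m.color (m.face (m.rot (m.rot (m.rot d)))) = c := by rw [rot_rot_rot, hd]
  have three : ∀ a b e c' : Fin 3, b ≠ a → e ≠ a → e ≠ b → a ≠ c' → c' = b ∨ c' = e := by decide
  rw [hd] at h1 h2
  simp only [key]
  rcases three _ _ _ c' h1 h2 h3 h with h5 | h5
  · refine ⟨d, ⟨rfl, Or.inl ⟨hd, h5.symm⟩⟩, ?_⟩
    rintro e ⟨he, he'⟩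
    rcases m.dart_eq he with rfl | rfl | rfl
    · rfl
    · grind
    · grind
  · refine ⟨m.rot (m.rot d), ⟨by simp [vertex_rot], Or.inr ⟨h5.symm, h4⟩⟩, ?_⟩
    rintro e ⟨he, he'⟩
    rcases m.dart_eq he with rfl | rfl | rfl
    · grind
    · grind
    · rfl

/-- Functions of the faces of two colours sum to zero modulo two over the vertices. -/
theorem sum_faceAt_eq_zero {c c' : Fin 3} (h : c ≠ c') (g : Fin F → Fin F → ZMod 2) :
    ∑ v, g (m.faceAt v c) (m.faceAt v c') = 0 := by
  -- The darts on edges between a face of colour `c` and one of colour `c'`; there is exactly one at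
  -- each vertex.
  let D : Finset m.Dart := Finset.univ.filter fun d =>
    (m.color (m.face d) = c ∧ m.color (m.face (m.opp d)) = c') ∨
      (m.color (m.face d) = c' ∧ m.color (m.face (m.opp d)) = c)
  have hD : ∀ d, d ∈ D ↔ (m.color (m.face d) = c ∧ m.color (m.face (m.opp d)) = c') ∨
      (m.color (m.face d) = c' ∧ m.color (m.face (m.opp d)) = c) := fun d => by simp [D]
  have h1 : ∑ d ∈ D, g (m.faceAt (m.vertex d) c) (m.faceAt (m.vertex d) c') =
      ∑ v, g (m.faceAt v c) (m.faceAt v c') := by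
    refine Finset.sum_bij (fun d _ => m.vertex d) (fun _ _ => Finset.mem_univ _) ?_ ?_
      (fun _ _ => rfl)
    · intro d hd e he hde
      exact (m.existsUnique_dart_edge (m.vertex e) h).unique ⟨hde, (hD d).1 hd⟩
        ⟨rfl, (hD e).1 he⟩
    · intro v _
      obtain ⟨d, ⟨hd, hd'⟩, -⟩ := m.existsUnique_dart_edge v h
      exact ⟨d, (hD d).2 hd', hd⟩
  rw [← h1]
  -- Both ends of such an edge see the same two faces, so their equal contributions cancel modulo
  -- two.
  refine Finset.sum_involution (fun d _ => m.opp d) ?_ (fun d _ _ => m.opp_ne d) ?_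
    (fun d _ => m.opp_opp d)
  · intro d hd
    have hd' := (hD d).1 hd
    rw [m.faceAt_vertex_opp d c (by grind), m.faceAt_vertex_opp d c' (by grind)]
    exact CharTwo.add_self_eq_zero _
  · intro d hd
    rw [hD] at hd ⊢
    rw [m.opp_opp]
    tauto

/-! ### The code spanned by the faces -/

/-- The sum modulo two of the values of `t` on the faces at `v`. -/
def boundary (t : Fin F → ZMod 2) (v : Fin V) : ZMod 2 := ∑ c, t (m.faceAt v c)

theorem boundary_add (t u : Fin F → ZMod 2) (v : Fin V) :
    m.boundary (t + u) v = m.boundary t v + m.boundary u v := by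
  simp [boundary, Finset.sum_add_distrib]

/-- The code spanned by the faces is self-orthogonal. -/
theorem sum_boundary_mul_boundary (t u : Fin F → ZMod 2) :
    ∑ v, m.boundary t v * m.boundary u v = 0 := by
  simp only [boundary, Finset.sum_mul_sum]
  rw [Finset.sum_comm]
  refine Finset.sum_eq_zero fun c _ => ?_
  rw [Finset.sum_comm]
  refine Finset.sum_eq_zero fun c' _ => ?_
  by_cases h : c = c'
  · subst h
    -- The summand involves only the faces of colour `c`; any other colour serves as a dummy second
    -- argument.
    have hne : c ≠ c + 1 := by revert c; decide
    exact m.sum_faceAt_eq_zero hne fun f _ => t f * u f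
  · exact m.sum_faceAt_eq_zero h fun f g => t f * u g

/-- The two ends of an edge share the faces on both of its sides. Since the three values at each end
sum to zero, the values on the two remaining faces, which have the third colour, agree as well.
Connectedness carries this along all edges, so `t` depends only on the colour of a face. -/
theorem faceAt_const_of_boundary_eq_zero {t : Fin F → ZMod 2} (ht : ∀ v, m.boundary t v = 0)
    (d e : m.Dart) (c : Fin 3) :
    t (m.faceAt (m.vertex d) c) = t (m.faceAt (m.vertex e) c) := by
  have hopp : ∀ (d : m.Dart) c,
      t (m.faceAt (m.vertex (m.opp d)) c) = t (m.faceAt (m.vertex d) c) := by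
    intro d c
    have hne := m.color_ne d
    by_cases hc : c = m.color (m.face d) ∨ c = m.color (m.face (m.opp d))
    · rw [m.faceAt_vertex_opp d c hc]
    · push Not at hc
      have huniv : (Finset.univ : Finset (Fin 3)) =
          {c, m.color (m.face d), m.color (m.face (m.opp d))} := by
        have : ∀ a b c : Fin 3, c ≠ a → c ≠ b → a ≠ b →
          (Finset.univ : Finset (Fin 3)) = {c, a, b} := by decide
        exact this _ _ _ hc.1 hc.2 hne
      have hsum : ∀ s : Fin 3 → ZMod 2, ∑ i, s i =
          s c + (s (m.color (m.face d)) + s (m.color (m.face (m.opp d)))) := by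
        intro s
        rw [huniv, Finset.sum_insert (by simp [hc]), Finset.sum_pair hne]
      have h1 := ht (m.vertex d)
      have h2 := ht (m.vertex (m.opp d))
      rw [boundary, hsum] at h1 h2
      rw [m.faceAt_vertex_opp d _ (Or.inl rfl), m.faceAt_vertex_opp d _ (Or.inr rfl)] at h2
      exact add_right_cancel (h2.trans h1.symm)
  obtain ⟨g, hg, rfl⟩ := m.connected d e
  suffices H : ∀ d c, t (m.faceAt (m.vertex (g d)) c) = t (m.faceAt (m.vertex d) c) from
    (H d c).symm
  induction hg using Subgroup.closure_induction with
  | mem x hx =>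
    rcases hx with rfl | rfl
    · intro d c
      rw [vertex_rot]
    · exact hopp
  | one => intro d c; rfl
  | mul x y _ _ hx hy => intro d c; rw [Equiv.Perm.mul_apply, hx, hy]
  | inv x _ hx =>
    intro d c
    rw [← hx (x⁻¹ d) c]
    simp

/-- The faces satisfy exactly two independent relations. -/
theorem card_boundary_eq_zero :
    (Finset.univ.filter fun t : Fin F → ZMod 2 => ∀ v, m.boundary t v = 0).card = 4 := by
  -- Elements of the kernel are the functions of the colour whose three values sum to zero.
  have h4 : (Finset.univ.filter fun a : Fin 3 → ZMod 2 => ∑ c, a c = 0).card = 4 := by decide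
  obtain ⟨d₀⟩ := m.dart_nonempty
  rw [← h4]
  refine Finset.card_bij' (fun t _ c => t (m.faceAt (m.vertex d₀) c)) (fun a _ f => a (m.color f))
    ?_ ?_ ?_ ?_
  · intro t ht
    rw [Finset.mem_filter] at ht ⊢
    exact ⟨Finset.mem_univ _, ht.2 (m.vertex d₀)⟩
  · intro a ha
    rw [Finset.mem_filter] at ha ⊢
    refine ⟨Finset.mem_univ _, fun v => ?_⟩
    simpa [boundary, color_faceAt] using ha.2
  · intro t ht
    rw [Finset.mem_filter] at ht
    ext1 f
    obtain ⟨d, rfl⟩ := m.face_surjective f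
    have := m.faceAt_const_of_boundary_eq_zero ht.2 d₀ d (m.color (m.face d))
    change t (m.faceAt (m.vertex d₀) (m.color (m.face d))) = _
    rw [this, m.faceAt_eq rfl rfl]
  · intro a ha
    ext1 c
    change a (m.color (m.faceAt _ c)) = a c
    rw [color_faceAt]

end Colex

end ColorCode

end

noncomputable section

namespace ColorCode

variable {n : ℕ}

/-! ## Preparation of code states by Gaussian elimination -/

/-- The operator `1 + X_b`, where `X_b` flips the bits in the support of `b`. -/
def onePlusX (b : Fin n → Fin 2) (ψ : QState n) : QState n := fun x => ψ x + ψ (x + b)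

/-- The product of the operators `1 + X_b` for `b = c 0, …, c (k - 1)`. -/
def prodOnePlusX (c : ℕ → Fin n → Fin 2) : ℕ → QState n → QState n
  | 0, ψ => ψ
  | k + 1, ψ => prodOnePlusX c k (onePlusX (c k) ψ)

theorem bits_add_self (b : Fin n → Fin 2) : b + b = 0 := by
  have : ∀ a : Fin 2, a + a = 0 := by decide
  ext1 v
  exact this _

theorem onePlusX_zero (ψ : QState n) : onePlusX 0 ψ = (2 : ℂ) • ψ := by
  ext x
  simp [onePlusX, two_mul]

theorem onePlusX_comm (b b' : Fin n → Fin 2) (ψ : QState n) :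
    onePlusX b (onePlusX b' ψ) = onePlusX b' (onePlusX b ψ) := by
  ext x
  simp only [onePlusX, add_right_comm x b' b]
  ring

/-- The factor 1 + X_b' absorbs X_b', so b may be shifted by b' in the other factor. This is what
makes column operations harmless. -/
theorem onePlusX_add (b b' : Fin n → Fin 2) (ψ : QState n) :
    onePlusX (b + b') (onePlusX b' ψ) = onePlusX b (onePlusX b' ψ) := by
  ext x
  have h1 : x + b + b' + b' = x + b := by
    rw [add_assoc (x + b), bits_add_self, add_zero]
  have h2 : x + (b + b') = x + b + b' := (add_assoc _ _ _).symm
  simp only [onePlusX, h2, h1]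
  ring

theorem prodOnePlusX_comm (c : ℕ → Fin n → Fin 2) (k : ℕ) (b : Fin n → Fin 2) (ψ : QState n) :
    prodOnePlusX c k (onePlusX b ψ) = onePlusX b (prodOnePlusX c k ψ) := by
  induction k generalizing ψ with
  | zero => rfl
  | succ k ih => rw [prodOnePlusX, onePlusX_comm, ih, prodOnePlusX]

theorem prodOnePlusX_succ (c : ℕ → Fin n → Fin 2) (k : ℕ) (ψ : QState n) :
    prodOnePlusX c (k + 1) ψ = onePlusX (c k) (prodOnePlusX c k ψ) :=
  prodOnePlusX_comm c k _ ψ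

/-- Adding multiples of a further vector to the others does not change the product. -/
theorem prodOnePlusX_add {c c' : ℕ → Fin n → Fin 2} {k : ℕ} {b : Fin n → Fin 2}
    (h : ∀ i < k, c' i = c i ∨ c' i = c i + b) (ψ : QState n) :
    onePlusX b (prodOnePlusX c' k ψ) = onePlusX b (prodOnePlusX c k ψ) := by
  induction k with
  | zero => rfl
  | succ k ih =>
    have ih' := ih fun i hi => h i (by omega)
    rw [prodOnePlusX_succ, prodOnePlusX_succ, onePlusX_comm, ih', onePlusX_comm b (c k)]
    rcases h k (by omega) with h | h
    · rw [h]
    · rw [h, onePlusX_add]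

/-- Expanding the product gives one term for each subset of the factors, which shifts the argument
by the sum of the vectors in the subset. -/
theorem prodOnePlusX_apply (c : ℕ → Fin n → Fin 2) (k : ℕ) (ψ : QState n) (x : Fin n → Fin 2) :
    prodOnePlusX c k ψ x =
      ∑ t : Fin k → Fin 2, ψ (x + ∑ i, if t i = 1 then c i else 0) := by
  induction k generalizing ψ x with
  | zero => simp [prodOnePlusX]
  | succ k ih =>
    rw [prodOnePlusX, ih, ← (Fin.snocEquiv fun _ => Fin 2).sum_comp, Fintype.sum_prod_type,
      Fin.sum_univ_two, ← Finset.sum_add_distrib]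
    refine Finset.sum_congr rfl fun t _ => ?_
    simp [onePlusX, Fin.snocEquiv, Fin.sum_univ_castSucc, add_assoc]

/-- A bit that vanishes on the support of `ψ` and is not flipped vanishes on the support of the
product. -/
theorem prodOnePlusX_support {c : ℕ → Fin n → Fin 2} {k : ℕ} {p : Fin n}
    (h : ∀ i < k, c i p = 0) {ψ : QState n} (hψ : ∀ x, x p ≠ 0 → ψ x = 0) :
    ∀ x, x p ≠ 0 → prodOnePlusX c k ψ x = 0 := by
  induction k generalizing ψ with
  | zero => exact hψ
  | succ k ih =>
    refine ih (fun i hi => h i (by omega)) fun x hx => ?_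
    have : (x + c k) p ≠ 0 := by simpa [h k (by omega)] using hx
    simp [onePlusX, hψ x hx, hψ _ this]

/-- The matrix of the gate that maps `|0⟩` to `(|0⟩ + |1⟩) / √2`. -/
def hadamardMatrix : Matrix (Fin 2) (Fin 2) ℂ :=
  Matrix.of fun i j => ((if i = 1 ∧ j = 1 then -1 else 1) * (1 / Real.sqrt 2) : ℝ)

def hadamard : Matrix.unitaryGroup (Fin 2) ℂ :=
  ⟨hadamardMatrix, by
    have h : ((1 / Real.sqrt 2 : ℝ) : ℂ) * ((1 / Real.sqrt 2 : ℝ) : ℂ) = 1 / 2 := by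
      rw [← Complex.ofReal_mul, div_mul_div_comm, Real.mul_self_sqrt (by norm_num)]
      norm_num
    rw [Matrix.mem_unitaryGroup_iff]
    ext i j
    rw [Matrix.mul_apply, Fin.sum_univ_two]
    fin_cases i <;> fin_cases j <;>
      simp only [hadamardMatrix, Matrix.star_apply, Matrix.of_apply, Complex.star_def,
        Complex.conj_ofReal] <;>
      simp [-one_div, -Complex.ofReal_div, h]⟩

theorem hadamard_apply_zero (i : Fin 2) :
    (hadamard : Matrix (Fin 2) (Fin 2) ℂ) i 0 = ((1 / Real.sqrt 2 : ℝ) : ℂ) := by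
  simp [hadamard, hadamardMatrix]

/-! ### Elimination and the preparation circuit -/

/-- The last row among the first `j` in which column `f` of `M` is not zero; `n` if there is
none. -/
def pivotUpTo (n : ℕ) (M : ℕ → ℕ → Fin 2) (f : ℕ) : ℕ → ℕ
  | 0 => n
  | j + 1 => if M j f = 1 then j else pivotUpTo n M f j

def pivot (n : ℕ) (M : ℕ → ℕ → Fin 2) (f : ℕ) : ℕ := pivotUpTo n M f n

theorem pivot_spec (n : ℕ) (M : ℕ → ℕ → Fin 2) (f : ℕ) :
    (pivot n M f < n ∧ M (pivot n M f) f = 1) ∨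
      (pivot n M f = n ∧ ∀ v < n, M v f = 0) := by
  have key : ∀ j, (pivotUpTo n M f j < j ∧ M (pivotUpTo n M f j) f = 1) ∨
      (pivotUpTo n M f j = n ∧ ∀ v < j, M v f = 0) := by
    intro j
    induction j with
    | zero => exact Or.inr ⟨rfl, by simp⟩
    | succ j ih =>
      have h2 : ∀ c : Fin 2, c ≠ 1 → c = 0 := by decide
      unfold pivotUpTo
      split_ifs with h
      · exact Or.inl ⟨by omega, h⟩
      · rcases ih with ⟨h1, h3⟩ | ⟨h1, h3⟩
        · exact Or.inl ⟨by omega, h3⟩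
        · refine Or.inr ⟨h1, fun v hv => ?_⟩
          rcases Nat.lt_succ_iff_lt_or_eq.1 hv with hv | rfl
          · exact h3 v hv
          · exact h2 _ h
  exact key n

/-- Adds column `f` to those columns to the left of it that do not vanish in the pivot row. -/
def elimStep (n : ℕ) (M : ℕ → ℕ → Fin 2) (f : ℕ) : ℕ → ℕ → Fin 2 := fun i k =>
  if k < f ∧ i < n then M i k + M (pivot n M f) k * M i f else M i k

/-- Gaussian elimination with the columns `f - 1, …, 0`. -/
def elim (n : ℕ) : ℕ → (ℕ → ℕ → Fin 2) → ℕ → ℕ → Fin 2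
  | 0, M => M
  | f + 1, M => elim n f (elimStep n M f)

/-- Column `f` as a vector of bits. -/
def column (n : ℕ) (M : ℕ → ℕ → Fin 2) (f : ℕ) : Fin n → Fin 2 := fun v => M v f

theorem elim_of_le {f k : ℕ} (M : ℕ → ℕ → Fin 2) (h : f ≤ k) (i : ℕ) :
    elim n f M i k = M i k := by
  induction f generalizing M with
  | zero => rfl
  | succ f ih =>
    rw [elim, ih _ (by omega), elimStep, if_neg (by omega)]

theorem column_elimStep {f k : ℕ} (M : ℕ → ℕ → Fin 2) (h : k < f) :
    column n (elimStep n M f) k = column n M k ∨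
      column n (elimStep n M f) k = column n M k + column n M f := by
  have h2 : ∀ c : Fin 2, c = 0 ∨ c = 1 := by decide
  rcases h2 (M (pivot n M f) k) with hp | hp
  · left
    ext1 v
    simp [column, elimStep, h, hp]
  · right
    ext1 v
    simp [column, elimStep, h, hp]

/-- In the step for column `f` this column itself is kept, and the others change only by adding it,
which `prodOnePlusX_add` allows. Later steps leave it untouched. -/
theorem prodOnePlusX_elim (f : ℕ) (M : ℕ → ℕ → Fin 2) (ψ : QState n) :
    prodOnePlusX (column n (elim n f M)) f ψ = prodOnePlusX (column n M) f ψ := by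
  induction f generalizing M with
  | zero => rfl
  | succ f ih =>
    have h1 : column n (elim n (f + 1) M) f = column n M f := by
      ext1 v
      rw [column, elim, elim_of_le _ le_rfl, elimStep, if_neg (by omega), column]
    rw [prodOnePlusX_succ, h1, elim, ih, prodOnePlusX_add fun i hi => column_elimStep M hi,
      prodOnePlusX_succ]

/-- What a step adds within a row is a multiple of the entry of that row in the eliminating column,
which is zero here. -/
theorem elim_row_eq_zero {f p : ℕ} {M : ℕ → ℕ → Fin 2} (h : ∀ k < f, M p k = 0) :
    ∀ k < f, elim n f M p k = 0 := by
  induction f generalizing M with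
  | zero => exact h
  | succ f ih =>
    intro k hk
    have key : ∀ k < f + 1, elimStep n M f p k = 0 := by
      intro k hk
      unfold elimStep
      split_ifs
      · simp [h k hk, h f (by omega)]
      · exact h k hk
    rcases Nat.lt_succ_iff_lt_or_eq.1 hk with hk | rfl
    · exact ih (fun k hk => key k (by omega)) k hk
    · rw [elim, elim_of_le _ le_rfl]
      exact key _ (by omega)

theorem pivot_congr {M M' : ℕ → ℕ → Fin 2} {f : ℕ} (h : ∀ i, M i f = M' i f) :
    pivot n M f = pivot n M' f := by
  suffices H : ∀ j, pivotUpTo n M f j = pivotUpTo n M' f j from H n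
  intro j
  induction j with
  | zero => rfl
  | succ j ih => simp only [pivotUpTo, h, ih]

/-- After the elimination every pivot row vanishes to the left of its pivot. -/
theorem elim_pivot_row {F f : ℕ} (M : ℕ → ℕ → Fin 2) (hf : f < F)
    (hp : pivot n (elim n F M) f < n) : ∀ k < f, elim n F M (pivot n (elim n F M) f) k = 0 := by
  induction F generalizing M with
  | zero => omega
  | succ F ih =>
    rcases Nat.lt_succ_iff_lt_or_eq.1 hf with hf | rfl
    · exact ih (elimStep n M F) hf hp
    · have hcol : ∀ i, elim n (f + 1) M i f = M i f := fun i => by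
        rw [elim, elim_of_le _ le_rfl, elimStep, if_neg (by omega)]
      have hpiv := pivot_congr (n := n) hcol
      rw [hpiv] at hp ⊢
      refine elim_row_eq_zero fun k hk => ?_
      rcases pivot_spec n M f with ⟨-, h1⟩ | ⟨h1, -⟩
      · have h2 : ∀ a : Fin 2, a + a * 1 = 0 := by decide
        simp only [elimStep, hk, hp, and_self, if_true, h1, h2]
      · omega

/-- The gates that apply `(1 + X_b) / √2` for column `b` of `M`. -/
def columnCircuit (n : ℕ) (M : ℕ → ℕ → Fin 2) (f : ℕ) : List (Gate n) :=
  singleCircuit n (pivot n M f) hadamard ++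
    (List.range n).flatMap fun v => if M v f = 1 then cnotCircuit n (pivot n M f) v else []

def codeCircuit (n : ℕ) (M : ℕ → ℕ → Fin 2) (k : ℕ) : List (Gate n) :=
  (List.range k).flatMap (columnCircuit n M)

theorem runCircuit_singleton (g : Gate n) (ψ : QState n) : runCircuit [g] ψ = g.apply ψ := rfl

/-- All CNOTs have the control `p`, whose bit never changes, so together they add x_p times the
column to the string. The index `p` itself is skipped because `cnotCircuit` is empty there. -/
theorem runCircuit_cnots (p : Fin n) (M : ℕ → ℕ → Fin 2) (f j : ℕ) (hj : j ≤ n) (ψ : QState n)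
    (x : Fin n → Fin 2) :
    runCircuit ((List.range j).flatMap fun v => if M v f = 1 then cnotCircuit n p v else []) ψ x =
      ψ fun v => if v ≠ p ∧ (v : ℕ) < j then x v + x p * M v f else x v := by
  induction j generalizing x with
  | zero => simp [runCircuit]
  | succ j ih =>
    rw [List.range_succ, List.flatMap_append, runCircuit_append]
    simp only [List.flatMap_cons, List.flatMap_nil, List.append_nil]
    have h2 : ∀ c : Fin 2, c ≠ 1 → c = 0 := by decide
    by_cases hM : M j f = 1
    · rw [if_pos hM]
      by_cases hp : (p : ℕ) = j
      · rw [cnotCircuit, dif_neg (by simp [hp])]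
        change runCircuit _ ψ x = _
        rw [ih (by omega)]
        congr 1
        ext1 v
        have : (v ≠ p ∧ (v : ℕ) < j) ↔ (v ≠ p ∧ (v : ℕ) < j + 1) := by
          constructor
          · rintro ⟨h1, h2⟩; exact ⟨h1, by omega⟩
          · rintro ⟨h1, h2⟩
            have : (v : ℕ) ≠ p := fun h => h1 (Fin.ext h)
            exact ⟨h1, by omega⟩
        simp only [this]
      · rw [cnotCircuit, dif_pos ⟨⟨p.2, by omega⟩, hp⟩]
        change runCircuit _ ψ _ = _
        rw [ih (by omega)]
        congr 1
        ext1 v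
        have hpj : p ≠ ⟨j, by omega⟩ := fun h => hp (congrArg Fin.val h)
        by_cases hv : v = ⟨j, by omega⟩
        · subst hv
          simp [hM, Ne.symm hpj]
        · have hvj : (v : ℕ) ≠ j := fun h => hv (Fin.ext h)
          have : (v : ℕ) < j ↔ (v : ℕ) < j + 1 := by omega
          simp [Function.update_of_ne hv, Function.update_of_ne hpj, this]
    · rw [if_neg hM]
      change runCircuit _ ψ x = _
      rw [ih (by omega)]
      congr 1
      ext1 v
      by_cases hvj : (v : ℕ) = j
      · simp [hvj, h2 _ hM]
      · have : (v : ℕ) < j ↔ (v : ℕ) < j + 1 := by omega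
        simp [this]

/-- When the pivot bit is 0 on the support of `ψ`, the two terms of ψ + X_b ψ live on strings with
pivot bit 0 and 1. The Hadamard gate creates both branches, and the CNOTs shift the second one by
the column. For a zero column the circuit is empty and 1 + X_b is multiplication by 2, hence the
constant 1/2. -/
theorem runCircuit_columnCircuit (M : ℕ → ℕ → Fin 2) (f : ℕ) (ψ : QState n)
    (hψ : ∀ p : Fin n, (p : ℕ) = pivot n M f → ∀ x, x p ≠ 0 → ψ x = 0) :
    ∃ c : ℝ, 0 < c ∧ runCircuit (columnCircuit n M f) ψ = (c : ℂ) • onePlusX (column n M f) ψ := by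
  have h2 : ∀ c : Fin 2, c = 0 ∨ c = 1 := by decide
  rcases pivot_spec n M f with ⟨hp, hM⟩ | ⟨hp, hM⟩
  · obtain ⟨p, hpp⟩ : ∃ p : Fin n, (p : ℕ) = pivot n M f := ⟨⟨_, hp⟩, rfl⟩
    refine ⟨1 / Real.sqrt 2, by positivity, ?_⟩
    have hψ' := hψ p hpp
    rw [← hpp] at hM
    ext x
    have hH : singleCircuit n (p : ℕ) hadamard = [Gate.single p hadamard] := dif_pos p.2
    rw [columnCircuit, ← hpp, hH, runCircuit_append, runCircuit_cnots p M f n le_rfl,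
      runCircuit_singleton]
    simp only [Gate.apply, Fin.sum_univ_two, hadamard_apply_zero]
    rw [hψ' (Function.update _ p 1) (by simp), mul_zero, add_zero, Pi.smul_apply, smul_eq_mul]
    congr 1
    unfold onePlusX
    rcases h2 (x p) with hx | hx
    · rw [hψ' (x + column n M f) (by simp [hx, column, hM]), add_zero]
      congr 1
      ext1 v
      by_cases hv : v = p
      · subst hv
        simp [hx]
      · simp [hv, hx]
    · rw [hψ' x (by simp [hx]), zero_add]
      congr 1
      ext1 v
      by_cases hv : v = p
      · subst hv
        simp [hx, column, hM]
      · simp [hv, hx, column]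
  · refine ⟨1 / 2, by norm_num, ?_⟩
    have hc : column n M f = 0 := by
      ext1 v
      exact hM v v.2
    have hW : columnCircuit n M f = [] := by
      rw [columnCircuit, singleCircuit, dif_neg (by omega), List.nil_append,
        List.flatMap_eq_nil_iff]
      intro v hv
      rw [hM v (List.mem_range.1 hv)]
      simp
    rw [hW, hc, onePlusX_zero, smul_smul]
    simp [runCircuit]

/-- The columns are processed from left to right: the earlier ones vanish in the pivot row of column
`k`, so the pivot qubit of `k` is still 0 when its turn comes. -/
theorem runCircuit_codeCircuit (M : ℕ → ℕ → Fin 2) (F k : ℕ) (hk : k ≤ F) :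
    ∃ c : ℝ, 0 < c ∧ runCircuit (codeCircuit n (elim n F M) k) (ketZero n) =
      (c : ℂ) • prodOnePlusX (column n (elim n F M)) k (ketZero n) := by
  induction k with
  | zero => exact ⟨1, one_pos, by simp [codeCircuit, runCircuit, prodOnePlusX]⟩
  | succ k ih =>
    obtain ⟨c, hc, h⟩ := ih (by omega)
    have hsupp : ∀ p : Fin n, (p : ℕ) = pivot n (elim n F M) k → ∀ x, x p ≠ 0 →
        prodOnePlusX (column n (elim n F M)) k (ketZero n) x = 0 := by
      intro p hp
      refine prodOnePlusX_support (fun i hi => ?_) fun x hx => ?_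
      · rw [column, hp]
        exact elim_pivot_row M (by omega) (hp ▸ p.2) i hi
      · have : x ≠ 0 := fun e => hx (by rw [e]; rfl)
        simp [ketZero, this]
    obtain ⟨c', hc', h'⟩ := runCircuit_columnCircuit (elim n F M) k _ hsupp
    refine ⟨c * c', by positivity, ?_⟩
    rw [codeCircuit, List.range_succ, List.flatMap_append, runCircuit_append]
    change runCircuit _ (runCircuit (codeCircuit n (elim n F M) k) _) = _
    simp only [List.flatMap_cons, List.flatMap_nil, List.append_nil]
    rw [h, runCircuit_smul, h', smul_smul, prodOnePlusX_succ]
    push_cast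
    rfl

theorem length_codeCircuit_le (M : ℕ → ℕ → Fin 2) (k : ℕ) :
    (codeCircuit n M k).length ≤ k * (n + 1) := by
  have h1 : ∀ f, (columnCircuit n M f).length ≤ n + 1 := by
    intro f
    have h3 : (singleCircuit n (pivot n M f) hadamard).length ≤ 1 := by
      unfold singleCircuit
      split_ifs <;> simp
    have h4 : ∀ j, ((List.range j).flatMap fun v =>
        if M v f = 1 then cnotCircuit n (pivot n M f) v else []).length ≤ j := by
      intro j
      induction j with
      | zero => simp
      | succ j ih =>
        rw [List.range_succ, List.flatMap_append, List.length_append]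
        refine Nat.add_le_add ih ?_
        simp only [List.flatMap_cons, List.flatMap_nil, List.append_nil, cnotCircuit]
        split_ifs <;> simp
    rw [columnCircuit, List.length_append]
    have := h4 n
    omega
  induction k with
  | zero => simp [codeCircuit]
  | succ k ih =>
    rw [codeCircuit, List.range_succ, List.flatMap_append, List.length_append, add_mul]
    refine Nat.add_le_add ih ?_
    simpa using h1 k

end ColorCode

end

noncomputable section

namespace ColorCode

/-! ## The colour code state -/

section

variable {V F : ℕ} (m : Colex V F)

/-- The vertex-face incidence matrix, extended by zero. -/
def incMatrix : ℕ → ℕ → Fin 2 := fun i j =>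
  if h : i < V ∧ j < F then (if m.Inc ⟨i, h.1⟩ ⟨j, h.2⟩ then 1 else 0) else 0

theorem tensorOp_pauliX_mulVec {n : ℕ} (P : Fin n → Prop) (ψ : QState n) :
    (tensorOp fun v => if P v then pauliX else 1).mulVec ψ =
      fun x => ψ (x + fun v => if P v then 1 else 0) := by
  ext x
  have h : ∀ y, (tensorOp fun v => if P v then pauliX else 1) x y =
      if y = (x + fun v => if P v then 1 else 0) then 1 else 0 := by
    intro y
    have hv : ∀ v, (if P v then pauliX else 1) (x v) (y v) =
        if y v = x v + (if P v then 1 else 0) then (1 : ℂ) else 0 := by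
      intro v
      have hx : ∀ a b : Fin 2, pauliX a b = if b = a + 1 then (1 : ℂ) else 0 := by
        intro a b
        fin_cases a <;> fin_cases b <;> simp [pauliX]
      by_cases hP : P v
      · rw [if_pos hP, if_pos hP, hx]
      · rw [if_neg hP, if_neg hP, add_zero, Matrix.one_apply]
        simp only [eq_comm]
    simp only [tensorOp, Matrix.of_apply, hv]
    split_ifs with hy
    · refine Finset.prod_eq_one fun v _ => ?_
      rw [if_pos]
      rw [hy]
      rfl
    · obtain ⟨v, hv'⟩ := Function.ne_iff.1 hy
      exact Finset.prod_eq_zero (Finset.mem_univ v) (if_neg hv')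
  simp [Matrix.mulVec, dotProduct, h]

theorem one_add_faceX_mulVec (f : Fin F) (ψ : QState V) :
    (1 + faceX m f).mulVec ψ = onePlusX (column V (incMatrix m) f) ψ := by
  rw [Matrix.add_mulVec, Matrix.one_mulVec, faceX, tensorOp_pauliX_mulVec]
  ext x
  simp only [onePlusX, Pi.add_apply]
  congr 3
  ext1 v
  simp [column, incMatrix]

theorem omegaUnnormalized_eq :
    omegaUnnormalized m = prodOnePlusX (column V (incMatrix m)) F (ketZero V) := by
  have key : ∀ (k : ℕ) (hk : k ≤ F) (ψ : QState V),
      (List.ofFn fun f : Fin k => 1 + faceX m (Fin.castLE hk f)).prod.mulVec ψ =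
        prodOnePlusX (column V (incMatrix m)) k ψ := by
    intro k
    induction k with
    | zero => intro _ ψ; simp [prodOnePlusX]
    | succ k ih =>
      intro hk ψ
      rw [List.ofFn_succ', List.concat_eq_append, List.prod_append, List.prod_singleton,
        ← Matrix.mulVec_mulVec, one_add_faceX_mulVec, prodOnePlusX, ← ih (by omega)]
      rfl
  exact key F le_rfl _

/-- A circuit that prepares the colour code state. -/
def omegaCircuit {V F : ℕ} (m : Colex V F) : List (Gate V) :=
  codeCircuit V (elim V F (incMatrix m)) F

/-- The circuit preserves the norm, so the positive factor it produces is forced to be the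
normalizing one. -/
theorem exists_runCircuit_omegaCircuit :
    ∃ c : ℝ, 0 < c ∧ c ^ 2 * normSq (omegaUnnormalized m) = 1 ∧
      runCircuit (omegaCircuit m) (ketZero V) = (c : ℂ) • omegaUnnormalized m := by
  obtain ⟨c, hc, h⟩ := runCircuit_codeCircuit (n := V) (incMatrix m) F F le_rfl
  rw [prodOnePlusX_elim, ← omegaUnnormalized_eq] at h
  refine ⟨c, hc, ?_, h⟩
  have h1 := congrArg normSq h
  rw [normSq_runCircuit, ketZero_eq_ket, normSq_ket, normSq_smul, Complex.norm_real,
    Real.norm_eq_abs, sq_abs] at h1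
  exact h1.symm

theorem omega_eq_smul {c : ℝ} (hc : 0 < c) (h : c ^ 2 * normSq (omegaUnnormalized m) = 1) :
    omega m = (c : ℂ) • omegaUnnormalized m := by
  have h1 : normSq (omegaUnnormalized m) = (c⁻¹) ^ 2 := by
    field_simp
    linarith
  ext x
  rw [omega, h1, Real.sqrt_sq (by positivity), Pi.smul_apply, smul_eq_mul]
  push_cast
  rw [div_inv_eq_mul, mul_comm]

theorem runCircuit_omegaCircuit : runCircuit (omegaCircuit m) (ketZero V) = omega m := by
  obtain ⟨c, hc, h1, h2⟩ := exists_runCircuit_omegaCircuit m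
  rw [h2, omega_eq_smul m hc h1]

theorem normSq_omega : normSq (omega m) = 1 := by
  rw [← runCircuit_omegaCircuit, normSq_runCircuit, ketZero_eq_ket, normSq_ket]

theorem length_omegaCircuit_le : (omegaCircuit m).length ≤ 6 * V ^ 3 := by
  have h1 := length_codeCircuit_le (n := V) (elim V F (incMatrix m)) F
  have h2 := m.face_card_le
  have h3 := m.vertex_card_pos
  calc (omegaCircuit m).length ≤ F * (V + 1) := h1
    _ ≤ (3 * V) * (V + V) := Nat.mul_le_mul h2 (by omega)
    _ = 6 * V ^ 2 * 1 := by ring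
    _ ≤ 6 * V ^ 2 * V := Nat.mul_le_mul_left _ h3
    _ = 6 * V ^ 3 := by ring

/-- The identification of `ZMod 2` with `Fin 2`. -/
def toBit : ZMod 2 →+ Fin 2 where
  toFun a := a
  map_zero' := rfl
  map_add' _ _ := rfl

theorem toBit_bijective : Function.Bijective toBit := Function.bijective_id

theorem toBit_one : toBit 1 = 1 := rfl

/-- The boundary of a set of faces as a bit string. -/
def boundaryBits (t : Fin F → ZMod 2) : Fin V → Fin 2 := fun v => toBit (m.boundary t v)

theorem boundaryBits_eq_sum (t : Fin F → ZMod 2) :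
    boundaryBits m t = ∑ f : Fin F, if toBit (t f) = 1 then column V (incMatrix m) f else 0 := by
  ext1 v
  have h1 : m.boundary t v = ∑ f ∈ Finset.univ.filter (fun f => m.Inc v f), t f := by
    rw [m.filter_inc, Finset.sum_map]
    rfl
  rw [boundaryBits, h1, Finset.sum_filter, map_sum, Finset.sum_apply]
  refine Finset.sum_congr rfl fun f _ => ?_
  have h2 : ∀ c : ZMod 2, c = 0 ∨ c = 1 := by decide
  rcases h2 (t f) with ht | ht <;> by_cases hi : m.Inc v f <;>
    simp [hi, ht, column, incMatrix, toBit_one]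

/-- The amplitude counts the sets of faces with boundary `x`. -/
theorem omegaUnnormalized_apply (x : Fin V → Fin 2) :
    omegaUnnormalized m x =
      ((∑ t : Fin F → ZMod 2, if x = boundaryBits m t then (1 : ℝ) else 0 : ℝ) : ℂ) := by
  rw [omegaUnnormalized_eq, prodOnePlusX_apply]
  push_cast
  symm
  refine Fintype.sum_bijective (fun (t : Fin F → ZMod 2) f => toBit (t f))
    toBit_bijective.comp_left _ _ fun t => ?_
  rw [← boundaryBits_eq_sum]
  have e : x + boundaryBits m t = 0 ↔ x = boundaryBits m t := by
    constructor
    · intro h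
      have h' := congrArg (· + boundaryBits m t) h
      simp only [zero_add, add_assoc, bits_add_self, add_zero] at h'
      exact h'
    · rintro h
      rw [h, bits_add_self]
  simp only [ketZero, e]
  split_ifs <;> simp

/-- For fixed `t` the translation by `t` permutes the summation range. -/
theorem sum_sum_add {M : Type*} [AddCommMonoid M] (g : (Fin F → ZMod 2) → M) :
    ∑ t, ∑ u, g (t + u) = (2 ^ F) • ∑ t, g t := by
  have : ∀ t, ∑ u, g (t + u) = ∑ u, g u := fun t => Equiv.sum_comp (Equiv.addLeft t) g
  simp [this]

/-- Passes from sums over bit strings, weighted by the amplitudes, to sums over sets of faces. -/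
theorem sum_mul_sum_ite (g : (Fin V → Fin 2) → (Fin V → Fin 2) → ℝ) :
    ∑ x, ∑ y, (∑ t : Fin F → ZMod 2, if x = boundaryBits m t then (1 : ℝ) else 0) *
        (∑ t : Fin F → ZMod 2, if y = boundaryBits m t then (1 : ℝ) else 0) * g x y =
      ∑ t : Fin F → ZMod 2, ∑ u : Fin F → ZMod 2, g (boundaryBits m t) (boundaryBits m u) := by
  have h1 : ∀ g' : (Fin V → Fin 2) → ℝ,
      ∑ x, (∑ t : Fin F → ZMod 2, if x = boundaryBits m t then (1 : ℝ) else 0) * g' x =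
        ∑ t : Fin F → ZMod 2, g' (boundaryBits m t) := by
    intro g'
    simp only [Finset.sum_mul]
    rw [Finset.sum_comm]
    refine Finset.sum_congr rfl fun t _ => ?_
    simp
  have h2 : ∀ x y, (∑ t : Fin F → ZMod 2, if x = boundaryBits m t then (1 : ℝ) else 0) *
        (∑ t : Fin F → ZMod 2, if y = boundaryBits m t then (1 : ℝ) else 0) * g x y =
      (∑ t : Fin F → ZMod 2, if x = boundaryBits m t then (1 : ℝ) else 0) *
        ((∑ t : Fin F → ZMod 2, if y = boundaryBits m t then (1 : ℝ) else 0) * g x y) :=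
    fun _ _ => mul_assoc _ _ _
  simp only [h2, ← Finset.mul_sum, h1]

/-- This counts pairs of sets of faces with equal boundary, that is, pairs whose sum is one of the
four elements of the kernel. -/
theorem normSq_omegaUnnormalized : normSq (omegaUnnormalized m) = 4 * 2 ^ F := by
  have h1 : normSq (omegaUnnormalized m) =
      ∑ x, ∑ y, (∑ t : Fin F → ZMod 2, if x = boundaryBits m t then (1 : ℝ) else 0) *
        (∑ t : Fin F → ZMod 2, if y = boundaryBits m t then (1 : ℝ) else 0) *
          if x = y then 1 else 0 := by
    refine Finset.sum_congr rfl fun x _ => ?_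
    rw [omegaUnnormalized_apply, Complex.norm_real, Real.norm_eq_abs, sq_abs]
    simp [pow_two]
  have h2 : ∀ t u : Fin F → ZMod 2,
      (if boundaryBits m t = boundaryBits m u then (1 : ℝ) else 0) =
        (fun w => if ∀ v, m.boundary w v = 0 then (1 : ℝ) else 0) (t + u) := by
    intro t u
    have : boundaryBits m t = boundaryBits m u ↔ ∀ v, m.boundary (t + u) v = 0 := by
      rw [funext_iff]
      refine forall_congr' fun v => ?_
      rw [m.boundary_add, boundaryBits, boundaryBits, toBit_bijective.1.eq_iff]
      have : ∀ a b : ZMod 2, a = b ↔ a + b = 0 := by decide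
      exact this _ _
    simp only [this]
  rw [h1, sum_mul_sum_ite]
  simp_rw [h2]
  rw [sum_sum_add fun w => if ∀ v, m.boundary w v = 0 then (1 : ℝ) else 0, Finset.sum_boole, m.card_boundary_eq_zero]
  simp [mul_comm]

/-! ## The partition function as an expectation value -/

/-- The nontrivial character of `ZMod 2`. -/
def bitSign (a : ZMod 2) : ℝ := if a = 0 then 1 else -1

theorem bitSign_add (a b : ZMod 2) : bitSign (a + b) = bitSign a * bitSign b := by
  have h2 : ∀ c : ZMod 2, c = 0 ∨ c = 1 := by decide
  have h3 : (1 : ZMod 2) + 1 = 0 := by decide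
  rcases h2 a with rfl | rfl <;> rcases h2 b with rfl | rfl <;> simp [bitSign, h3]

theorem bitSign_sum {ι : Type*} (s : Finset ι) (g : ι → ZMod 2) :
    bitSign (∑ i ∈ s, g i) = ∏ i ∈ s, bitSign (g i) := by
  induction s using Finset.induction_on with
  | empty => simp [bitSign]
  | insert i s hi ih => rw [Finset.sum_insert hi, Finset.prod_insert hi, bitSign_add, ih]

def bitEquivUnits : ZMod 2 ≃ ℤˣ where
  toFun a := if a = 0 then 1 else -1
  invFun u := if u = 1 then 0 else 1
  left_inv := by
    have h2 : ∀ c : ZMod 2, c = 0 ∨ c = 1 := by decide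
    intro a
    rcases h2 a with rfl | rfl <;> simp
  right_inv u := by
    rcases Int.units_eq_one_or u with rfl | rfl <;> simp

theorem bitEquivUnits_coe (a : ZMod 2) : (((bitEquivUnits a : ℤˣ) : ℤ) : ℝ) = bitSign a := by
  simp only [bitEquivUnits, bitSign, Equiv.coe_fn_mk]
  split_ifs <;> simp

/-- With spins written as signs of bits, the three-body product at a vertex is the sign of the
boundary there. -/
theorem partitionFunction_eq (β : ℝ) (J : Fin V → ℝ) :
    partitionFunction m β J = ∑ t : Fin F → ZMod 2,
      ∏ a, Real.exp (β * J a * bitSign (m.boundary t a)) := by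
  rw [partitionFunction, ← (Equiv.piCongrRight fun _ : Fin F => bitEquivUnits).sum_comp]
  refine Finset.sum_congr rfl fun t _ => ?_
  rw [← Real.exp_sum, energy]
  congr 1
  rw [neg_mul_neg, Finset.mul_sum]
  refine Finset.sum_congr rfl fun a _ => ?_
  rw [m.filter_inc, Finset.prod_map, Colex.boundary, bitSign_sum, mul_assoc]
  simp [bitEquivUnits_coe]

/-- The normalization of the observable `A_a`. -/
def obsNorm (β J : ℝ) : ℝ := Real.sqrt (Real.exp (2 * β * J) + Real.exp (-2 * β * J))

theorem obsNorm_pos (β J : ℝ) : 0 < obsNorm β J := Real.sqrt_pos.2 (by positivity)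

/-- Splits the entries into a sign that is bilinear in the two bits and a Boltzmann weight that
depends only on their sum. -/
theorem obsA_apply (β J : ℝ) (a b : ZMod 2) :
    obsA β J (toBit a) (toBit b) = bitSign (a * b) * ((obsNorm β J)⁻¹ * Real.exp (β * J * bitSign (a + b))) := by
  have h2 : ∀ c : ZMod 2, c = 0 ∨ c = 1 := by decide
  have h3 : (1 : ZMod 2) + 1 = 0 := by decide
  have h00 : obsA β J (0 : Fin 2) (0 : Fin 2) = (obsNorm β J)⁻¹ * Real.exp (β * J) := by
    simp [obsA, obsNorm]
  have h01 : obsA β J (0 : Fin 2) (1 : Fin 2) = (obsNorm β J)⁻¹ * Real.exp (-β * J) := by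
    simp [obsA, obsNorm]
  have h10 : obsA β J (1 : Fin 2) (0 : Fin 2) = (obsNorm β J)⁻¹ * Real.exp (-β * J) := by
    simp [obsA, obsNorm]
  have h11 : obsA β J (1 : Fin 2) (1 : Fin 2) = -((obsNorm β J)⁻¹ * Real.exp (β * J)) := by
    simp [obsA, obsNorm]
  rcases h2 a with rfl | rfl <;> rcases h2 b with rfl | rfl
  · exact h00.trans (by simp [bitSign])
  · exact h01.trans (by simp [bitSign])
  · exact h10.trans (by simp [bitSign])
  · exact h11.trans (by simp [bitSign, h3])

/-- The expectation value of the product of the observables, up to normalization. -/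
theorem sum_sum_prod_obsA (β : ℝ) (J : Fin V → ℝ) :
    ∑ t : Fin F → ZMod 2, ∑ u : Fin F → ZMod 2,
        ∏ a, obsA β (J a) (boundaryBits m t a) (boundaryBits m u a) =
      2 ^ F * ((∏ a, obsNorm β (J a))⁻¹ * partitionFunction m β J) := by
  have h : ∀ t u : Fin F → ZMod 2, ∏ a, obsA β (J a) (boundaryBits m t a) (boundaryBits m u a) =
      (fun w => (∏ a, obsNorm β (J a))⁻¹ *
        ∏ a, Real.exp (β * J a * bitSign (m.boundary w a))) (t + u) := by
    intro t u
    simp only [boundaryBits, obsA_apply]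
    -- Self-orthogonality makes the total sign 1; only a function of `t + u` is left.
    rw [Finset.prod_mul_distrib, ← bitSign_sum, m.sum_boundary_mul_boundary,
      Finset.prod_mul_distrib, Finset.prod_inv_distrib]
    simp [bitSign, m.boundary_add]
  simp_rw [h]
  rw [sum_sum_add fun w => (∏ a, obsNorm β (J a))⁻¹ *
    ∏ a, Real.exp (β * J a * bitSign (m.boundary w a)), ← Finset.mul_sum, ← partitionFunction_eq]
  simp

end

/-- Measuring a product of diagonalized observables. -/
theorem sum_parity_mul_sq {n : ℕ} (O : Fin n → Matrix (Fin 2) (Fin 2) ℝ)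
    (w : (Fin n → Fin 2) → ℝ) :
    ∑ x, parity x * (∑ y, (∏ a, O a (x a) (y a)) * w y) ^ 2 =
      ∑ y, ∑ z, w y * w z * ∏ a, ((O a).transpose * pauliZ * O a) (y a) (z a) := by
  have hA : ∀ a (i j : Fin 2), ((O a).transpose * pauliZ * O a) i j =
      ∑ b : Fin 2, (-1 : ℝ) ^ (b : ℕ) * (O a b i * O a b j) := by
    intro a i j
    simp [Matrix.mul_apply, Fin.sum_univ_two, pauliZ]
  simp only [hA, Finset.prod_univ_sum, Fintype.piFinset_univ, Finset.mul_sum]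
  have hx : ∀ x, parity x * (∑ y, (∏ a, O a (x a) (y a)) * w y) ^ 2 =
      ∑ y, ∑ z, w y * w z * ∏ a, ((-1 : ℝ) ^ (x a : ℕ) * (O a (x a) (y a) * O a (x a) (z a))) := by
    intro x
    rw [pow_two, Finset.sum_mul_sum, Finset.mul_sum]
    refine Finset.sum_congr rfl fun y _ => ?_
    rw [Finset.mul_sum]
    refine Finset.sum_congr rfl fun z _ => ?_
    rw [Finset.prod_mul_distrib, Finset.prod_mul_distrib, parity]
    ring
  simp only [hx]
  rw [Finset.sum_comm]
  refine Finset.sum_congr rfl fun y _ => ?_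
  rw [Finset.sum_comm]

/-- The factor 4 is √16, from 2^(F+2) = 16 · 2^(F-2). It cancels the order of the kernel of the
boundary map, which enters through the norm of the state. -/
theorem errorScale_eq {V : ℕ} (F : ℕ) (β : ℝ) (J : Fin V → ℝ) :
    errorScale F β J = 4 * ∏ a, obsNorm β (J a) := by
  have h1 : (2 : ℝ) ^ (F + 2) = 16 * (2 : ℝ) ^ ((F : ℤ) - 2) := by
    rw [zpow_sub₀ (by norm_num), zpow_natCast, pow_add]
    norm_num
    ring
  have h2 : (0 : ℝ) < Real.sqrt ((2 : ℝ) ^ ((F : ℤ) - 2)) := Real.sqrt_pos.2 (by positivity)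
  have h4 : Real.sqrt 16 = 4 := by
    rw [show (16 : ℝ) = 4 ^ 2 by norm_num, Real.sqrt_sq (by norm_num)]
  rw [errorScale, gammaFactor, h1, Real.sqrt_mul (by norm_num), h4]
  unfold obsNorm
  field_simp

theorem errorScale_pos {V : ℕ} (F : ℕ) (β : ℝ) (J : Fin V → ℝ) : 0 < errorScale F β J := by
  rw [errorScale_eq]
  have : 0 < ∏ a, obsNorm β (J a) := Finset.prod_pos fun a _ => obsNorm_pos _ _
  positivity

/-! ## The diagonalization of the observables -/

/-- Cosine of half the angle of the reflection `A_a`. -/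
def obsCos (β J : ℝ) : ℝ := Real.sqrt ((1 + Real.exp (β * J) / obsNorm β J) / 2)

/-- Sine of half the angle of the reflection `A_a`. -/
def obsSin (β J : ℝ) : ℝ := Real.sqrt ((1 - Real.exp (β * J) / obsNorm β J) / 2)

theorem obsNorm_sq (β J : ℝ) :
    obsNorm β J ^ 2 = Real.exp (β * J) ^ 2 + Real.exp (-β * J) ^ 2 := by
  rw [obsNorm, Real.sq_sqrt (by positivity), ← Real.exp_nat_mul, ← Real.exp_nat_mul]
  congr 2 <;> push_cast <;> ring

theorem exp_div_obsNorm_le_one (β J : ℝ) : Real.exp (β * J) / obsNorm β J ≤ 1 := by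
  rw [div_le_one (obsNorm_pos β J)]
  have := obsNorm_sq β J
  nlinarith [obsNorm_pos β J, Real.exp_pos (β * J), sq_nonneg (Real.exp (-β * J))]

theorem obsCos_sq (β J : ℝ) : obsCos β J ^ 2 = (1 + Real.exp (β * J) / obsNorm β J) / 2 :=
  Real.sq_sqrt (by have := obsNorm_pos β J; positivity)

theorem obsSin_sq (β J : ℝ) : obsSin β J ^ 2 = (1 - Real.exp (β * J) / obsNorm β J) / 2 :=
  Real.sq_sqrt (by linarith [exp_div_obsNorm_le_one β J])

/-- The double-angle formula; both sides are nonnegative, so it suffices to compare squares. -/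
theorem two_mul_obsCos_mul_obsSin (β J : ℝ) :
    2 * (obsCos β J * obsSin β J) = Real.exp (-β * J) / obsNorm β J := by
  have h0 := obsNorm_pos β J
  have h1 : 0 ≤ obsCos β J := Real.sqrt_nonneg _
  have h2 : 0 ≤ obsSin β J := Real.sqrt_nonneg _
  refine (sq_eq_sq₀ (by positivity) (by positivity)).1 ?_
  rw [mul_pow, mul_pow, obsCos_sq, obsSin_sq, div_pow]
  have := obsNorm_sq β J
  generalize Real.exp (-β * J) = e at *
  field_simp
  linear_combination this

/-- The orthogonal matrix that diagonalizes `A_a`. -/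
def obsRotation (β J : ℝ) : Matrix.orthogonalGroup (Fin 2) ℝ :=
  ⟨!![obsCos β J, obsSin β J; obsSin β J, -obsCos β J], by
    have h : obsCos β J ^ 2 + obsSin β J ^ 2 = 1 := by rw [obsCos_sq, obsSin_sq]; ring
    rw [Matrix.mem_orthogonalGroup_iff]
    ext i j
    fin_cases i <;> fin_cases j <;>
      simp [Matrix.mul_apply, Fin.sum_univ_two, ← pow_two, h, add_comm (obsSin β J ^ 2)] <;> ring⟩

theorem obsA_eq (β J : ℝ) : obsA β J =
    (obsRotation β J : Matrix (Fin 2) (Fin 2) ℝ).transpose * pauliZ *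
      (obsRotation β J : Matrix (Fin 2) (Fin 2) ℝ) := by
  have h1 := obsCos_sq β J
  have h2 := obsSin_sq β J
  have h3 := two_mul_obsCos_mul_obsSin β J
  have h4 : ∀ x, 1 / Real.sqrt (Real.exp (2 * β * J) + Real.exp (-2 * β * J)) * x =
      x / obsNorm β J := fun x => by rw [obsNorm]; ring
  ext i j
  rw [obsA, Matrix.smul_apply, smul_eq_mul, h4]
  fin_cases i <;> fin_cases j <;>
    simp [Matrix.mul_apply, Fin.sum_univ_two, obsRotation, pauliZ] <;>
    simp only [neg_mul] at h3
  · linear_combination h2 - h1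
  · linear_combination -h3
  · linear_combination -h3
  · rw [neg_div]
    linear_combination h1 - h2

/-- The state before the measurements. -/
def measuredState {V F : ℕ} (m : Colex V F) (β : ℝ) (J : Fin V → ℝ) : QState V :=
  runCircuit (List.ofFn fun a => Gate.single a (realGate (obsRotation β (J a)))) (omega m)

theorem normSq_measuredState {V F : ℕ} (m : Colex V F) (β : ℝ) (J : Fin V → ℝ) :
    normSq (measuredState m β J) = 1 := by
  rw [measuredState, normSq_runCircuit, normSq_omega]

/-- The partition function is a multiple of the expected parity. -/
theorem errorScale_mul_sum_parity {V F : ℕ} (m : Colex V F) (β : ℝ) (J : Fin V → ℝ) :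
    errorScale F β J * ∑ x, parity x * ‖measuredState m β J x‖ ^ 2 = partitionFunction m β J := by
  obtain ⟨c, hc, h1, -⟩ := exists_runCircuit_omegaCircuit m
  have h2 := omega_eq_smul m hc h1
  -- The amplitudes of the code state and the rotation matrices are real, so squared moduli become
  -- ordinary squares.
  let w : (Fin V → Fin 2) → ℝ := fun y =>
    c * ∑ t : Fin F → ZMod 2, if y = boundaryBits m t then (1 : ℝ) else 0
  have hw : ∀ y, omega m y = (w y : ℂ) := by
    intro y
    rw [h2, Pi.smul_apply, omegaUnnormalized_apply]
    simp [w]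
  have hφ : ∀ x, ‖measuredState m β J x‖ ^ 2 =
      (∑ y, (∏ a, (obsRotation β (J a) : Matrix (Fin 2) (Fin 2) ℝ) (x a) (y a)) * w y) ^ 2 := by
    intro x
    rw [measuredState, runCircuit_singles]
    have : (tensorOp fun a => (realGate (obsRotation β (J a)) : Matrix (Fin 2) (Fin 2) ℂ)).mulVec
        (omega m) x = ((∑ y,
          (∏ a, (obsRotation β (J a) : Matrix (Fin 2) (Fin 2) ℝ) (x a) (y a)) * w y : ℝ) : ℂ) := by
      simp only [Matrix.mulVec, dotProduct, tensorOp, Matrix.of_apply, hw, realGate,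
        Matrix.map_apply]
      push_cast
      rfl
    rw [this, Complex.norm_real, Real.norm_eq_abs, sq_abs]
  simp only [hφ]
  rw [sum_parity_mul_sq fun a => (obsRotation β (J a) : Matrix (Fin 2) (Fin 2) ℝ)]
  simp only [← obsA_eq]
  have h3 : ∀ y z, w y * w z * ∏ a, obsA β (J a) (y a) (z a) = c ^ 2 *
      ((∑ t : Fin F → ZMod 2, if y = boundaryBits m t then (1 : ℝ) else 0) *
        (∑ t : Fin F → ZMod 2, if z = boundaryBits m t then (1 : ℝ) else 0) *
          ∏ a, obsA β (J a) (y a) (z a)) := by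
    intro y z
    simp only [w]
    ring
  simp only [h3, ← Finset.mul_sum]
  rw [sum_mul_sum_ite m fun y z => ∏ a, obsA β (J a) (y a) (z a), sum_sum_prod_obsA,
    errorScale_eq]
  rw [normSq_omegaUnnormalized] at h1
  have hpos : 0 < ∏ a, obsNorm β (J a) := Finset.prod_pos fun a _ => obsNorm_pos _ _
  field_simp
  linear_combination partitionFunction m β J * h1

end ColorCode

end

noncomputable section

namespace ColorCode

/-! ## Independent samples and Hoeffding's inequality -/

/-- The distribution of `K` independent samples. -/
def iid {B : Type} (q : PMF B) : (K : ℕ) → PMF (Fin K → B)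
  | 0 => PMF.pure Fin.elim0
  | K + 1 => q.bind fun x => (iid q K).map (Fin.cons (α := fun _ => B) x)

theorem iid_apply {B : Type} [Fintype B] (q : PMF B) (K : ℕ) (x : Fin K → B) :
    iid q K x = ∏ k, q (x k) := by
  induction K with
  | zero =>
    rw [iid, PMF.pure_apply, if_pos (Subsingleton.elim _ _)]
    simp
  | succ K ih =>
    have h : ∀ a, q a * (iid q K).map (Fin.cons (α := fun _ => B) a) x =
        if a = x 0 then q a * iid q K (Fin.tail x) else 0 := by
      intro a
      rw [PMF.map_apply, tsum_fintype]
      split_ifs with ha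
      · congr 1
        rw [Finset.sum_eq_single (Fin.tail x)]
        · rw [if_pos]
          rw [ha, Fin.cons_self_tail]
        · intro b _ hb
          rw [if_neg]
          rintro rfl
          exact hb (Fin.tail_cons (α := fun _ => B) a b).symm
        · simp
      · rw [Finset.sum_eq_zero, mul_zero]
        intro b _
        rw [if_neg]
        rintro rfl
        exact ha (Fin.cons_zero (α := fun _ => B) a b).symm
    rw [iid, PMF.bind_apply, tsum_fintype]
    simp only [h, Finset.sum_ite_eq', Finset.mem_univ, if_true]
    rw [ih, Fin.prod_univ_succ]
    rfl

/-- Hoeffding's lemma for variables with values in `[-1, 1]`. -/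
theorem sum_mul_exp_le {B : Type} [Fintype B] (q : PMF B) (y : B → ℝ)
    (hy : ∀ b, y b ∈ Set.Icc (-1 : ℝ) 1) (l : ℝ) :
    ∑ b, (q b).toReal * Real.exp (l * (y b - ∑ b', (q b').toReal * y b')) ≤
      Real.exp (l ^ 2 / 2) := by
  let _ : MeasurableSpace B := ⊤
  -- The interval has length 2, so the variance proxy (2 / 2)² is 1.
  have h := ProbabilityTheory.hasSubgaussianMGF_of_mem_Icc (X := y) (μ := q.toMeasure)
    (a := -1) (b := 1) (measurable_from_top.aemeasurable) (Filter.Eventually.of_forall hy)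
  have h2 := h.mgf_le l
  rw [ProbabilityTheory.mgf, PMF.integral_eq_sum, PMF.integral_eq_sum] at h2
  simp only [smul_eq_mul] at h2
  refine h2.trans (le_of_eq ?_)
  congr 1
  have : ‖(1 : ℝ) - -1‖ = 2 := by norm_num
  norm_num [this]

/-- The upper tail in Hoeffding's inequality. -/
theorem sum_tail_le {B : Type} [Fintype B] (q : PMF B) (y : B → ℝ)
    (hy : ∀ b, y b ∈ Set.Icc (-1 : ℝ) 1) (K : ℕ) {ε : ℝ} (hε : 0 ≤ ε) :
    ∑ x ∈ Finset.univ.filter (fun x : Fin K → B =>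
        K * ε ≤ ∑ k, (y (x k) - ∑ b', (q b').toReal * y b')), ∏ k, (q (x k)).toReal ≤
      Real.exp (-K * ε ^ 2 / 2) := by
  set e := ∑ b', (q b').toReal * y b' with he
  -- Chernoff's method with parameter `ε`, which minimizes the exponent -Klε + Kl²/2 over l.
  calc _ ≤ ∑ x ∈ Finset.univ.filter (fun x : Fin K → B => K * ε ≤ ∑ k, (y (x k) - e)),
        (∏ k, (q (x k)).toReal) * Real.exp (ε * (∑ k, (y (x k) - e) - K * ε)) := by
        refine Finset.sum_le_sum fun x hx => ?_
        rw [Finset.mem_filter] at hx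
        refine le_mul_of_one_le_right (Finset.prod_nonneg fun _ _ => ENNReal.toReal_nonneg) ?_
        exact Real.one_le_exp (mul_nonneg hε (by linarith [hx.2]))
    _ ≤ ∑ x : Fin K → B, (∏ k, (q (x k)).toReal) *
        Real.exp (ε * (∑ k, (y (x k) - e) - K * ε)) := by
        refine Finset.sum_le_sum_of_subset_of_nonneg (Finset.filter_subset _ _) fun x _ _ => ?_
        exact mul_nonneg (Finset.prod_nonneg fun _ _ => ENNReal.toReal_nonneg) (Real.exp_nonneg _)
    _ = Real.exp (-K * ε ^ 2) * ∏ _k : Fin K, ∑ b, (q b).toReal * Real.exp (ε * (y b - e)) := by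
        rw [Finset.prod_univ_sum, Fintype.piFinset_univ, Finset.mul_sum]
        refine Finset.sum_congr rfl fun x _ => ?_
        rw [Finset.prod_mul_distrib, ← Real.exp_sum, ← Finset.mul_sum,
          show ε * (∑ k, (y (x k) - e) - K * ε) = -K * ε ^ 2 + ε * ∑ k, (y (x k) - e) by ring,
          Real.exp_add]
        ring
    _ ≤ Real.exp (-K * ε ^ 2) * ∏ _k : Fin K, Real.exp (ε ^ 2 / 2) := by
        gcongr
        exact sum_mul_exp_le q y hy ε
    _ = Real.exp (-K * ε ^ 2 / 2) := by
        rw [← Real.exp_sum, ← Real.exp_add]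
        congr 1
        simp
        ring

/-- Hoeffding's inequality for the mean of independent samples. -/
theorem iid_mean_close {B : Type} [Fintype B] (q : PMF B) (y : B → ℝ)
    (hy : ∀ b, y b ∈ Set.Icc (-1 : ℝ) 1) {K : ℕ} (hK : 0 < K) {ε p : ℝ} (hε : 0 ≤ ε)
    (hp : 2 * Real.exp (-K * ε ^ 2 / 2) ≤ 1 - p) :
    ENNReal.ofReal p ≤ (iid q K).toOuterMeasure
      {x | |(∑ k, y (x k)) / K - ∑ b, (q b).toReal * y b| ≤ ε} := by
  set e := ∑ b', (q b').toReal * y b' with he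
  have hK' : (0 : ℝ) < K := by exact_mod_cast hK
  set w : (Fin K → B) → ℝ := fun x => ∏ k, (q (x k)).toReal with hw
  have hw0 : ∀ x, 0 ≤ w x := fun x => Finset.prod_nonneg fun _ _ => ENNReal.toReal_nonneg
  have hiid : ∀ x, iid q K x = ENNReal.ofReal (w x) := by
    intro x
    rw [iid_apply, hw, ENNReal.ofReal_prod_of_nonneg fun _ _ => ENNReal.toReal_nonneg]
    exact Finset.prod_congr rfl fun k _ => (ENNReal.ofReal_toReal (q.apply_ne_top _)).symm
  have htot : ∑ x, w x = 1 := by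
    have := (iid q K).tsum_coe
    rw [tsum_fintype] at this
    simp only [hiid] at this
    rw [← ENNReal.ofReal_sum_of_nonneg fun x _ => hw0 x] at this
    simpa using this
  have h1 := sum_tail_le q y hy K hε
  have h2 := sum_tail_le q (fun b => -y b)
    (fun b => ⟨by linarith [(hy b).2], by linarith [(hy b).1]⟩) K hε
  rw [← he] at h1
  have hneg : ∑ b', (q b').toReal * -y b' = -e := by simp [he]
  rw [hneg] at h2
  have hsum : ∀ x : Fin K → B, ∑ k, (y (x k) - e) = (∑ k, y (x k)) - K * e := by
    intro x
    simp [Finset.sum_sub_distrib]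
  have hsum' : ∀ x : Fin K → B, ∑ k, (-y (x k) - -e) = K * e - ∑ k, y (x k) := by
    intro x
    simp [Finset.sum_add_distrib]
    ring
  simp only [hsum] at h1
  simp only [hsum'] at h2
  rw [PMF.toOuterMeasure_apply_fintype]
  have hind : ∀ x, Set.indicator {x : Fin K → B | |(∑ k, y (x k)) / K - e| ≤ ε} (iid q K) x =
      ENNReal.ofReal (if |(∑ k, y (x k)) / K - e| ≤ ε then w x else 0) := by
    intro x
    simp only [Set.indicator, Set.mem_ofPred_eq]
    split_ifs
    · exact hiid x
    · simp
  simp only [hind]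
  rw [← ENNReal.ofReal_sum_of_nonneg fun x _ => by split_ifs; exacts [hw0 x, le_rfl]]
  refine ENNReal.ofReal_le_ofReal ?_
  rw [Finset.sum_filter] at h1 h2
  -- Union bound: a sample with a large deviation lies in the upper tail of `y` or of `-y`.
  have hcover : ∀ x : Fin K → B, w x ≤ (if |(∑ k, y (x k)) / K - e| ≤ ε then w x else 0) +
      ((if K * ε ≤ (∑ k, y (x k)) - K * e then w x else 0) +
        (if K * ε ≤ K * e - ∑ k, y (x k) then w x else 0)) := by
    intro x
    have hx := hw0 x
    by_cases ha : |(∑ k, y (x k)) / K - e| ≤ ε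
    · rw [if_pos ha]
      have : 0 ≤ (if K * ε ≤ (∑ k, y (x k)) - K * e then w x else 0) := by split_ifs <;> simp [hx]
      have : 0 ≤ (if K * ε ≤ K * e - ∑ k, y (x k) then w x else 0) := by split_ifs <;> simp [hx]
      linarith
    · rw [if_neg ha]
      have hform : (∑ k, y (x k)) - K * e = K * ((∑ k, y (x k)) / K - e) := by
        field_simp
      rcases lt_abs.1 (not_le.1 ha) with hb | hb
      · rw [if_pos (c := K * ε ≤ (∑ k, y (x k)) - K * e)]
        · split_ifs <;> linarith
        · rw [hform]
          exact mul_le_mul_of_nonneg_left hb.le hK'.le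
      · rw [if_pos (c := K * ε ≤ K * e - ∑ k, y (x k))]
        · split_ifs <;> linarith
        · rw [← neg_sub, hform, ← mul_neg]
          exact mul_le_mul_of_nonneg_left hb.le hK'.le
  have := Finset.sum_le_sum fun x (_ : x ∈ Finset.univ) => hcover x
  rw [htot, Finset.sum_add_distrib, Finset.sum_add_distrib] at this
  linarith

end ColorCode

end

noncomputable section

namespace ColorCode

/-! ## The program -/

section Programs

open IExp in
/-- Sets index register `5` to the pivot of the column in index register `2`. -/
def pivotCmd : Cmd :=
  .seq (.setIdx 5 (reg 0))
    (forLoop 4 0 (.ite (.rlt (.const 0) (.read 0 (reg 4) (reg 2))) (.setIdx 5 (reg 4)) .skip))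

/-- The real expression `(a - b * c) ^ 2`; on bits it is `a + b * c` modulo two. -/
def addMulModTwo (a b c : RExp) : RExp :=
  .mul (.sub a (.mul b c)) (.sub a (.mul b c))

open IExp in
/-- Adds the column in index register `2` to the column in index register `3` if the latter does
not vanish in the pivot row. -/
def addColumnCmd : Cmd :=
  .seq (.write 7 (const 0) (const 0) (.read 0 (reg 5) (reg 3)))
    (forLoop 4 0 (.write 0 (reg 4) (reg 3) (addMulModTwo (.read 0 (reg 4) (reg 3))
      (.read 7 (const 0) (const 0)) (.read 0 (reg 4) (reg 2)))))

open IExp in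
/-- Gaussian elimination of the matrix in array `0`. -/
def elimCmd : Cmd :=
  .seq (.setIdx 2 (reg 1)) (.while (.ilt (const 0) (reg 2))
    (.seq (.setIdx 2 (pred (reg 2))) (.seq pivotCmd (forLoop 3 2 addColumnCmd))))

def hadamardExp (i j : Fin 2) : RExp :=
  .mul (.const (if i = 1 ∧ j = 1 then -1 else 1)) (.div (.const 1) (.sqrt (.const 2)))

open IExp in
/-- Prepares the code state from the eliminated matrix in array `0`. -/
def prepareCmd : Cmd :=
  forLoop 2 1 (.seq pivotCmd (.seq (.gate (reg 5) hadamardExp fun _ _ => .const 0)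
    (forLoop 4 0 (.ite (.rlt (.const 0) (.read 0 (reg 4) (reg 2))) (.cnot (reg 5) (reg 4)) .skip))))

/-- The expression `β * J a`, with `a` in index register `4`. -/
def couplingExp : RExp := .mul (.read 1 (.const 0) (.const 0)) (.read 2 (.reg 4) (.const 0))

def obsNormExp : RExp :=
  .sqrt (.add (.exp (.mul (.const 2) couplingExp)) (.exp (.mul (.const (-2)) couplingExp)))

def obsCosExp : RExp :=
  .sqrt (.div (.add (.const 1) (.div (.exp couplingExp) obsNormExp)) (.const 2))

def obsSinExp : RExp :=
  .sqrt (.div (.sub (.const 1) (.div (.exp couplingExp) obsNormExp)) (.const 2))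

def rotationExp (i j : Fin 2) : RExp :=
  if i = 0 then (if j = 0 then obsCosExp else obsSinExp)
  else (if j = 0 then obsSinExp else .sub (.const 0) obsCosExp)

def resetCmd : Cmd := forLoop 4 0 (.reset (.reg 4))

def rotateCmd : Cmd := forLoop 4 0 (.gate (.reg 4) rotationExp fun _ _ => .const 0)

open IExp in
/-- Measures all qubits and multiplies entry `(0, 0)` of array `6` by the parity. -/
def measureCmd : Cmd :=
  forLoop 4 0 (.seq (.measure (reg 4) 7 (const 0) (const 0))
    (.write 6 (const 0) (const 0) (.mul (.read 6 (const 0) (const 0))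
      (.sub (.const 1) (.mul (.const 2) (.read 7 (const 0) (const 0)))))))

open IExp in
/-- One round of the protocol: adds the parity to entry `(0, 0)` of array `4` and increases the
counter in entry `(0, 0)` of array `5`. -/
def roundCmd : Cmd :=
  .seq resetCmd (.seq prepareCmd (.seq rotateCmd (.seq (.write 6 (const 0) (const 0) (.const 1))
    (.seq measureCmd (.seq (.write 4 (const 0) (const 0)
        (.add (.read 4 (const 0) (const 0)) (.read 6 (const 0) (const 0))))
      (.write 5 (const 0) (const 0) (.add (.read 5 (const 0) (const 0)) (.const 1))))))))

open IExp in
/-- More rounds are needed: `1 - p < 2 * exp (-k * ε ^ 2 / 2)`. -/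
def moreRounds : BExp :=
  .rlt (.sub (.const 1) (.read 3 (const 0) (const 1)))
    (.mul (.const 2) (.exp (.div (.mul (.sub (.const 0) (.read 5 (const 0) (const 0)))
      (.mul (.read 3 (const 0) (const 0)) (.read 3 (const 0) (const 0)))) (.const 2))))

open IExp in
/-- Rescales the average. -/
def rescaleCmd : Cmd :=
  .seq (.write 4 (const 0) (const 0) (.mul (.const 4)
      (.div (.read 4 (const 0) (const 0)) (.read 5 (const 0) (const 0)))))
    (forLoop 4 0 (.write 4 (const 0) (const 0) (.mul (.read 4 (const 0) (const 0)) obsNormExp)))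

/-- The program that estimates the partition function. -/
def estimateCmd : Cmd :=
  .seq elimCmd (.seq (.while moreRounds roundCmd) rescaleCmd)

end Programs

/-! ## Verification of the classical part -/

/-- The input data apart from the incidence matrix. -/
structure Params (V : ℕ) where
  F : ℕ
  β : ℝ
  J : Fin V → ℝ
  ε : ℝ
  p : ℝ

/-- The relevant contents of a store: the input, the matrix `M`, the number `k` of rounds, the sum
`r` of the parities, the parity `w` of the current round, the quantum state, and the history. -/
structure Holds {V : ℕ} (c : Params V) (M : ℕ → ℕ → Fin 2) (k r w : ℝ) (ψ : QState V)
    (h : List (QEvent V)) (s : Store V) : Prop where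
  idx0 : s.idx 0 = V
  idx1 : s.idx 1 = c.F
  mem0 : ∀ i j, s.mem 0 i j = ((M i j : ℕ) : ℝ)
  mem1 : s.mem 1 0 0 = c.β
  mem2 : ∀ a : Fin V, s.mem 2 a 0 = c.J a
  mem3 : s.mem 3 0 0 = c.ε
  mem3' : s.mem 3 0 1 = c.p
  mem4 : s.mem 4 0 0 = r
  mem5 : s.mem 5 0 0 = k
  mem6 : s.mem 6 0 0 = w
  qstate : s.qstate = ψ
  history : s.history = h

variable {V : ℕ} {c : Params V} {M : ℕ → ℕ → Fin 2} {k r w : ℝ} {ψ : QState V}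
  {h : List (QEvent V)} {s : Store V}

theorem Holds.setIdx (H : Holds c M k r w ψ h s) {i : ℕ} (hi : 2 ≤ i) (x : ℕ) :
    Holds c M k r w ψ h (s.setIdx i x) where
  idx0 := by
    have : (0 : ℕ) ≠ i := by omega
    simp [Store.setIdx, Function.update_of_ne this, H.idx0]
  idx1 := by
    have : (1 : ℕ) ≠ i := by omega
    simp [Store.setIdx, Function.update_of_ne this, H.idx1]
  mem0 := H.mem0
  mem1 := H.mem1
  mem2 := H.mem2
  mem3 := H.mem3
  mem3' := H.mem3'
  mem4 := H.mem4
  mem5 := H.mem5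
  mem6 := H.mem6
  qstate := H.qstate
  history := H.history

theorem Holds.setMem_scratch (H : Holds c M k r w ψ h s) (i j : ℕ) (y : ℝ) :
    Holds c M k r w ψ h (s.setMem 7 i j y) := by
  constructor <;> simp [Store.setMem, H.idx0, H.idx1, H.mem0, H.mem1, H.mem2, H.mem3, H.mem3',
    H.mem4, H.mem5, H.mem6, H.qstate, H.history]

theorem Holds.setMem_sum (H : Holds c M k r w ψ h s) (y : ℝ) :
    Holds c M k y w ψ h (s.setMem 4 0 0 y) := by
  constructor <;> simp [Store.setMem, H.idx0, H.idx1, H.mem0, H.mem1, H.mem2, H.mem3, H.mem3',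
    H.mem5, H.mem6, H.qstate, H.history]

theorem Holds.setMem_count (H : Holds c M k r w ψ h s) (y : ℝ) :
    Holds c M y r w ψ h (s.setMem 5 0 0 y) := by
  constructor <;> simp [Store.setMem, H.idx0, H.idx1, H.mem0, H.mem1, H.mem2, H.mem3, H.mem3',
    H.mem4, H.mem6, H.qstate, H.history]

theorem Holds.setMem_parity (H : Holds c M k r w ψ h s) (y : ℝ) :
    Holds c M k r y ψ h (s.setMem 6 0 0 y) := by
  constructor <;> simp [Store.setMem, H.idx0, H.idx1, H.mem0, H.mem1, H.mem2, H.mem3, H.mem3',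
    H.mem4, H.mem5, H.qstate, H.history]

theorem Holds.setMem_matrix (H : Holds c M k r w ψ h s) (i j : ℕ) (x : Fin 2) :
    Holds c (fun i' j' => if i' = i ∧ j' = j then x else M i' j') k r w ψ h
      (s.setMem 0 i j ((x : ℕ) : ℝ)) := by
  constructor
  case mem0 =>
    intro i' j'
    simp only [Store.setMem, true_and, H.mem0]
    split_ifs <;> rfl
  all_goals simp [Store.setMem, H.idx0, H.idx1, H.mem1, H.mem2, H.mem3, H.mem3',
    H.mem4, H.mem5, H.mem6, H.qstate, H.history]

theorem Holds.setQuantum (H : Holds c M k r w ψ h s) (ψ' : QState V) (h' : List (QEvent V)) :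
    Holds c M k r w ψ' h' { s with qstate := ψ', history := h' } :=
  { H with qstate := rfl, history := rfl }

theorem Holds.applyCircuit {W : List (Gate V)}
    (H : Holds c M k r w (runCircuit W ψ) (h ++ W.map .gate) s) (W' : List (Gate V)) :
    Holds c M k r w (runCircuit (W ++ W') ψ) (h ++ (W ++ W').map .gate) (s.applyCircuit W') := by
  have := H.setQuantum (runCircuit W' s.qstate) (s.history ++ W'.map .gate)
  rw [H.qstate, H.history] at this
  rw [runCircuit_append, List.map_append, ← List.append_assoc]
  simpa only [Store.applyCircuit, H.qstate, H.history] using this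

theorem setIdx_idx_of_ne (s : Store V) {i j : ℕ} (x : ℕ) (hij : i ≠ j) :
    (s.setIdx j x).idx i = s.idx i := by
  simp [Store.setIdx, Function.update_of_ne hij]

theorem setMem_idx (s : Store V) (A i j : ℕ) (y : ℝ) : (s.setMem A i j y).idx = s.idx := rfl

theorem bit_pos_iff (a : Fin 2) : (0 : ℝ) < ((a : ℕ) : ℝ) ↔ a = 1 := by
  have h2 : ∀ c : Fin 2, c = 0 ∨ c = 1 := by decide
  rcases h2 a with rfl | rfl <;> simp

theorem bit_sub_mul_sq (a t b : Fin 2) :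
    (((a : ℕ) : ℝ) - ((t : ℕ) : ℝ) * ((b : ℕ) : ℝ)) * (((a : ℕ) : ℝ) - ((t : ℕ) : ℝ) * ((b : ℕ) : ℝ))
      = (((a + t * b : Fin 2) : ℕ) : ℝ) := by
  have h2 : ∀ c : Fin 2, c = 0 ∨ c = 1 := by decide
  rcases h2 a with rfl | rfl <;> rcases h2 t with rfl | rfl <;> rcases h2 b with rfl | rfl <;>
    simp

theorem det_pivotCmd {f : ℕ} (H : Holds c M k r w ψ h s) (hf : s.idx 2 = f) :
    Det pivotCmd s (5 * V + 5) fun s' =>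
      Holds c M k r w ψ h s' ∧ s'.idx 2 = f ∧ s'.idx 5 = pivot V M f := by
  refine (Det.seq (det_setIdx (Q := fun s' => Holds c M k r w ψ h s' ∧ s'.idx 2 = f ∧
      s'.idx 5 = V) ?_) fun s' hs' => ?_).mono (T := 1 + (V * (2 + 3) + 3) + 1) (by omega)
      fun _ h => h
  · refine ⟨H.setIdx (by omega) _, ?_, ?_⟩
    · rw [setIdx_idx_of_ne _ _ (by omega), hf]
    · rw [Store.setIdx_idx_self, IExp.eval, H.idx0]
  · refine det_forLoop (fun j s' => Holds c M k r w ψ h s' ∧ s'.idx 2 = f ∧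
      s'.idx 5 = pivotUpTo V M f j) ?_ ?_ hs' ?_
    · rintro i s x ⟨h1, h2, h3⟩
      refine ⟨h1.setIdx (by omega) _, ?_, ?_⟩
      · rwa [setIdx_idx_of_ne _ _ (by omega)]
      · rwa [setIdx_idx_of_ne _ _ (by omega)]
    · rintro i s ⟨h1, -⟩
      exact h1.idx0
    · rintro i s hi h4 ⟨h1, h2, h3⟩
      have hb : (BExp.rlt (.const 0) (.read 0 (.reg 4) (.reg 2))).eval s ↔ M i f = 1 := by
        simp only [BExp.eval, RExp.eval, IExp.eval, h4, h2, h1.mem0, Rat.cast_zero, bit_pos_iff]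
      refine det_ite (fun hc => det_setIdx ⟨?_, h1.setIdx (by omega) _, ?_, ?_⟩)
        (fun hc => det_skip ⟨h4, h1, h2, ?_⟩)
      · rwa [setIdx_idx_of_ne _ _ (by omega)]
      · rwa [setIdx_idx_of_ne _ _ (by omega)]
      · rw [Store.setIdx_idx_self, IExp.eval, h4, pivotUpTo, if_pos (hb.1 hc)]
      · rw [pivotUpTo, if_neg (fun e => hc (hb.2 e)), h3]

/-- The matrix in the course of one step of the elimination: the columns before `j`, and column
`j` in the rows before `v`, are done. -/
def partialElim (V : ℕ) (M : ℕ → ℕ → Fin 2) (f j v : ℕ) : ℕ → ℕ → Fin 2 := fun i k =>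
  if (k < j ∧ i < V) ∨ (k = j ∧ i < v) then M i k + M (pivot V M f) k * M i f else M i k

theorem partialElim_zero (f : ℕ) : partialElim V M f 0 0 = M := by
  ext1 i; ext1 k
  simp [partialElim]

theorem partialElim_next (f j : ℕ) : partialElim V M f j V = partialElim V M f (j + 1) 0 := by
  ext1 i; ext1 k
  have : (k < j ∧ i < V) ∨ (k = j ∧ i < V) ↔ (k < j + 1 ∧ i < V) ∨ (k = j + 1 ∧ i < 0) := by
    omega
  simp only [partialElim, this]

theorem partialElim_self (f : ℕ) : partialElim V M f f 0 = elimStep V M f := by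
  ext1 i; ext1 k
  simp [partialElim, elimStep]

/-- The entry of column `j` in the pivot row is saved to array 7 first, because the loop clears it
on reaching that row while later rows still need it. If column `f` is zero, the saved entry is
meaningless, but it is multiplied by zero in every row. -/
theorem det_addColumnCmd {f j : ℕ} (hj : j < f)
    (H : Holds c (partialElim V M f j 0) k r w ψ h s) (h2 : s.idx 2 = f) (h3 : s.idx 3 = j)
    (h5 : s.idx 5 = pivot V M f) :
    Det addColumnCmd s (4 * V + 5) fun s' => Holds c (partialElim V M f (j + 1) 0) k r w ψ h s' ∧
      s'.idx 2 = f ∧ s'.idx 3 = j ∧ s'.idx 5 = pivot V M f := by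
  have hp : partialElim V M f j 0 (pivot V M f) j = M (pivot V M f) j := by
    simp [partialElim]
  refine (Det.seq (det_write (Q := fun s' => Holds c (partialElim V M f j 0) k r w ψ h s' ∧
      s'.mem 7 0 0 = ((M (pivot V M f) j : ℕ) : ℝ) ∧ s'.idx = s.idx) ?_)
      fun s' hs' => ?_).mono (T := 1 + (V * (1 + 3) + 3) + 1) (by omega) fun _ h => h
  · refine ⟨H.setMem_scratch _ _ _, ?_, setMem_idx _ _ _ _ _⟩
    simp [Store.setMem, IExp.eval, RExp.eval, h5, h3, H.mem0, hp]
  · obtain ⟨g1, g2, g3⟩ := hs'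
    have key := det_forLoop (r := 4) (b := 0) (N := V) (T := 1)
      (body := .write 0 (.reg 4) (.reg 3) (addMulModTwo (.read 0 (.reg 4) (.reg 3))
        (.read 7 (.const 0) (.const 0)) (.read 0 (.reg 4) (.reg 2)))) (s := s')
      (fun v s' => Holds c (partialElim V M f j v) k r w ψ h s' ∧
        s'.mem 7 0 0 = ((M (pivot V M f) j : ℕ) : ℝ) ∧ s'.idx 2 = f ∧ s'.idx 3 = j ∧
          s'.idx 5 = pivot V M f) ?_ ?_ ?_ ?_
    · refine key.mono le_rfl fun s'' hs'' => ?_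
      rw [← partialElim_next]
      exact ⟨hs''.1, hs''.2.2⟩
    · rintro i s x ⟨a1, a2, a3, a4, a5⟩
      refine ⟨a1.setIdx (by omega) _, a2, ?_, ?_, ?_⟩
      · rwa [setIdx_idx_of_ne _ _ (by omega)]
      · rwa [setIdx_idx_of_ne _ _ (by omega)]
      · rwa [setIdx_idx_of_ne _ _ (by omega)]
    · rintro i s ⟨a1, -⟩
      exact a1.idx0
    · exact ⟨g1, g2, by rw [g3, h2], by rw [g3, h3], by rw [g3, h5]⟩
    · rintro v s hv a0 ⟨a1, a2, a3, a4, a5⟩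
      refine det_write ⟨a0, ?_, ?_, a3, a4, a5⟩
      · have e1 : partialElim V M f j v v j = M v j := by simp [partialElim]
        have e2 : partialElim V M f j v v f = M v f := by
          simp [partialElim, hj.ne', hj.le]
        have hval : (addMulModTwo (.read 0 (.reg 4) (.reg 3))
            (.read 7 (.const 0) (.const 0)) (.read 0 (.reg 4) (.reg 2))).eval s =
            (((M v j + M (pivot V M f) j * M v f : Fin 2) : ℕ) : ℝ) := by
          rw [← bit_sub_mul_sq]
          simp only [addMulModTwo, RExp.eval, IExp.eval, a0, a2, a3, a4, a1.mem0, e1, e2]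
        rw [hval, IExp.eval, IExp.eval, a0, a4]
        convert a1.setMem_matrix v j (M v j + M (pivot V M f) j * M v f) using 1
        ext1 i; ext1 k
        by_cases hik : i = v ∧ k = j
        · obtain ⟨rfl, rfl⟩ := hik
          simp [partialElim]
        · rw [if_neg hik]
          have : ((k < j ∧ i < V) ∨ (k = j ∧ i < v + 1)) ↔
              ((k < j ∧ i < V) ∨ (k = j ∧ i < v)) := by omega
          simp only [partialElim, this]
      · simpa [Store.setMem] using a2

theorem det_elimCmd (H : Holds c M k r w ψ h s) :
    Det elimCmd s (c.F * (5 * V + c.F * (4 * V + 8) + 12) + 3)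
      (Holds c (elim V c.F M) k r w ψ h) := by
  have key : ∀ f, f ≤ c.F → ∀ (M : ℕ → ℕ → Fin 2) (s : Store V), Holds c M k r w ψ h s →
      s.idx 2 = f → Det (.while (.ilt (.const 0) (.reg 2))
        (.seq (.setIdx 2 (.pred (.reg 2))) (.seq pivotCmd (forLoop 3 2 addColumnCmd)))) s
        (f * (5 * V + c.F * (4 * V + 8) + 12) + 1) (Holds c (elim V f M) k r w ψ h) := by
    intro f
    induction f with
    | zero =>
      intro _ M s H h2
      refine (det_while_false ?_ H).mono (by omega) fun _ h => h
      simp [BExp.eval, IExp.eval, h2]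
    | succ f ih =>
      intro hf M s H h2
      have hstep : Det (.seq (.setIdx 2 (.pred (.reg 2))) (.seq pivotCmd
          (forLoop 3 2 addColumnCmd))) s (5 * V + c.F * (4 * V + 8) + 11)
          fun s' => Holds c (elimStep V M f) k r w ψ h s' ∧ s'.idx 2 = f := by
        refine (Det.seq (det_setIdx (Q := fun s' => Holds c M k r w ψ h s' ∧ s'.idx 2 = f)
          ⟨H.setIdx (by omega) _, ?_⟩) fun s₁ hs₁ => Det.seq (det_pivotCmd hs₁.1 hs₁.2)
            fun s₂ hs₂ => (?_ : Det _ _ (f * ((4 * V + 5) + 3) + 3) _)).mono ?_ fun _ h => h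
        · rw [Store.setIdx_idx_self, IExp.eval, IExp.eval, h2]
          rfl
        · have := det_forLoop (r := 3) (b := 2) (N := f) (T := 4 * V + 5)
            (body := addColumnCmd) (s := s₂)
            (fun j s' => Holds c (partialElim V M f j 0) k r w ψ h s' ∧ s'.idx 2 = f ∧
              s'.idx 5 = pivot V M f) ?_ ?_ ?_ ?_
          · refine this.mono le_rfl fun s' hs' => ?_
            rw [← partialElim_self]
            exact ⟨hs'.1, hs'.2.1⟩
          · rintro i s x ⟨a1, a2, a3⟩
            refine ⟨a1.setIdx (by omega) _, ?_, ?_⟩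
            · rwa [setIdx_idx_of_ne _ _ (by omega)]
            · rwa [setIdx_idx_of_ne _ _ (by omega)]
          · rintro i s ⟨-, a2, -⟩
            exact a2
          · rw [partialElim_zero]
            exact hs₂
          · rintro j s hj a0 ⟨a1, a2, a3⟩
            exact (det_addColumnCmd hj a1 a2 a0 a3).mono le_rfl
              fun s' hs' => ⟨hs'.2.2.1, hs'.1, hs'.2.1, hs'.2.2.2⟩
        · have : f * (4 * V + 8) ≤ c.F * (4 * V + 8) := Nat.mul_le_mul_right _ (by omega)
          have e : f * (4 * V + 5 + 3) = f * (4 * V + 8) := by ring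
          omega
      refine (Det.while_true ?_ hstep fun s' hs' => ih (by omega) _ s' hs'.1 hs'.2).mono ?_
        fun _ h => h
      · simp [BExp.eval, IExp.eval, h2]
      · rw [add_mul]
        omega
  refine (Det.seq (det_setIdx (Q := fun s' => Holds c M k r w ψ h s' ∧ s'.idx 2 = c.F)
    ⟨H.setIdx (by omega) _, ?_⟩) fun s' hs' => key c.F le_rfl M s' hs'.1 hs'.2).mono ?_
    fun _ h => h
  · rw [Store.setIdx_idx_self, IExp.eval, H.idx1]
  · omega

theorem take_ofFn_succ {α : Type*} {n : ℕ} (f : Fin n → α) {i : ℕ} (hi : i < n) :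
    (List.ofFn f).take (i + 1) = (List.ofFn f).take i ++ [f ⟨i, hi⟩] := by
  rw [List.take_add_one, List.getElem?_eq_getElem (by simpa using hi)]
  simp

theorem eval_couplingExp (H : Holds c M k r w ψ h s) {a : ℕ} (ha : a < V) (h4 : s.idx 4 = a) :
    couplingExp.eval s = c.β * c.J ⟨a, ha⟩ := by
  have := H.mem2 ⟨a, ha⟩
  simp only at this
  simp [couplingExp, RExp.eval, IExp.eval, h4, H.mem1, this]

theorem eval_obsNormExp (H : Holds c M k r w ψ h s) {a : ℕ} (ha : a < V) (h4 : s.idx 4 = a) :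
    obsNormExp.eval s = obsNorm c.β (c.J ⟨a, ha⟩) := by
  simp [obsNormExp, RExp.eval, eval_couplingExp H ha h4, obsNorm, mul_assoc]

/-- By `errorScale_eq` the scale is four times a product of norms, so the program needs no power of
two. -/
theorem det_rescaleCmd (H : Holds c M k r w ψ h s) :
    Det rescaleCmd s (4 * V + 5) fun s' =>
      output s' = 4 * (r / k) * ∏ a, obsNorm c.β (c.J a) ∧ s'.history = h := by
  refine (Det.seq (det_write (Q := Holds c M k (4 * (r / k)) w ψ h) ?_) fun s' hs' =>
    ?_).mono (T := 1 + (V * (1 + 3) + 3) + 1) (by omega) fun _ h => h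
  · have := H.setMem_sum (4 * (r / k))
    simpa [RExp.eval, IExp.eval, H.mem4, H.mem5] using this
  · have := det_forLoop (r := 4) (b := 0) (N := V) (T := 1)
      (body := .write 4 (.const 0) (.const 0) (.mul (.read 4 (.const 0) (.const 0)) obsNormExp))
      (s := s') (fun i => Holds c M k
        (4 * (r / k) * ((List.ofFn fun a => obsNorm c.β (c.J a)).take i).prod) w ψ h) ?_ ?_ ?_ ?_
    · refine this.mono le_rfl fun s'' hs'' => ⟨?_, hs''.history⟩
      rw [output, hs''.mem4, List.take_of_length_le (by simp), List.prod_ofFn]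
    · exact fun i s x hs => hs.setIdx (by omega) _
    · exact fun i s hs => hs.idx0
    · simpa using hs'
    · intro i s hi h4 hs
      refine det_write ⟨h4, ?_⟩
      have := hs.setMem_sum (4 * (r / k) *
        ((List.ofFn fun a => obsNorm c.β (c.J a)).take (i + 1)).prod)
      rw [take_ofFn_succ _ hi, List.prod_append, List.prod_singleton, ← mul_assoc] at this ⊢
      simpa [RExp.eval, IExp.eval, eval_obsNormExp hs hi h4, hs.mem4] using this

end ColorCode

end

noncomputable section

namespace ColorCode

/-! ## Verification of the quantum part -/

variable {V : ℕ} {c : Params V} {M : ℕ → ℕ → Fin 2} {k r w : ℝ} {ψ : QState V}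
  {h : List (QEvent V)} {s : Store V}

/-- A basis vector up to a phase. -/
def IsBasisState (ψ : QState V) : Prop := ∃ (u : ℂ) (x : Fin V → Fin 2), ‖u‖ = 1 ∧ ψ = u • ket x

/-- On a basis vector every measurement inside a reset has a certain outcome. The global phase `u`
survives. -/
theorem det_resetCmd (H : Holds c M k r w ψ h s) (hψ : IsBasisState ψ) :
    Det resetCmd s (4 * V + 3) fun s' => ∃ u : ℂ, ‖u‖ = 1 ∧
      Holds c M k r w (u • ketZero V) (h ++ List.ofFn fun a => QEvent.reset a) s' := by
  obtain ⟨u, x, hu, rfl⟩ := hψ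
  have := det_forLoop (r := 4) (b := 0) (N := V) (T := 1) (body := .reset (.reg 4)) (s := s)
    (fun i s' => ∃ x : Fin V → Fin 2, (∀ a : Fin V, (a : ℕ) < i → x a = 0) ∧
      Holds c M k r w (u • ket x) (h ++ (List.ofFn fun a : Fin V => QEvent.reset a).take i) s')
    ?_ ?_ ?_ ?_
  · refine this.mono (by omega) fun s' ⟨x, hx, H'⟩ => ⟨u, hu, ?_⟩
    have hx0 : x = 0 := funext fun a => hx a a.2
    rw [List.take_of_length_le (by simp)] at H'
    rw [ketZero_eq_ket, ← hx0]
    exact H'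
  · rintro i s y ⟨x, hx, H'⟩
    exact ⟨x, hx, H'.setIdx (by omega) _⟩
  · rintro i s ⟨x, hx, H'⟩
    exact H'.idx0
  · exact ⟨x, by simp, by simpa using H⟩
  · rintro i s hi h4 ⟨x, hx, H'⟩
    have hq : (IExp.reg 4).eval s < V := by rw [IExp.eval, h4]; exact hi
    have hq' : (⟨(IExp.reg 4).eval s, hq⟩ : Fin V) = ⟨i, hi⟩ := Fin.ext h4
    refine det_reset hq (x ⟨i, hi⟩) ?_ ⟨h4, Function.update x ⟨i, hi⟩ 0, ?_, ?_⟩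
    · rw [hq', H'.qstate, measureOutcome_smul_ket hu]
    · intro a ha
      by_cases hai : a = ⟨i, hi⟩
      · rw [hai, Function.update_self]
      · rw [Function.update_of_ne hai]
        have : (a : ℕ) ≠ i := fun e => hai (Fin.ext e)
        exact hx a (by omega)
    · have := H'.setQuantum (u • ket (Function.update x ⟨i, hi⟩ 0))
        (h ++ (List.ofFn fun a : Fin V => QEvent.reset a).take (i + 1))
      rw [hq', H'.qstate, H'.history, reset_smul_ket hu, List.append_assoc,
        ← take_ofFn_succ (fun a : Fin V => QEvent.reset a) hi]
      exact this

theorem gateMatrix_hadamardExp (s : Store V) :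
    gateMatrix s hadamardExp (fun _ _ => .const 0) = hadamard := by
  ext i j
  apply Complex.ext
  · simp only [gateMatrix, hadamardExp, hadamard, hadamardMatrix, Matrix.of_apply, RExp.eval,
      Complex.ofReal_re]
    split_ifs <;> simp
  · simp [gateMatrix, hadamard, hadamardMatrix, RExp.eval]

/-- The loops issue exactly the gates of `codeCircuit`, in the same order, the pivots being
recomputed for each column. -/
theorem det_prepareCmd (H : Holds c M k r w ψ h s) :
    Det prepareCmd s (c.F * (10 * V + 14) + 3)
      (Holds c M k r w (runCircuit (codeCircuit V M c.F) ψ)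
        (h ++ (codeCircuit V M c.F).map .gate)) := by
  have := det_forLoop (r := 2) (b := 1) (N := c.F)
    (T := (5 * V + 5) + (1 + (V * (2 + 3) + 3) + 1) + 1)
    (body := .seq pivotCmd (.seq (.gate (.reg 5) hadamardExp fun _ _ => .const 0)
      (forLoop 4 0 (.ite (.rlt (.const 0) (.read 0 (.reg 4) (.reg 2)))
        (.cnot (.reg 5) (.reg 4)) .skip)))) (s := s)
    (fun f => Holds c M k r w (runCircuit (codeCircuit V M f) ψ)
        (h ++ (codeCircuit V M f).map .gate)) ?_ ?_ ?_ ?_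
  · refine this.mono (le_of_eq ?_) fun _ h => h
    ring
  · exact fun i s x hs => hs.setIdx (by omega) _
  · exact fun i s hs => hs.idx1
  · simpa [codeCircuit, runCircuit] using H
  · intro f s hf h2 hs
    refine Det.seq (det_pivotCmd hs h2) fun s₁ ⟨b1, b2, b5⟩ => Det.seq
      (det_gate (Q := fun s' => Holds c M k r w
        (runCircuit (codeCircuit V M f ++ singleCircuit V (pivot V M f) hadamard) ψ)
        (h ++ (codeCircuit V M f ++ singleCircuit V (pivot V M f) hadamard).map .gate) s' ∧
        s'.idx 2 = f ∧ s'.idx 5 = pivot V M f) hadamard (gateMatrix_hadamardExp _) ?_)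
        fun s₂ ⟨d1, d2, d5⟩ => ?_
    · refine ⟨?_, b2, b5⟩
      rw [IExp.eval, b5]
      exact b1.applyCircuit _
    · have := det_forLoop (r := 4) (b := 0) (N := V) (T := 2)
        (body := .ite (.rlt (.const 0) (.read 0 (.reg 4) (.reg 2)))
          (.cnot (.reg 5) (.reg 4)) .skip) (s := s₂)
        (fun j s' => Holds c M k r w
          (runCircuit (codeCircuit V M f ++ singleCircuit V (pivot V M f) hadamard ++
            (List.range j).flatMap fun v =>
              if M v f = 1 then cnotCircuit V (pivot V M f) v else []) ψ)
          (h ++ (codeCircuit V M f ++ singleCircuit V (pivot V M f) hadamard ++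
            (List.range j).flatMap fun v =>
              if M v f = 1 then cnotCircuit V (pivot V M f) v else []).map .gate) s' ∧
          s'.idx 2 = f ∧ s'.idx 5 = pivot V M f) ?_ ?_ ?_ ?_
      · refine this.mono le_rfl fun s' hs' => ⟨hs'.2.1, ?_⟩
        have e : codeCircuit V M (f + 1) = codeCircuit V M f ++
            singleCircuit V (pivot V M f) hadamard ++ (List.range V).flatMap fun v =>
              if M v f = 1 then cnotCircuit V (pivot V M f) v else [] := by
          rw [codeCircuit, List.range_succ, List.flatMap_append, List.append_assoc]
          simp [codeCircuit, columnCircuit]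
        rw [e]
        exact hs'.1
      · rintro i s x ⟨a1, a2, a3⟩
        refine ⟨a1.setIdx (by omega) _, ?_, ?_⟩
        · rwa [setIdx_idx_of_ne _ _ (by omega)]
        · rwa [setIdx_idx_of_ne _ _ (by omega)]
      · rintro i s ⟨a1, -⟩
        exact a1.idx0
      · simp only [List.range_zero, List.flatMap_nil, List.append_nil]
        exact ⟨d1, d2, d5⟩
      · rintro v s hv a4 ⟨a1, a2, a5⟩
        have hb : (BExp.rlt (.const 0) (.read 0 (.reg 4) (.reg 2))).eval s ↔ M v f = 1 := by
          simp only [BExp.eval, RExp.eval, IExp.eval, a4, a2, a1.mem0, Rat.cast_zero, bit_pos_iff]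
        rw [List.range_succ, List.flatMap_append, ← List.append_assoc]
        simp only [List.flatMap_cons, List.flatMap_nil, List.append_nil]
        refine det_ite (fun hc => det_cnot ⟨a4, ?_, a2, a5⟩) (fun hc => det_skip ⟨a4, ?_, a2, a5⟩)
        · rw [if_pos (hb.1 hc), IExp.eval, IExp.eval, a4, a5]
          exact a1.applyCircuit _
        · rw [if_neg fun e => hc (hb.2 e), List.append_nil]
          exact a1

theorem gateMatrix_rotationExp (H : Holds c M k r w ψ h s) {a : ℕ} (ha : a < V)
    (h4 : s.idx 4 = a) :
    gateMatrix s rotationExp (fun _ _ => .const 0) =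
      realGate (obsRotation c.β (c.J ⟨a, ha⟩)) := by
  have hcos : obsCosExp.eval s = obsCos c.β (c.J ⟨a, ha⟩) := by
    simp [obsCosExp, RExp.eval, eval_couplingExp H ha h4, eval_obsNormExp H ha h4, obsCos]
  have hsin : obsSinExp.eval s = obsSin c.β (c.J ⟨a, ha⟩) := by
    simp [obsSinExp, RExp.eval, eval_couplingExp H ha h4, eval_obsNormExp H ha h4, obsSin]
  ext i j
  apply Complex.ext
  · fin_cases i <;> fin_cases j <;>
      simp [gateMatrix, rotationExp, realGate, obsRotation, RExp.eval, hcos, hsin]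
  · simp [gateMatrix, realGate, RExp.eval]

theorem det_rotateCmd (H : Holds c M k r w ψ h s) :
    Det rotateCmd s (4 * V + 3) (Holds c M k r w
      (runCircuit (List.ofFn fun a => Gate.single a (realGate (obsRotation c.β (c.J a)))) ψ)
      (h ++ List.ofFn fun a =>
        QEvent.gate (Gate.single a (realGate (obsRotation c.β (c.J a)))))) := by
  have := det_forLoop (r := 4) (b := 0) (N := V) (T := 1)
    (body := .gate (.reg 4) rotationExp fun _ _ => .const 0) (s := s)
    (fun i => Holds c M k r w
      (runCircuit ((List.ofFn fun a => Gate.single a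
        (realGate (obsRotation c.β (c.J a)))).take i) ψ)
      (h ++ ((List.ofFn fun a => Gate.single a
        (realGate (obsRotation c.β (c.J a)))).take i).map .gate)) ?_ ?_ ?_ ?_
  · refine this.mono (by omega) fun s' hs' => ?_
    rw [List.take_of_length_le (by simp), List.map_ofFn] at hs'
    exact hs'
  · exact fun i s x hs => hs.setIdx (by omega) _
  · exact fun i s hs => hs.idx0
  · simpa [runCircuit] using H
  · intro i s hi h4 hs
    refine det_gate _ (gateMatrix_rotationExp hs hi h4) ⟨h4, ?_⟩
    have e : singleCircuit V ((IExp.reg 4).eval s) (realGate (obsRotation c.β (c.J ⟨i, hi⟩))) =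
        [Gate.single ⟨i, hi⟩ (realGate (obsRotation c.β (c.J ⟨i, hi⟩)))] := by
      rw [IExp.eval, h4, singleCircuit, dif_pos hi]
    rw [take_ofFn_succ _ hi, e]
    exact hs.applyCircuit _

theorem drop_ofFn {α : Type*} {n : ℕ} (f : Fin n → α) {i : ℕ} (hi : i < n) :
    (List.ofFn f).drop i = f ⟨i, hi⟩ :: (List.ofFn f).drop (i + 1) := by
  rw [List.drop_eq_getElem_cons (by simpa using hi)]
  simp

theorem bornPMF_congr {ψ φ : QState V} (hψ : normSq ψ = 1) (hφ : normSq φ = 1)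
    (h : ∀ x, ‖ψ x‖ = ‖φ x‖) : bornPMF ψ hψ = bornPMF φ hφ := by
  ext x
  simp [bornPMF, h]

/-- Induction on the number `d` of unmeasured qubits. The current state is supported on strings that
agree with `x` before position `j`, so the coupled value can be the whole outcome string, with the
joint Born law of the current state. One measurement is split off by `bornPMF_eq_bind`; with none
left, the state is a basis vector up to a phase. -/
theorem run_measureLoop (d : ℕ) :
    ∀ (j : ℕ) (_ : j + d = V) (s : Store V) (w : ℝ) (ψ : QState V) (h : List (QEvent V))
      (x : Fin V → Fin 2) (hψ : normSq ψ = 1), Holds c M k r w ψ h s → s.idx 4 = j →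
      (∀ y, (∃ a : Fin V, (a : ℕ) < j ∧ y a ≠ x a) → ψ y = 0) →
      Run (.while (.ilt (.reg 4) (.reg 0)) (.seq (.seq (.measure (.reg 4) 7 (.const 0) (.const 0))
        (.write 6 (.const 0) (.const 0) (.mul (.read 6 (.const 0) (.const 0))
          (.sub (.const 1) (.mul (.const 2) (.read 7 (.const 0) (.const 0)))))))
        (.setIdx 4 (.succ (.reg 4))))) s (d * 6 + 1) (bornPMF ψ hψ) fun y s' =>
        ∃ ψ', IsBasisState ψ' ∧ Holds c M k r
          (w * ((List.ofFn fun a => (-1 : ℝ) ^ (y a : ℕ)).drop j).prod) ψ'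
          (h ++ (List.ofFn fun a => QEvent.measured a (y a)).drop j) s' := by
  induction d with
  | zero =>
    intro j hj s w ψ h x hψ H h4 hsupp
    obtain rfl : j = V := by omega
    obtain ⟨hu, e⟩ := eq_smul_ket hψ (x := x) fun y hy => by
      obtain ⟨a, ha⟩ := Function.ne_iff.1 hy
      exact hsupp y ⟨a, a.2, ha⟩
    have hpure : bornPMF ψ hψ = PMF.pure x := by
      ext y
      by_cases hy : y = x
      · rw [bornPMF, PMF.ofFintype_apply, hy, hu]
        simp
      · have : ψ y = 0 := by rw [e]; simp [ket, hy]
        simp [bornPMF, this, hy]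
    rw [hpure]
    refine ((det_while_false ?_ H).mono (by omega) fun _ h => h).run x fun s' H' =>
      ⟨ψ, ⟨_, _, hu, e⟩, ?_⟩
    · simp [BExp.eval, IExp.eval, h4, H.idx0]
    · rw [List.drop_of_length_le (by simp), List.drop_of_length_le (by simp)]
      simpa using H'
  | succ d ih =>
    intro j hj s w ψ h x hψ H h4 hsupp
    have hjV : j < V := by omega
    have hq : (IExp.reg 4).eval s < V := by rw [IExp.eval, h4]; exact hjV
    have hq' : (⟨(IExp.reg 4).eval s, hq⟩ : Fin V) = ⟨j, hjV⟩ := Fin.ext h4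
    let q : Fin V := ⟨j, hjV⟩
    have hmeas := run_measure (s := s) (q := .reg 4) (i := .const 0) (j := .const 0) (A := 7) hq
    rw [hq', H.qstate, H.history] at hmeas
    have hstep : Run (.seq (.seq (.measure (.reg 4) 7 (.const 0) (.const 0))
        (.write 6 (.const 0) (.const 0) (.mul (.read 6 (.const 0) (.const 0))
          (.sub (.const 1) (.mul (.const 2) (.read 7 (.const 0) (.const 0)))))))
        (.setIdx 4 (.succ (.reg 4)))) s 5 (measureOutcome ψ q) fun b s' =>
        bornProb ψ q b ≠ 0 ∧ Holds c M k r (w * (-1) ^ (b : ℕ)) (collapse ψ q b)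
          (h ++ [.measured q b]) s' ∧ s'.idx 4 = j + 1 := by
      refine Run.seq_det (T₁ := 3) (T₂ := 1) (Run.seq_det (T₁ := 1) (T₂ := 1) hmeas.and_support
        (R := fun b s' => bornProb ψ q b ≠ 0 ∧ Holds c M k r (w * (-1) ^ (b : ℕ)) (collapse ψ q b)
          (h ++ [.measured q b]) s' ∧ s'.idx 4 = j) ?_) ?_
      · rintro b s' ⟨hb, rfl⟩
        refine det_write ⟨?_, ?_, h4⟩
        · rw [PMF.mem_support_iff, measureOutcome_apply hψ] at hb
          exact_mod_cast hb
        · have H1 := (((H.setMem_scratch 0 0 ((b : ℕ) : ℝ)).setQuantum (collapse ψ q b)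
            (h ++ [.measured q b])).setMem_parity (w * (-1) ^ (b : ℕ)))
          have e : w * (1 - 2 * ((b : ℕ) : ℝ)) = w * (-1) ^ (b : ℕ) := by
            have h2 : ∀ c : Fin 2, c = 0 ∨ c = 1 := by decide
            rcases h2 b with rfl | rfl <;> norm_num
          have ev : (RExp.mul (.read 6 (.const 0) (.const 0))
              (.sub (.const 1) (.mul (.const 2) (.read 7 (.const 0) (.const 0))))).eval
              { s.setMem 7 ((IExp.const 0).eval s) ((IExp.const 0).eval s) ((b : ℕ) : ℝ) with
                qstate := collapse ψ ⟨j, hjV⟩ b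
                history := h ++ [.measured ⟨j, hjV⟩ b] } = w * (-1) ^ (b : ℕ) := by
            rw [← e]
            simp [RExp.eval, IExp.eval, Store.setMem, H.mem6]
          rw [ev]
          exact H1
      · rintro b s' ⟨hb, H', h4'⟩
        refine det_setIdx ⟨hb, H'.setIdx (by omega) _, ?_⟩
        rw [Store.setIdx_idx_self, IExp.eval, IExp.eval, h4']
    -- The value on outcomes of probability zero is arbitrary.
    let κ : Fin 2 → PMF (Fin V → Fin 2) := fun b =>
      if hb : bornProb ψ q b ≠ 0 then bornPMF (collapse ψ q b) (normSq_collapse hb)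
      else bornPMF ψ hψ
    have hκ : ∀ b (hb : bornProb ψ q b ≠ 0),
        κ b = bornPMF (collapse ψ q b) (normSq_collapse hb) := fun b hb => dif_pos hb
    rw [← bornPMF_eq_bind hψ q κ hκ]
    refine (Run.while_true (T₂ := d * 6 + 1) ?_ hstep fun b s' ⟨hb, H', h4'⟩ => ?_).mono
      (by omega) fun _ _ h => h
    · simp only [BExp.eval, IExp.eval, h4, H.idx0]
      exact hjV
    · have hy : ∀ y : Fin V → Fin 2, collapse ψ q b y ≠ 0 → y q = b := by
        intro y hy
        by_contra hne
        exact hy (if_neg hne)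
      rw [hκ b hb]
      refine (ih (j + 1) (by omega) s' _ _ _ (Function.update x q b) (normSq_collapse hb) H' h4'
        ?_).and_support.mono le_rfl fun y s'' => ?_
      · rintro y ⟨a, ha, hya⟩
        by_contra hne
        by_cases haq : a = q
        · rw [haq, Function.update_self] at hya
          exact hya (hy y hne)
        · rw [Function.update_of_ne haq] at hya
          have haj : (a : ℕ) ≠ j := fun e => haq (Fin.ext e)
          refine hne ?_
          simp [collapse, hsupp y ⟨a, by omega, hya⟩]
      · rintro ⟨hsup, ψ', hψ', H''⟩
        -- The collapsed state vanishes on strings with another bit at `q`, so the final string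
        -- records the outcome just seen.
        have hyq : y q = b := by
          refine hy y fun h0 => ?_
          rw [PMF.mem_support_iff] at hsup
          exact hsup (by simp [bornPMF, h0])
        refine ⟨ψ', hψ', ?_⟩
        rw [drop_ofFn (fun a => (-1 : ℝ) ^ (y a : ℕ)) hjV,
          drop_ofFn (fun a => QEvent.measured a (y a)) hjV, List.prod_cons, ← mul_assoc]
        change Holds c M k r (w * (-1) ^ (y q : ℕ) * _) ψ' (h ++ QEvent.measured q (y q) :: _) s''
        rw [hyq]
        simpa using H''

theorem run_measureCmd (hψ : normSq ψ = 1) (H : Holds c M k r w ψ h s) :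
    Run measureCmd s (6 * V + 3) (bornPMF ψ hψ) fun y s' =>
      ∃ ψ', IsBasisState ψ' ∧ Holds c M k r (w * parity y) ψ'
          (h ++ List.ofFn fun a => QEvent.measured a (y a)) s' := by
  refine (Det.seq_run (det_setIdx (Q := fun s' => Holds c M k r w ψ h s' ∧ s'.idx 4 = 0)
    ⟨H.setIdx (by omega) _, Store.setIdx_idx_self _ _ _⟩) fun s' hs' =>
      run_measureLoop V 0 (by omega) s' w ψ h 0 hψ hs'.1 hs'.2 ?_).mono (by omega) fun y s' => ?_
  · rintro y ⟨a, ha, -⟩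
    omega
  · simp only [List.drop_zero, List.prod_ofFn]
    exact fun h => h

/-- One round of the protocol. -/
theorem run_roundCmd {F : ℕ} {m : Colex V F} (hF : c.F = F)
    (H : Holds c (elim V F (incMatrix m)) k r w ψ h s) (hψ : IsBasisState ψ) :
    Run roundCmd s (F * (10 * V + 14) + 14 * V + 21)
      (bornPMF (measuredState m c.β c.J) (normSq_measuredState m c.β c.J)) fun y s' =>
      ∃ w' ψ', IsBasisState ψ' ∧ Holds c (elim V F (incMatrix m)) (k + 1) (r + parity y) w' ψ'
          (h ++ roundEvents (omegaCircuit m)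
            (fun a => realGate (obsRotation c.β (c.J a))) y) s' := by
  subst hF
  let R : Fin V → Matrix.unitaryGroup (Fin 2) ℂ := fun a => realGate (obsRotation c.β (c.J a))
  have hfin : ∀ {w' : ℝ} {ψ' : QState V} {h' : List (QEvent V)} {s' : Store V},
      Holds c (elim V c.F (incMatrix m)) k r w' ψ' h' s' →
      Det (.seq (.write 4 (.const 0) (.const 0)
          (.add (.read 4 (.const 0) (.const 0)) (.read 6 (.const 0) (.const 0))))
        (.write 5 (.const 0) (.const 0) (.add (.read 5 (.const 0) (.const 0)) (.const 1)))) s' 3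
        (Holds c (elim V c.F (incMatrix m)) (k + 1) (r + w') w' ψ' h') := by
    intro w' ψ' h' s' H'
    refine Det.seq (T₁ := 1) (T₂ := 1) (det_write
      (Q := Holds c (elim V c.F (incMatrix m)) k (r + w') w' ψ' h') ?_)
      fun s'' H'' => det_write ?_
    · have := H'.setMem_sum (r + w')
      simpa [RExp.eval, IExp.eval, H'.mem4, H'.mem6] using this
    · have := H''.setMem_count (k + 1)
      simpa [RExp.eval, IExp.eval, H''.mem5] using this
  have hinit : ∀ {ψ' : QState V} {h' : List (QEvent V)} {s' : Store V},
      Holds c (elim V c.F (incMatrix m)) k r w ψ' h' s' →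
      Det (.write 6 (.const 0) (.const 0) (.const 1)) s' 1
        (Holds c (elim V c.F (incMatrix m)) k r 1 ψ' h') := by
    intro ψ' h' s' H'
    refine det_write ?_
    have := H'.setMem_parity 1
    simpa [RExp.eval, IExp.eval] using this
  refine Run.mono (T := (4 * V + 3) + ((c.F * (10 * V + 14) + 3) + ((4 * V + 3) +
    (1 + ((6 * V + 3) + 3 + 1) + 1) + 1) + 1) + 1) ?_ (by omega) fun _ _ h => h
  refine Det.seq_run (det_resetCmd H hψ) fun s₁ ⟨u, hu, H₁⟩ => ?_
  refine Det.seq_run (det_prepareCmd H₁) fun s₂ H₂ => ?_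
  refine Det.seq_run (det_rotateCmd H₂) fun s₃ H₃ => ?_
  refine Det.seq_run (hinit H₃) fun s₄ H₄ => ?_
  -- The phase left by the resets passes through the linear circuits and does not affect the Born
  -- probabilities.
  have hstate : runCircuit (List.ofFn fun a => Gate.single a (R a))
      (runCircuit (codeCircuit V (elim V c.F (incMatrix m)) c.F) (u • ketZero V)) =
        u • measuredState m c.β c.J := by
    rw [runCircuit_smul, runCircuit_smul]
    change u • runCircuit _ (runCircuit (omegaCircuit m) _) = _
    rw [runCircuit_omegaCircuit]
    rfl
  rw [hstate] at H₄
  have hn : normSq (u • measuredState m c.β c.J) = 1 := by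
    rw [normSq_smul, hu, normSq_measuredState]
    norm_num
  have hborn := bornPMF_congr hn (normSq_measuredState m c.β c.J) fun x => by
    simp [hu]
  rw [← hborn]
  refine Run.seq_det (T₁ := 6 * V + 3) (T₂ := 3) (run_measureCmd hn H₄) fun y s₅ ⟨ψ', hψ', H₅⟩ =>
    (hfin H₅).mono le_rfl fun s₆ H₆ => ⟨parity y, ψ', hψ', ?_⟩
  rw [one_mul] at H₆
  have e : h ++ roundEvents (omegaCircuit m) R y = h ++ (List.ofFn fun a => QEvent.reset a) ++
      (codeCircuit V (elim V c.F (incMatrix m)) c.F).map QEvent.gate ++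
      (List.ofFn fun a => QEvent.gate (Gate.single a (R a))) ++
      List.ofFn fun a => QEvent.measured a (y a) := by
    simp only [roundEvents, List.append_assoc]
    rfl
  rw [e]
  exact H₆

theorem moreRounds_iff (H : Holds c M k r w ψ h s) :
    moreRounds.eval s ↔ 1 - c.p < 2 * Real.exp (-k * c.ε ^ 2 / 2) := by
  simp [moreRounds, BExp.eval, RExp.eval, IExp.eval, H.mem3, H.mem3', H.mem5, pow_two]

/-- The rounds of the protocol. -/
theorem run_rounds {F K : ℕ} {m : Colex V F} (hF : c.F = F)
    (hK : ∀ j : ℕ, 1 - c.p < 2 * Real.exp (-(j : ℝ) * c.ε ^ 2 / 2) ↔ j < K) (d : ℕ) :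
    ∀ (j : ℕ) (_ : j + d = K) (s : Store V) (r w : ℝ) (ψ : QState V) (h : List (QEvent V)),
      Holds c (elim V F (incMatrix m)) j r w ψ h s → IsBasisState ψ →
      Run (.while moreRounds roundCmd) s (d * (F * (10 * V + 14) + 14 * V + 22) + 1)
        (iid (bornPMF (measuredState m c.β c.J) (normSq_measuredState m c.β c.J)) d) fun x s' =>
        ∃ w' ψ', Holds c (elim V F (incMatrix m)) K (r + ∑ i, parity (x i)) w' ψ'
          (h ++ (List.ofFn fun i => roundEvents (omegaCircuit m)
            (fun a => realGate (obsRotation c.β (c.J a))) (x i)).flatten) s' := by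
  induction d with
  | zero =>
    intro j hj s r w ψ h H hψ
    obtain rfl : j = K := by omega
    refine ((det_while_false ?_ H).mono (by omega) fun _ h => h).run _ fun s' H' => ⟨w, ψ, ?_⟩
    · rw [moreRounds_iff H, hK]
      exact lt_irrefl j
    · simpa using H'
  | succ d ih =>
    intro j hj s r w ψ h H hψ
    refine (Run.while_true ((moreRounds_iff H).2 ((hK j).2 (by omega)))
      (run_roundCmd hF H hψ) fun y s' ⟨w', ψ', hψ', H'⟩ => ?_).mono
      (T := (F * (10 * V + 14) + 14 * V + 21) +
        (d * (F * (10 * V + 14) + 14 * V + 22) + 1) + 1) ?_ fun _ _ h => h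
    · have H'' := H'
      rw [← Nat.cast_succ] at H''
      refine (ih (j + 1) (by omega) s' _ _ _ _ H'' hψ').map _ fun x s'' => ?_
      rintro ⟨w'', ψ'', H₃⟩
      refine ⟨w'', ψ'', ?_⟩
      rw [Fin.sum_univ_succ, List.ofFn_succ, List.flatten_cons, ← add_assoc, ← List.append_assoc]
      simpa using H₃
    · rw [add_mul]
      omega

/-- The whole program, for a number `K` of rounds determined by `ε` and `p`. -/
theorem run_estimateCmd {F K : ℕ} (m : Colex V F) (β : ℝ) (J : Fin V → ℝ) (ε p : ℝ)
    (hK : ∀ j : ℕ, 1 - p < 2 * Real.exp (-(j : ℝ) * ε ^ 2 / 2) ↔ j < K) :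
    Run estimateCmd (inputStore m β J ε p)
      (F * (5 * V + F * (4 * V + 8) + 12) + K * (F * (10 * V + 14) + 14 * V + 22) + 4 * V + 11)
      (iid (bornPMF (measuredState m β J) (normSq_measuredState m β J)) K) fun x s' =>
      s'.history = (List.ofFn fun i => roundEvents (omegaCircuit m)
        (fun a => realGate (obsRotation β (J a))) (x i)).flatten ∧
      output s' = errorScale F β J * ((∑ i, parity (x i)) / K) := by
  let c : Params V := ⟨F, β, J, ε, p⟩
  have H : Holds c (incMatrix m) (0 : ℕ) 0 0 (ketZero V) [] (inputStore m β J ε p) := by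
    constructor
    case mem0 =>
      intro i j
      simp only [inputStore, incMatrix, if_true]
      split_ifs <;> simp
    all_goals simp [inputStore, c]
  have hbasis : IsBasisState (ketZero V) := ⟨1, 0, by simp, by simp [ketZero_eq_ket]⟩
  refine (Det.seq_run (det_elimCmd H) fun s₁ H₁ => Run.seq_det
    (run_rounds (c := c) (F := F) rfl hK K 0 (by omega) s₁ _ _ _ _ H₁ hbasis)
    fun x s₂ ⟨w', ψ', H₂⟩ => det_rescaleCmd H₂).mono ?_ fun x s' hs' => ?_
  · change F * (5 * V + F * (4 * V + 8) + 12) + 3 +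
      (K * (F * (10 * V + 14) + 14 * V + 22) + 1 + (4 * V + 5) + 1) + 1 ≤ _
    omega
  · refine ⟨by simpa using hs'.2, ?_⟩
    rw [hs'.1, errorScale_eq, zero_add]
    ring

end ColorCode

end

noncomputable section

namespace ColorCode

/-! ## Running time and success probability -/

/-- The number of rounds is the least one that makes the failure probability small enough. -/
def numRounds (ε p : ℝ) : ℕ := ⌈2 * Real.log (2 / (1 - p)) / ε ^ 2⌉₊

/-- Taking logarithms turns the loop test into a strict upper bound on `j`, so the test first fails
at the ceiling. -/
theorem lt_numRounds_iff {ε p : ℝ} (hε : 0 < ε) (hp : p < 1) (j : ℕ) :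
    1 - p < 2 * Real.exp (-(j : ℝ) * ε ^ 2 / 2) ↔ j < numRounds ε p := by
  have h1 : 0 < 1 - p := by linarith
  rw [numRounds, Nat.lt_ceil, lt_div_iff₀ (by positivity), Real.log_div (by norm_num) h1.ne',
    ← Real.log_lt_log_iff h1 (by positivity), Real.log_mul (by norm_num) (Real.exp_ne_zero _),
    Real.log_exp]
  constructor <;> intro h <;> linarith

theorem numRounds_pos {ε p : ℝ} (hε : 0 < ε) (hp0 : 0 < p) (hp : p < 1) : 0 < numRounds ε p := by
  rw [← lt_numRounds_iff hε hp]
  simp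
  linarith

/-- The terms not proportional to log(1 / (1 - p)) are log 2 from the two tails and 1 from the
ceiling. They are absorbed using ε ≤ ε₀ and the positive lower bound that p₀ gives for this
logarithm. -/
theorem numRounds_le {ε₀ p₀ ε p : ℝ} (hp₀ : 0 < p₀) (hε : 0 < ε)
    (hεε₀ : ε ≤ ε₀) (hpp₀ : p₀ ≤ p) (hp : p < 1) :
    (numRounds ε p : ℝ) ≤ (2 + (2 * Real.log 2 + ε₀ ^ 2) / Real.log (1 / (1 - p₀))) *
      (1 / ε ^ 2 * Real.log (1 / (1 - p))) := by
  have h1 : 0 < 1 - p := by linarith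
  set L₀ := Real.log (1 / (1 - p₀)) with hL₀
  set L := Real.log (1 / (1 - p)) with hL
  have hL₀pos : 0 < L₀ := Real.log_pos (by rw [lt_div_iff₀ (by linarith)]; linarith)
  have hLL : L₀ ≤ L := by
    have h0 : 0 < 1 - p₀ := by linarith
    exact Real.log_le_log (by positivity) (one_div_le_one_div_of_le h1 (by linarith))
  have hlog : Real.log (2 / (1 - p)) = Real.log 2 + L := by
    rw [hL, ← Real.log_mul (by norm_num) (by positivity)]
    congr 1
    ring
  have hlog2 : 0 < Real.log 2 := Real.log_pos (by norm_num)
  have hε2 : 0 < ε ^ 2 := by positivity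
  have hε₀2 : ε ^ 2 ≤ ε₀ ^ 2 := by gcongr
  have hceil : (numRounds ε p : ℝ) ≤ 2 * Real.log (2 / (1 - p)) / ε ^ 2 + 1 := by
    refine (Nat.ceil_lt_add_one ?_).le
    rw [hlog]
    have : 0 < L := by linarith
    positivity
  have hratio : 1 ≤ L / L₀ := by rwa [one_le_div hL₀pos]
  calc (numRounds ε p : ℝ) ≤ 2 * (Real.log 2 + L) / ε ^ 2 + 1 := by rw [← hlog]; exact hceil
    _ = (2 * L + 2 * Real.log 2 + ε ^ 2) / ε ^ 2 := by field_simp; ring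
    _ ≤ (2 * L + (2 * Real.log 2 + ε₀ ^ 2) * (L / L₀)) / ε ^ 2 := by
        have : 2 * Real.log 2 + ε ^ 2 ≤ (2 * Real.log 2 + ε₀ ^ 2) * (L / L₀) :=
          (show _ ≤ 2 * Real.log 2 + ε₀ ^ 2 by linarith).trans
            (le_mul_of_one_le_right (by positivity) hratio)
        exact div_le_div_of_nonneg_right (by linarith) hε2.le
    _ = (2 + (2 * Real.log 2 + ε₀ ^ 2) / L₀) * (1 / ε ^ 2 * L) := by ring

/-- A bound on the number of steps of the program. -/
theorem steps_le {V F K : ℕ} (hV : 0 < V) (hF : F ≤ 3 * V) (hK : 0 < K) :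
    F * (5 * V + F * (4 * V + 8) + 12) + K * (F * (10 * V + 14) + 14 * V + 22) + 4 * V + 11 ≤
      300 * (V ^ 3 * K) := by
  -- Insert F ≤ 3V and raise the lower-order terms by 1 ≤ V: 3 · (5 + 36 + 12) = 159.
  have h1 : F * (5 * V + F * (4 * V + 8) + 12) ≤ 159 * V ^ 3 := by
    calc F * (5 * V + F * (4 * V + 8) + 12)
        ≤ (3 * V) * (5 * (V * V) + (3 * V) * (4 * V + 8 * V) + 12 * (V * V)) := by
          gcongr <;> nlinarith
      _ = 159 * V ^ 3 := by ring
  have hV2 : V ≤ V ^ 3 := Nat.le_self_pow (by norm_num) V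
  have hV3 : V ^ 2 ≤ V ^ 3 := Nat.pow_le_pow_right hV (by norm_num)
  have h2 : F * (10 * V + 14) + 14 * V + 22 ≤ 108 * V ^ 3 := by
    calc F * (10 * V + 14) + 14 * V + 22
        ≤ (3 * V) * (10 * V + 14 * V) + 14 * V + 22 * V := by
          gcongr <;> omega
      _ = 72 * V ^ 2 + 36 * V := by ring
      _ ≤ 108 * V ^ 3 := by omega
  have h3 : 159 * V ^ 3 + 4 * V + 11 ≤ 174 * V ^ 3 := by omega
  calc _ ≤ 159 * V ^ 3 + K * (108 * V ^ 3) + 4 * V + 11 := by gcongr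
    _ ≤ 174 * V ^ 3 + K * (108 * V ^ 3) := by omega
    _ ≤ 174 * V ^ 3 * K + K * (108 * V ^ 3) := by
        exact Nat.add_le_add_right (Nat.le_mul_of_pos_right _ hK) _
    _ = 282 * (V ^ 3 * K) := by ring
    _ ≤ 300 * (V ^ 3 * K) := by gcongr; norm_num

theorem parity_mem_Icc {n : ℕ} (x : Fin n → Fin 2) : parity x ∈ Set.Icc (-1 : ℝ) 1 := by
  have : |parity x| = 1 := by
    rw [parity, Finset.abs_prod]
    exact Finset.prod_eq_one fun a _ => by simp
  exact abs_le.1 this.le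

theorem Run.runFor_eq {n : ℕ} {α : Type} {P : Cmd} {s : Store n} {T : ℕ} {μ : PMF α}
    {Q : α → Store n → Prop} (h : Run P s T μ Q) :
    ∃ ρ : PMF (α × Store n), ρ.map Prod.fst = μ ∧ (∀ z ∈ ρ.support, Q z.1 z.2) ∧
      runFor T ([P], s) = ρ.map fun z => ([], z.2) := by
  obtain ⟨ρ, h1, h2, h3⟩ := h
  refine ⟨ρ, h1, h2, ?_⟩
  rw [h3.halts T le_rfl, PMF.map_comp]
  rfl

theorem Run.support {n : ℕ} {α : Type} {P : Cmd} {s : Store n} {T : ℕ} {μ : PMF α}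
    {Q : α → Store n → Prop} (h : Run P s T μ Q) :
    ∀ c ∈ (runFor T ([P], s)).support, c.1 = [] ∧ ∃ a, Q a c.2 := by
  obtain ⟨ρ, -, h2, h3⟩ := h.runFor_eq
  intro c hc
  rw [h3, PMF.support_map] at hc
  obtain ⟨z, hz, rfl⟩ := hc
  exact ⟨rfl, z.1, h2 z hz⟩

/-- The coupling carries a lower bound for an event about the random value over to an event about
the final configuration. -/
theorem Run.le_toOuterMeasure {n : ℕ} {α : Type} {P : Cmd} {s : Store n} {T : ℕ} {μ : PMF α}
    {Q : α → Store n → Prop} (h : Run P s T μ Q) {A : Set α} {B : Set (Config n)}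
    (hAB : ∀ a s', a ∈ A → Q a s' → ([], s') ∈ B) :
    μ.toOuterMeasure A ≤ (runFor T ([P], s)).toOuterMeasure B := by
  obtain ⟨ρ, rfl, h2, h3⟩ := h.runFor_eq
  rw [h3, PMF.toOuterMeasure_map_apply, PMF.toOuterMeasure_map_apply]
  exact PMF.toOuterMeasure_mono _ fun z hz => hAB z.1 z.2 hz.1 (h2 z hz.2)

theorem sum_bornPMF_mul_parity {V F : ℕ} (m : Colex V F) (β : ℝ) (J : Fin V → ℝ) :
    errorScale F β J * ∑ x, (bornPMF (measuredState m β J) (normSq_measuredState m β J) x).toReal *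
      parity x = partitionFunction m β J := by
  rw [← errorScale_mul_sum_parity]
  congr 1
  refine Finset.sum_congr rfl fun x _ => ?_
  rw [bornPMF, PMF.ofFintype_apply, ENNReal.toReal_ofReal (by positivity), mul_comm]

end ColorCode

end

open ColorCode in
theorem mainTheorem5 :
    ∃ (P : Cmd) (W : ∀ {V F : ℕ}, Colex V F → List (Gate V))
      (O : ℝ → ℝ → Matrix.orthogonalGroup (Fin 2) ℝ),
      -- `A_a = O_aᵀ Z O_a`, where `O_a = O β (J a)`
      (∀ β J : ℝ, obsA β J =
        (O β J : Matrix (Fin 2) (Fin 2) ℝ).transpose * pauliZ * (O β J : Matrix _ _ ℝ)) ∧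
      -- the circuit `W m` prepares `|Ω⟩` and has `O(V ^ 3)` gates
      (∀ (V F : ℕ) (m : Colex V F), runCircuit (W m) (ketZero V) = omega m) ∧
      (∃ C : ℝ, ∀ (V F : ℕ) (m : Colex V F), ((W m).length : ℝ) ≤ C * (V : ℝ) ^ 3) ∧
      -- the program `P`, for `ε` bounded above and `p` bounded away from `0`
      ∀ ε₀ p₀ : ℝ, 0 < ε₀ → 0 < p₀ → p₀ < 1 → ∃ C : ℝ,
        ∀ (V F : ℕ) (m : Colex V F) (β : ℝ) (J : Fin V → ℝ) (ε p : ℝ),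
          0 < ε → ε ≤ ε₀ → p₀ ≤ p → p < 1 →
          ∃ T K : ℕ,
            (T : ℝ) ≤ C * ((V : ℝ) ^ 3 * (1 / ε ^ 2) * Real.log (1 / (1 - p))) ∧
            0 < K ∧
            -- after `T` steps the machine has halted, having run `K` rounds of the protocol,
            -- and its output is the rescaled average of the measured parities
            (∀ c ∈ (runFor T ([P], inputStore m β J ε p)).support,
              c.1 = [] ∧
              ∃ x : Fin K → Fin V → Fin 2,
                c.2.history = (List.ofFn fun k =>
                  roundEvents (W m) (fun a => realGate (O β (J a))) (x k)).flatten ∧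
                output c.2 = errorScale F β J * ((∑ k, parity (x k)) / K)) ∧
            -- the output is an estimate of the partition function
            ENNReal.ofReal p ≤ (runFor T ([P], inputStore m β J ε p)).toOuterMeasure
              {c | |output c.2 - partitionFunction m β J| ≤ errorScale F β J * ε} := by
  refine ⟨estimateCmd, omegaCircuit, obsRotation, obsA_eq,
    fun V F m => runCircuit_omegaCircuit m, ⟨6, fun V F m => ?_⟩, ?_⟩
  · exact_mod_cast length_omegaCircuit_le m
  · intro ε₀ p₀ hε₀ hp₀ hp₀1
    refine ⟨300 * (2 + (2 * Real.log 2 + ε₀ ^ 2) / Real.log (1 / (1 - p₀))),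
      fun V F m β J ε p hε hεε₀ hpp₀ hp => ?_⟩
    have hK := numRounds_pos hε (hp₀.trans_le hpp₀) hp
    have hrun := run_estimateCmd m β J ε p (lt_numRounds_iff hε hp)
    refine ⟨_, numRounds ε p, ?_, hK, hrun.support, ?_⟩
    · have h1 := steps_le m.vertex_card_pos m.face_card_le hK
      have h2 := numRounds_le hp₀ hε hεε₀ hpp₀ hp
      calc _ ≤ ((300 * (V ^ 3 * numRounds ε p) : ℕ) : ℝ) := by exact_mod_cast h1
        _ = 300 * (V : ℝ) ^ 3 * numRounds ε p := by push_cast; ring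
        _ ≤ 300 * (V : ℝ) ^ 3 * _ := mul_le_mul_of_nonneg_left h2 (by positivity)
        _ = _ := by ring
    -- The exit condition of the loop is exactly the hypothesis of Hoeffding's inequality.
    · have hfail : 2 * Real.exp (-(numRounds ε p : ℝ) * ε ^ 2 / 2) ≤ 1 - p :=
        not_lt.1 fun h => lt_irrefl _ ((lt_numRounds_iff hε hp _).1 h)
      refine (iid_mean_close _ parity parity_mem_Icc hK hε.le hfail).trans
        (hrun.le_toOuterMeasure fun x s' hx hs' => ?_)
      have hx' : |(∑ k, parity (x k)) / (numRounds ε p : ℝ) -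
        ∑ b, (bornPMF (measuredState m β J) (normSq_measuredState m β J) b).toReal * parity b| ≤ ε :=
        hx
      change |output s' - partitionFunction m β J| ≤ _
      rw [hs'.2, ← sum_bornPMF_mul_parity, ← mul_sub, abs_mul, abs_of_pos (errorScale_pos F β J)]
      exact mul_le_mul_of_nonneg_left hx' (errorScale_pos F β J).le
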